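/- **Problems.** All metric spaces are finite with rational distances; an instance is given by its distance matrix, the explicit list of its points, and its numerical parameters, all numbers in binary. *Pairwise Fair $k$-Median with $\ell$ disjoint groups.* Given are a finite metric space $(\Omega,d)$, finitely many points, each placed at a location of $\Omega$ (several points may share a location) and belonging to exactly one of the groups $P_1,\dots,P_\ell$, and integers $k\ge 0$ and $t\ge 1$. A feasible solution consists of at most $k$ clusters $X_1,X_2,\dots$ partitioning the points (clusters may be empty), with centers $c_1,c_2,\dots\in\Omega$, such that $|X_j\cap P_a|\le t\,|X_j\cap P_b|$ for every cluster $X_j$ and all $a,b\in\{1,\dots,\ell\}$. Its cost, to be minimized, is $\sum_j\sum_{p\in X_j} d(p,c_j)$. *Soft Uniform Capacitated $k$-Median.* Given are a finite metric space $(X,d)$ and integers $k,u\ge 0$. A feasible solution consists of at most $k$ facilities $f_1,f_2,\dots\in X$ (several facilities may be at the same location) and an assignment of each point $x\in X$ to a facility $f_{a(x)}$ such that at most $u$ points are assigned to each facility. Its cost, to be minimized, is $\sum_{x\in X} d(x,f_{a(x)})$. A *polynomial-time $\alpha$-approximation algorithm* for one of these problems runs on every instance in time polynomial in the length of the instance and,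 on every instance that has a feasible solution, returns a feasible solution of cost at most $\alpha$ times the minimum cost; here $\alpha\ge 1$ may be a constant or, more generally, any function $\alpha=\alpha(k)\ge 1$ of the parameter $k$ of the instance. **Theorem.** Assume that there is a polynomial-time $\alpha$-approximation algorithm for Pairwise Fair $k$-Median with $\ell=2$ disjoint groups. Then, for every constant $\varepsilon>0$, there is a polynomial-time $(1+\varepsilon)\alpha$-approximation algorithm for Soft Uniform Capacitated $k$-Median. -/

import Mathlib

/-! ### A machine model: while-programs over binary trees, with running time -/

/-- Binary trees (S-expressions), the data that programs manipulate. -/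
inductive Data where
  | nil : Data
  | node : Data → Data → Data

namespace Data

/-- Number of nodes of a tree, leaves included. -/
def size : Data → ℕ
  | nil => 1
  | node l r => l.size + r.size + 1

/-- Left subtree; `nil` for the empty tree. -/
def left : Data → Data
  | nil => nil
  | node l _ => l

/-- Right subtree; `nil` for the empty tree. -/
def right : Data → Data
  | nil => nil
  | node _ r => r

/-- A list of trees as a right comb. -/
def ofList : List Data → Data
  | [] => nil
  | x :: xs => node x (ofList xs)

def ofBool : Bool → Data
  | false => nil
  | true => node nil nil

/-- Natural numbers in binary, least significant bit first. -/
def ofNat (n : ℕ) : Data :=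
  ofList (n.bits.map ofBool)

/-- Nonnegative rationals as numerator and denominator in binary, in lowest terms. -/
def ofNNRat (q : ℚ≥0) : Data :=
  node (ofNat q.num) (ofNat q.den)

/-- A function on `{0, …, n - 1}` as the list of its values. -/
def ofFn {n : ℕ} (f : Fin n → Data) : Data :=
  ofList (List.ofFn f)

end Data

/-- A memory state: the contents of the variables `0, 1, 2, …`. -/
abbrev Store := ℕ → Data

/-- Expressions of the programming language. -/
inductive Expr where
  | var : ℕ → Expr
  | nil : Expr
  | node : Expr → Expr → Expr
  | left : Expr → Expr
  | right : Expr → Expr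

namespace Expr

def eval (s : Store) : Expr → Data
  | var x => s x
  | nil => Data.nil
  | node a b => Data.node (a.eval s) (b.eval s)
  | left a => (a.eval s).left
  | right a => (a.eval s).right

/-- Time to evaluate an expression: every operation costs the size of the tree it produces, so
that unbounded copying of trees is never free. -/
def time (s : Store) : Expr → ℕ
  | var x => (s x).size
  | nil => 1
  | node a b => a.time s + b.time s + (Data.node (a.eval s) (b.eval s)).size
  | left a => a.time s + (a.eval s).left.size
  | right a => a.time s + (a.eval s).right.size

end Expr

/-- While-programs. A test succeeds when its expression is not `nil`. -/
inductive Prog where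
  | assign : ℕ → Expr → Prog
  | seq : Prog → Prog → Prog
  | cond : Expr → Prog → Prog → Prog
  | loop : Expr → Prog → Prog

/-- `Exec c s s' m`: started in the state `s`, the program `c` halts in the state `s'`
after time `m`. -/
inductive Exec : Prog → Store → Store → ℕ → Prop where
  | assign (x : ℕ) (e : Expr) (s : Store) :
      Exec (.assign x e) s (Function.update s x (e.eval s)) (e.time s + 1)
  | seq {c₁ c₂ : Prog} {s₁ s₂ s₃ : Store} {m₁ m₂ : ℕ} :
      Exec c₁ s₁ s₂ m₁ → Exec c₂ s₂ s₃ m₂ → Exec (.seq c₁ c₂) s₁ s₃ (m₁ + m₂)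
  | cond_true {e : Expr} {c₁ c₂ : Prog} {s s' : Store} {m : ℕ} :
      e.eval s ≠ Data.nil → Exec c₁ s s' m → Exec (.cond e c₁ c₂) s s' (e.time s + 1 + m)
  | cond_false {e : Expr} {c₁ c₂ : Prog} {s s' : Store} {m : ℕ} :
      e.eval s = Data.nil → Exec c₂ s s' m → Exec (.cond e c₁ c₂) s s' (e.time s + 1 + m)
  | loop_true {e : Expr} {c : Prog} {s₁ s₂ s₃ : Store} {m₁ m₂ : ℕ} :
      e.eval s₁ ≠ Data.nil → Exec c s₁ s₂ m₁ → Exec (.loop e c) s₂ s₃ m₂ →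
        Exec (.loop e c) s₁ s₃ (e.time s₁ + 1 + m₁ + m₂)
  | loop_false {e : Expr} {c : Prog} {s : Store} :
      e.eval s = Data.nil → Exec (.loop e c) s s (e.time s + 1)

/-- The initial state: the input is in variable `0`, all other variables are empty. -/
def Store.init (x : Data) : Store :=
  fun i => if i = 0 then x else Data.nil

/-- On input `x` the program `c` halts after time `m` with output `y` (in variable `0`). -/
def Prog.Outputs (c : Prog) (x y : Data) (m : ℕ) : Prop :=
  ∃ s : Store, Exec c (Store.init x) s m ∧ s 0 = y

/-! ### Minimization problems and polynomial-time approximation -/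

/-- A minimization problem: instances, feasible solutions of each instance, their costs, and
the encodings of instances and solutions. -/
structure MinProblem where
  Inst : Type
  Sol : Inst → Type
  cost : (I : Inst) → Sol I → ℚ≥0
  encInst : Inst → Data
  encSol : (I : Inst) → Sol I → Data

/-- There is a program that halts on every instance in time polynomial in the size of the
encoded instance, and that, on every instance `I` that has a feasible solution, outputs a
feasible solution whose cost is at most `α I` times the cost of every feasible solution. -/
def MinProblem.HasPolyTimeApprox (Q : MinProblem) (α : Q.Inst → ℝ) : Prop :=
  ∃ (c : Prog) (p : Polynomial ℕ), ∀ I : Q.Inst, ∃ (y : Data) (m : ℕ),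
    c.Outputs (Q.encInst I) y m ∧ m ≤ p.eval (Q.encInst I).size ∧
    (Nonempty (Q.Sol I) →
      ∃ S : Q.Sol I, y = Q.encSol I S ∧ ∀ S' : Q.Sol I, (Q.cost I S : ℝ) ≤ α I * Q.cost I S')

/-! ### The two clustering problems -/

/-- A finite metric space on the points `0, …, n - 1` with rational distances. -/
structure FinMetric where
  n : ℕ
  dist : Fin n → Fin n → ℚ≥0
  dist_eq_zero : ∀ x y, dist x y = 0 ↔ x = y
  dist_comm : ∀ x y, dist x y = dist y x
  dist_triangle : ∀ x y z, dist x z ≤ dist x y + dist y z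

/-- The distance matrix, row by row. -/
def FinMetric.encode (X : FinMetric) : Data :=
  Data.ofFn fun x => Data.ofFn fun y => Data.ofNNRat (X.dist x y)

/-- An instance of pairwise fair `k`-median with `ℓ` disjoint groups: a metric space of
locations, `N` points, each with a location (several points may share one) and a group, the
number `k` of clusters and the balance parameter `t`. -/
structure PairwiseFairInst (ℓ : ℕ) where
  space : FinMetric
  N : ℕ
  loc : Fin N → Fin space.n
  group : Fin N → Fin ℓ
  k : ℕ
  t : ℕ
  one_le_t : 1 ≤ t

def PairwiseFairInst.encode {ℓ : ℕ} (I : PairwiseFairInst ℓ) : Data :=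
  .node I.space.encode
    (.node (Data.ofFn fun p => .node (Data.ofNat (I.loc p)) (Data.ofNat (I.group p)))
      (.node (Data.ofNat I.k) (Data.ofNat I.t)))

/-- A pairwise fair clustering: at most `k` clusters with their centers, and an assignment of
the points to the clusters, such that in every cluster the number of points of any group is at
most `t` times (and hence at least `1 / t` times) that of any other group. -/
structure PairwiseFairSol {ℓ : ℕ} (I : PairwiseFairInst ℓ) where
  numClusters : ℕ
  numClusters_le : numClusters ≤ I.k
  center : Fin numClusters → Fin I.space.n
  assign : Fin I.N → Fin numClusters
  fair : ∀ (j : Fin numClusters) (a b : Fin ℓ),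
    (Finset.univ.filter fun p => assign p = j ∧ I.group p = a).card ≤
      I.t * (Finset.univ.filter fun p => assign p = j ∧ I.group p = b).card

/-- Pairwise fair `k`-median with `ℓ` disjoint groups. -/
def pairwiseFairKMedian (ℓ : ℕ) : MinProblem where
  Inst := PairwiseFairInst ℓ
  Sol := PairwiseFairSol
  cost I S := ∑ p, I.space.dist (I.loc p) (S.center (S.assign p))
  encInst I := I.encode
  encSol _ S := .node (Data.ofFn fun j => Data.ofNat (S.center j))
    (Data.ofFn fun p => Data.ofNat (S.assign p))

/-- An instance of soft uniform capacitated `k`-median: a metric space, whose points are both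
the clients and the possible facility locations, the number `k` of facilities and the
capacity `u`. -/
structure SoftCkMInst where
  space : FinMetric
  k : ℕ
  u : ℕ

def SoftCkMInst.encode (I : SoftCkMInst) : Data :=
  .node I.space.encode (.node (Data.ofNat I.k) (Data.ofNat I.u))

/-- At most `k` facilities, several of which may be at the same location, and an assignment of
all points to the facilities with at most `u` points at each facility. -/
structure SoftCkMSol (I : SoftCkMInst) where
  numFacilities : ℕ
  numFacilities_le : numFacilities ≤ I.k
  facility : Fin numFacilities → Fin I.space.n
  assign : Fin I.space.n → Fin numFacilities
  capacity : ∀ j : Fin numFacilities, (Finset.univ.filter fun x => assign x = j).card ≤ I.u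

/-- Soft uniform capacitated `k`-median. -/
def softCapacitatedKMedian : MinProblem where
  Inst := SoftCkMInst
  Sol := SoftCkMSol
  cost I S := ∑ x, I.space.dist x (S.facility (S.assign x))
  encInst I := I.encode
  encSol _ S := .node (Data.ofFn fun j => Data.ofNat (S.facility j))
    (Data.ofFn fun x => Data.ofNat (S.assign x))

/-! ### Renaming, frames and clean-up of programs -/

/-! Let `n` be the number of points of the capacitated instance, with `0 < n ≤ k * u`; for nonempty
spaces this inequality is exactly feasibility. The fair instance has `M` copies of every point in
one group, at most `k` single points in the other group, the same `k`, and `t = u * M`. A cluster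
with `q` points of the second group can hold at most `q * u * M` copies, so each of these points
acts as a permit for one facility of capacity `u`.

A capacitated solution of cost `C` becomes a fair clustering by giving every used facility a permit;
the cost is at most `M * C` plus the cost of the permits (`SoftCkMSol.exists_fair`). Conversely, a
fair clustering divided by `M` is a fractional assignment in which a location `c` serves at most `u
* b c` clients, where `b c` counts the permits in clusters centered at `c` and the sum of `b` is at
most `k`. By integrality of transportation problems it can be rounded at no extra cost
(`PairwiseFairSol.rounded_spec`). For `M` a power of two this is elementary: orient the bipartite
multigraph of points and locations so that in-degree and out-degree differ by at most one everywhere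
(`abs_excess_orient_le`). The two directions split the edges into halves, each with half of the
edges at every point and with at most half of the load bound at every location; the cheaper half is
kept. After `log M` rounds one edge per point is left, and greedy filling at each location opens at
most `b c` facilities (`length_pack_le`).

The permits must cost little compared with `M` times the optimum `OPT`, although `M` is polynomial
in `n`. Hence distances are made integral and truncated just above the cost `F` of a crude solution
with `F ≤ n² * OPT` (`fallback_spec`). If `OPT > 0`, the permits cost at most `n * (F + 1) ≤ 2 * n³
* OPT`, and `M ≥ n³ * 2 ^ c` with `ε * 2 ^ c ≥ 2` suffices. If `OPT = 0`, the crude solution is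
optimal. The better of the crude and the rounded solution is returned, so truncation does no harm:
where it matters, even the truncated cost of the rounded solution exceeds `F`. Since `k` is
unchanged, a factor depending on `k` is preserved. `SoftCkMInst.exists_fairInst` assembles this
argument.

The remaining work is to show that the reduction runs in polynomial time on the given machine.
`PolyTime` is the class of functions computed by programs that leave all auxiliary variables empty;
it is closed under composition, pairing, case distinction and folds whose intermediate states stay
polynomially bounded, and the whole algorithm is written as list functions built from these. -/

theorem Data.size_pos (x : Data) : 1 ≤ x.size := by
  cases x <;> simp [Data.size]

theorem Data.size_left_le (x : Data) : x.left.size ≤ x.size := by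
  cases x
  · simp [Data.left]
  · simp only [Data.size, Data.left]; omega

theorem Data.size_right_le (x : Data) : x.right.size ≤ x.size := by
  cases x
  · simp [Data.right]
  · simp only [Data.size, Data.right]; omega

namespace Expr

def rename (ρ : ℕ → ℕ) : Expr → Expr
  | var x => var (ρ x)
  | nil => nil
  | node a b => node (a.rename ρ) (b.rename ρ)
  | left a => left (a.rename ρ)
  | right a => right (a.rename ρ)

theorem eval_rename (ρ : ℕ → ℕ) (s : Store) (e : Expr) :
    (e.rename ρ).eval s = e.eval (s ∘ ρ) := by
  induction e <;> simp_all [rename, eval]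

theorem time_rename (ρ : ℕ → ℕ) (s : Store) (e : Expr) :
    (e.rename ρ).time s = e.time (s ∘ ρ) := by
  induction e <;> simp_all [rename, time, eval_rename]

theorem size_eval_le_time (s : Store) (e : Expr) : (e.eval s).size ≤ e.time s := by
  cases e <;> simp [eval, time, Data.size]

end Expr

namespace Prog

def rename (ρ : ℕ → ℕ) : Prog → Prog
  | assign x e => assign (ρ x) (e.rename ρ)
  | seq a b => seq (a.rename ρ) (b.rename ρ)
  | cond e a b => cond (e.rename ρ) (a.rename ρ) (b.rename ρ)
  | loop e a => loop (e.rename ρ) (a.rename ρ)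

/-- A strict upper bound on the variables that a program writes. -/
def bound : Prog → ℕ
  | assign x _ => x + 1
  | seq a b => max a.bound b.bound
  | cond _ a b => max a.bound b.bound
  | loop _ a => a.bound

/-- Empties the variables `1, …, b`. -/
def clear : ℕ → Prog
  | 0 => loop .nil (assign 0 .nil)
  | b + 1 => seq (clear b) (assign (b + 1) .nil)

end Prog

/-- An injective renaming gives a subprogram private variables; everything outside the range of `ρ`
survives its execution. -/
theorem Exec.rename {ρ : ℕ → ℕ} (hρ : Function.Injective ρ) {c : Prog} {s s' : Store} {m : ℕ}
    (h : Exec c s s' m) : ∀ r : Store, r ∘ ρ = s → ∃ r' : Store,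
      Exec (c.rename ρ) r r' m ∧ r' ∘ ρ = s' ∧ ∀ j, j ∉ Set.range ρ → r' j = r j := by
  induction h with
  | assign x e s =>
    rintro r rfl
    refine ⟨Function.update r (ρ x) (e.eval (r ∘ ρ)), ?_, ?_, ?_⟩
    · have := Exec.assign (ρ x) (e.rename ρ) r
      rwa [Expr.eval_rename, Expr.time_rename] at this
    · funext i
      by_cases hi : i = x
      · subst hi; simp
      · simp [Function.update, hi, hρ.eq_iff]
    · intro j hj
      rw [Function.update_of_ne]
      rintro rfl
      exact hj ⟨x, rfl⟩
  | seq _ _ ih₁ ih₂ =>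
    intro r hr
    obtain ⟨r₁, e₁, h₁, f₁⟩ := ih₁ r hr
    obtain ⟨r₂, e₂, h₂, f₂⟩ := ih₂ r₁ h₁
    exact ⟨r₂, .seq e₁ e₂, h₂, fun j hj => (f₂ j hj).trans (f₁ j hj)⟩
  | @cond_true e _ _ _ _ _ hne _ ih =>
    rintro r rfl
    obtain ⟨r₁, e₁, h₁, f₁⟩ := ih r rfl
    refine ⟨r₁, ?_, h₁, f₁⟩
    rw [← Expr.eval_rename] at hne
    rw [← Expr.time_rename]
    exact .cond_true hne e₁
  | @cond_false e _ _ _ _ _ hne _ ih =>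
    rintro r rfl
    obtain ⟨r₁, e₁, h₁, f₁⟩ := ih r rfl
    refine ⟨r₁, ?_, h₁, f₁⟩
    rw [← Expr.eval_rename] at hne
    rw [← Expr.time_rename]
    exact .cond_false hne e₁
  | loop_true hne _ _ ih₁ ih₂ =>
    rintro r rfl
    obtain ⟨r₁, e₁, h₁, f₁⟩ := ih₁ r rfl
    obtain ⟨r₂, e₂, h₂, f₂⟩ := ih₂ r₁ h₁
    refine ⟨r₂, ?_, h₂, fun j hj => (f₂ j hj).trans (f₁ j hj)⟩
    rw [← Expr.eval_rename] at hne
    rw [← Expr.time_rename]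
    exact .loop_true hne e₁ e₂
  | loop_false hne =>
    rintro r rfl
    refine ⟨r, ?_, rfl, fun _ _ => rfl⟩
    rw [← Expr.eval_rename] at hne
    rw [← Expr.time_rename]
    exact .loop_false hne

theorem Exec.eq_of_bound_le {c : Prog} {s s' : Store} {m : ℕ} (h : Exec c s s' m) :
    ∀ j, c.bound ≤ j → s' j = s j := by
  induction h with
  | assign x e s =>
    intro j hj
    rw [Function.update_of_ne]
    simp only [Prog.bound] at hj
    omega
  | seq _ _ ih₁ ih₂ =>
    intro j hj
    simp only [Prog.bound, max_le_iff] at hj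
    exact (ih₂ j hj.2).trans (ih₁ j hj.1)
  | cond_true _ _ ih =>
    intro j hj
    simp only [Prog.bound, max_le_iff] at hj
    exact ih j hj.1
  | cond_false _ _ ih =>
    intro j hj
    simp only [Prog.bound, max_le_iff] at hj
    exact ih j hj.2
  | loop_true _ _ _ ih₁ ih₂ => exact fun j hj => (ih₂ j hj).trans (ih₁ j hj)
  | loop_false _ => exact fun _ _ => rfl

/-- Each operation costs the size of the tree it produces, so running time bounds growth. This is
what turns time bounds into size bounds for compositions. -/
theorem Exec.size_le {c : Prog} {s s' : Store} {m : ℕ} (h : Exec c s s' m) :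
    ∀ j, (s' j).size ≤ (s j).size + m := by
  induction h with
  | assign x e s =>
    intro j
    by_cases hj : j = x
    · subst hj
      have := e.size_eval_le_time s
      simp only [Function.update_self]
      omega
    · rw [Function.update_of_ne hj]
      omega
  | seq _ _ ih₁ ih₂ =>
    intro j
    have h₁ := ih₁ j
    have h₂ := ih₂ j
    omega
  | cond_true _ _ ih =>
    intro j
    have := ih j
    omega
  | cond_false _ _ ih =>
    intro j
    have := ih j
    omega
  | loop_true _ _ _ ih₁ ih₂ =>
    intro j
    have h₁ := ih₁ j
    have h₂ := ih₂ j
    omega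
  | loop_false _ => intro j; omega

theorem Exec.clear (b : ℕ) (s : Store) :
    Exec (Prog.clear b) s (fun j => if 1 ≤ j ∧ j ≤ b then Data.nil else s j) (2 + 2 * b) := by
  induction b with
  | zero =>
    -- The test `nil` always fails, so the loop does nothing and takes time 2.
    have h : Exec (Prog.clear 0) s s (2 + 2 * 0) := .loop_false rfl
    convert h using 1
    funext j
    rw [if_neg]
    omega
  | succ b ih =>
    have h : Exec (Prog.clear (b + 1)) s _ _ := Exec.seq ih (Exec.assign (b + 1) .nil _)
    change Exec _ _ _ (2 + 2 * (b + 1)) at h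
    convert h using 1
    funext j
    by_cases hj : j = b + 1
    · subst hj; simp [Expr.eval]
    · rw [Function.update_of_ne hj]
      have : (1 ≤ j ∧ j ≤ b + 1) ↔ (1 ≤ j ∧ j ≤ b) := by omega
      simp only [this]

/-- `Outputs` constrains only variable `0`. Variables from `c.bound` on were never written and the
others can be emptied in constant time, so every program can be made to end in a clean store. -/
theorem Prog.Outputs.exec_init {c : Prog} {x y : Data} {m : ℕ} (h : c.Outputs x y m) :
    Exec (.seq c (.clear c.bound)) (Store.init x) (Store.init y) (m + (2 + 2 * c.bound)) := by
  obtain ⟨s, hs, rfl⟩ := h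
  convert Exec.seq hs (Exec.clear c.bound s) using 1
  funext j
  by_cases hj : j = 0
  · subst hj; simp [Store.init]
  · by_cases hb : j ≤ c.bound
    · rw [if_pos ⟨by omega, hb⟩]; simp [Store.init, hj]
    · rw [if_neg (by omega), hs.eq_of_bound_le j (by omega)]; simp [Store.init, hj]

/-! ### Encodings and polynomial bounds -/

/-- Types whose elements are represented by trees. -/
class Enc (α : Type) where
  enc : α → Data

open Enc (enc)

instance : Enc Bool := ⟨Data.ofBool⟩
instance : Enc ℕ := ⟨Data.ofNat⟩
instance {α β : Type} [Enc α] [Enc β] : Enc (α × β) := ⟨fun p => .node (enc p.1) (enc p.2)⟩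
instance {α : Type} [Enc α] : Enc (List α) := ⟨fun l => Data.ofList (l.map enc)⟩
-- A proof is not encoded, so a function on a subtype models a computation under a promise on its
-- input.
instance {α : Type} [Enc α] {P : α → Prop} : Enc {a // P a} := ⟨fun a => enc a.1⟩

/-- The size of the encoding. -/
def sz {α : Type} [Enc α] (a : α) : ℕ := (enc a).size

section bounds

variable {α β γ : Type} [Enc α] [Enc β] [Enc γ]

theorem sz_pos (a : α) : 1 ≤ sz a := Data.size_pos _

theorem sz_pair (a : α) (b : β) : sz (a, b) = sz a + sz b + 1 := rfl

theorem sz_nil : sz ([] : List α) = 1 := rfl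

theorem sz_cons (a : α) (l : List α) : sz (a :: l) = sz a + sz l + 1 := rfl

theorem sz_append (l l' : List α) : sz (l ++ l') + 1 = sz l + sz l' := by
  induction l with
  | nil => simp [sz_nil]; omega
  | cons a l ih => simp only [List.cons_append, sz_cons]; omega

theorem length_lt_sz (l : List α) : l.length < sz l := by
  induction l with
  | nil => simp [sz_nil]
  | cons a l ih => simp only [List.length_cons, sz_cons]; omega

theorem sz_lt_of_mem {a : α} {l : List α} (h : a ∈ l) : sz a < sz l := by
  induction l with
  | nil => simp at h
  | cons b l ih =>
    rcases List.mem_cons.1 h with rfl | h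
    · simp only [sz_cons]; omega
    · have := ih h; simp only [sz_cons]; omega

theorem sz_list_le {l : List α} {K : ℕ} (h : ∀ a ∈ l, sz a ≤ K) :
    sz l ≤ l.length * (K + 1) + 1 := by
  induction l with
  | nil => simp [sz_nil]
  | cons a l ih =>
    have h₁ := h a (by simp)
    have h₂ := ih fun b hb => h b (by simp [hb])
    simp only [sz_cons, List.length_cons, add_mul, one_mul]
    omega

theorem Polynomial.eval_mono_nat (p : Polynomial ℕ) : Monotone fun n => p.eval n := by
  intro a b hab
  induction p using Polynomial.induction_on' with
  | add p q hp hq => simp only [Polynomial.eval_add] at *; omega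
  | monomial n c => simp only [Polynomial.eval_monomial]; gcongr

/-- Functions bounded by a polynomial in the size of the encoded argument. -/
def PolyBdd (f : α → ℕ) : Prop := ∃ p : Polynomial ℕ, ∀ a, f a ≤ p.eval (sz a)

namespace PolyBdd

theorem mono {f g : α → ℕ} (hg : PolyBdd g) (h : ∀ a, f a ≤ g a) : PolyBdd f := by
  obtain ⟨p, hp⟩ := hg
  exact ⟨p, fun a => (h a).trans (hp a)⟩

theorem const (n : ℕ) : PolyBdd fun _ : α => n := ⟨.C n, fun a => by simp⟩

theorem sz : PolyBdd fun a : α => sz a := ⟨.X, fun a => by simp⟩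

theorem add {f g : α → ℕ} (hf : PolyBdd f) (hg : PolyBdd g) : PolyBdd fun a => f a + g a := by
  obtain ⟨p, hp⟩ := hf
  obtain ⟨q, hq⟩ := hg
  exact ⟨p + q, fun a => by simpa using add_le_add (hp a) (hq a)⟩

theorem mul {f g : α → ℕ} (hf : PolyBdd f) (hg : PolyBdd g) : PolyBdd fun a => f a * g a := by
  obtain ⟨p, hp⟩ := hf
  obtain ⟨q, hq⟩ := hg
  exact ⟨p * q, fun a => by simpa using Nat.mul_le_mul (hp a) (hq a)⟩

theorem eval {f : α → ℕ} (p : Polynomial ℕ) (hf : PolyBdd f) : PolyBdd fun a => p.eval (f a) := by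
  obtain ⟨q, hq⟩ := hf
  exact ⟨p.comp q, fun a => by simpa using p.eval_mono_nat (hq a)⟩

theorem comp {f : β → ℕ} {g : α → β} (hf : PolyBdd f) (hg : PolyBdd fun a => _root_.sz (g a)) :
    PolyBdd fun a => f (g a) := by
  obtain ⟨p, hp⟩ := hf
  exact (hg.eval p).mono fun a => hp _

end PolyBdd

end bounds

/-- Functions computed in polynomial time by a program that leaves no garbage behind. -/
def PolyTime {α β : Type} [Enc α] [Enc β] (f : α → β) : Prop :=
  ∃ (c : Prog) (t : α → ℕ), PolyBdd t ∧
    ∀ a, ∃ m ≤ t a, Exec c (Store.init (enc a)) (Store.init (enc (f a))) m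

/-! ### Polynomial-time functions: basic closure properties -/

namespace PolyTime

variable {α β γ δ σ : Type} [Enc α] [Enc β] [Enc γ] [Enc δ] [Enc σ]

theorem sz_bdd {f : α → β} (hf : PolyTime f) : PolyBdd fun a => sz (f a) := by
  obtain ⟨c, t, ht, hc⟩ := hf
  refine (PolyBdd.sz.add ht).mono fun a => ?_
  obtain ⟨m, hm, e⟩ := hc a
  have : sz (f a) ≤ sz a + m := e.size_le 0
  omega

/-- A straight-line program. -/
theorem of_expr {f : α → β} (e : Expr) (he : ∀ a, e.eval (Store.init (enc a)) = enc (f a))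
    (ht : PolyBdd fun a : α => e.time (Store.init (enc a))) : PolyTime f := by
  refine ⟨.assign 0 e, _, ht.add (.const 1), fun a => ⟨_, le_rfl, ?_⟩⟩
  convert Exec.assign 0 e _ using 1
  rw [he]
  funext j
  by_cases hj : j = 0
  · subst hj; simp [Store.init]
  · simp [Store.init, hj]

theorem of_enc_eq {f : α → β} (h : ∀ a, enc (f a) = enc a) : PolyTime f :=
  of_expr (.var 0) (fun a => (h a).symm) (PolyBdd.sz.mono fun _ => le_rfl)

theorem congr {f g : α → β} (hg : PolyTime g) (h : ∀ a, f a = g a) : PolyTime f := by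
  rwa [funext h]

/-- Only encodings matter. In particular a value obtained by choice is polynomial-time computable as
soon as its encoding is. -/
theorem congr_enc {f : α → β} {g : α → γ} (hg : PolyTime g) (h : ∀ a, enc (f a) = enc (g a)) :
    PolyTime f := by
  obtain ⟨c, t, ht, hc⟩ := hg
  exact ⟨c, t, ht, fun a => by rw [h a]; exact hc a⟩

theorem id : PolyTime fun a : α => a := of_enc_eq fun _ => rfl

theorem comp {f : β → γ} {g : α → β} (hf : PolyTime f) (hg : PolyTime g) :
    PolyTime fun a => f (g a) := by
  have hs := hg.sz_bdd
  obtain ⟨c, t, ht, hc⟩ := hf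
  obtain ⟨c', t', ht', hc'⟩ := hg
  refine ⟨.seq c' c, _, ht'.add (ht.comp hs), fun a => ?_⟩
  obtain ⟨m, hm, e⟩ := hc (g a)
  obtain ⟨m', hm', e'⟩ := hc' a
  exact ⟨m' + m, by omega, .seq e' e⟩

end PolyTime

/-! ### Running programs side by side in one store -/

theorem Expr.exists_eval_eq (x : Data) : ∃ e : Expr, ∃ m, ∀ s : Store, e.eval s = x ∧ e.time s = m := by
  induction x with
  | nil => exact ⟨.nil, 1, fun s => ⟨rfl, rfl⟩⟩
  | node l r hl hr =>
    obtain ⟨e, m, he⟩ := hl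
    obtain ⟨e', m', he'⟩ := hr
    exact ⟨.node e e', _, fun s => ⟨by simp [eval, he, he'], by simp only [time, he, he']; rfl⟩⟩

/-- Even and odd variables serve as two independent memories, so a program can run in one of them
while the other keeps data. -/
theorem Exec.rename_even {c : Prog} {x y : Data} {m : ℕ} (h : Exec c (.init x) (.init y) m)
    {s : Store} (hs : ∀ i, s (2 * i) = Store.init x i) :
    Exec (c.rename (2 * ·)) s (fun j => if j % 2 = 0 then Store.init y (j / 2) else s j) m := by
  obtain ⟨r, hr, h₁, h₂⟩ := h.rename (ρ := (2 * ·)) (fun a b hab => by simpa using hab) s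
    (funext hs)
  convert hr using 1
  funext j
  split_ifs with hj
  · have := congrFun h₁ (j / 2)
    rw [← this, Function.comp_apply]
    congr 1
    omega
  · exact (h₂ j (by rintro ⟨i, rfl⟩; simp at hj)).symm

theorem Exec.rename_odd {c : Prog} {x y : Data} {m : ℕ} (h : Exec c (.init x) (.init y) m)
    {s : Store} (hs : ∀ i, s (2 * i + 1) = Store.init x i) :
    Exec (c.rename (2 * · + 1)) s (fun j => if j % 2 = 1 then Store.init y (j / 2) else s j) m := by
  obtain ⟨r, hr, h₁, h₂⟩ := h.rename (ρ := (2 * · + 1)) (fun a b hab => by simpa using hab) s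
    (funext hs)
  convert hr using 1
  funext j
  split_ifs with hj
  · have := congrFun h₁ (j / 2)
    rw [← this, Function.comp_apply]
    congr 1
    omega
  · exact (h₂ j (by rintro ⟨i, rfl⟩; dsimp only at hj; omega)).symm

/-- A store with given contents of the variables `0`, `1`, `2` and `4`. -/
def Store.four (x₀ x₁ x₂ x₄ : Data) : Store := fun i =>
  if i = 0 then x₀ else if i = 1 then x₁ else if i = 2 then x₂ else if i = 4 then x₄ else .nil

theorem Store.init_eq_four (x : Data) : Store.init x = Store.four x .nil .nil .nil := by
  funext j
  simp [Store.init, Store.four]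

theorem Store.four_update_zero (x₀ x₁ x₂ x₄ y : Data) :
    Function.update (Store.four x₀ x₁ x₂ x₄) 0 y = Store.four y x₁ x₂ x₄ := by
  funext j; simp only [Function.update, Store.four]; grind

theorem Store.four_update_one (x₀ x₁ x₂ x₄ y : Data) :
    Function.update (Store.four x₀ x₁ x₂ x₄) 1 y = Store.four x₀ y x₂ x₄ := by
  funext j; simp only [Function.update, Store.four]; grind

theorem Store.four_update_two (x₀ x₁ x₂ x₄ y : Data) :
    Function.update (Store.four x₀ x₁ x₂ x₄) 2 y = Store.four x₀ x₁ y x₄ := by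
  funext j; simp only [Function.update, Store.four]; grind

theorem Store.four_update_four (x₀ x₁ x₂ x₄ y : Data) :
    Function.update (Store.four x₀ x₁ x₂ x₄) 4 y = Store.four x₀ x₁ x₂ y := by
  funext j; simp only [Function.update, Store.four]; grind

theorem Exec.assign_zero (e : Expr) (x₀ x₁ x₂ x₄ : Data) :
    Exec (.assign 0 e) (.four x₀ x₁ x₂ x₄) (.four (e.eval (.four x₀ x₁ x₂ x₄)) x₁ x₂ x₄)
      (e.time (.four x₀ x₁ x₂ x₄) + 1) := by
  simpa only [Store.four_update_zero] using Exec.assign 0 e (.four x₀ x₁ x₂ x₄)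

theorem Exec.assign_one (e : Expr) (x₀ x₁ x₂ x₄ : Data) :
    Exec (.assign 1 e) (.four x₀ x₁ x₂ x₄) (.four x₀ (e.eval (.four x₀ x₁ x₂ x₄)) x₂ x₄)
      (e.time (.four x₀ x₁ x₂ x₄) + 1) := by
  simpa only [Store.four_update_one] using Exec.assign 1 e (.four x₀ x₁ x₂ x₄)

theorem Exec.assign_two (e : Expr) (x₀ x₁ x₂ x₄ : Data) :
    Exec (.assign 2 e) (.four x₀ x₁ x₂ x₄) (.four x₀ x₁ (e.eval (.four x₀ x₁ x₂ x₄)) x₄)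
      (e.time (.four x₀ x₁ x₂ x₄) + 1) := by
  simpa only [Store.four_update_two] using Exec.assign 2 e (.four x₀ x₁ x₂ x₄)

theorem Exec.assign_four (e : Expr) (x₀ x₁ x₂ x₄ : Data) :
    Exec (.assign 4 e) (.four x₀ x₁ x₂ x₄) (.four x₀ x₁ x₂ (e.eval (.four x₀ x₁ x₂ x₄)))
      (e.time (.four x₀ x₁ x₂ x₄) + 1) := by
  simpa only [Store.four_update_four] using Exec.assign 4 e (.four x₀ x₁ x₂ x₄)

/-- Running a clean program on the odd variables of a store. -/
theorem Exec.odd_four {c : Prog} {x y : Data} {m : ℕ} (h : Exec c (.init x) (.init y) m)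
    (x₀ x₂ x₄ : Data) :
    Exec (c.rename (2 * · + 1)) (.four x₀ x x₂ x₄) (.four x₀ y x₂ x₄) m := by
  convert h.rename_odd (s := .four x₀ x x₂ x₄) _ using 1
  · funext j
    split_ifs with hj
    · simp only [Store.init, Store.four]; grind
    · simp only [Store.four]; grind
  · intro i
    simp only [Store.init, Store.four]; grind

theorem Exec.even_four {c : Prog} {x y : Data} {m : ℕ} (h : Exec c (.init x) (.init y) m)
    (x₁ : Data) :
    Exec (c.rename (2 * ·)) (.four x x₁ .nil .nil) (.four y x₁ .nil .nil) m := by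
  convert h.rename_even (s := .four x x₁ .nil .nil) _ using 1
  · funext j
    split_ifs with hj
    · simp only [Store.init, Store.four]; grind
    · simp only [Store.four]; grind
  · intro i
    simp only [Store.init, Store.four]; grind

/-! ### Pairing, case distinction and bounded folds -/

namespace PolyTime

variable {α β γ δ σ : Type} [Enc α] [Enc β] [Enc γ] [Enc δ] [Enc σ]

theorem const (b : β) : PolyTime fun _ : α => b := by
  obtain ⟨e, m, he⟩ := Expr.exists_eval_eq (enc b)
  exact of_expr e (fun a => (he _).1) ((PolyBdd.const m).mono fun a => (he _).2.le)

/-- The input is copied to variable `1`; `f` is computed in the odd memory and `g` in the even one.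
-/
theorem pair {f : α → β} {g : α → γ} (hf : PolyTime f) (hg : PolyTime g) :
    PolyTime fun a => (f a, g a) := by
  have hfs := hf.sz_bdd
  have hgs := hg.sz_bdd
  obtain ⟨c, t, ht, hc⟩ := hf
  obtain ⟨c', t', ht', hc'⟩ := hg
  refine ⟨.seq (.assign 1 (.var 0)) (.seq (c.rename (2 * · + 1)) (.seq (c'.rename (2 * ·))
    (.seq (.assign 0 (.node (.var 1) (.var 0))) (.assign 1 .nil)))), _,
    ((((PolyBdd.sz.add ht).add ht').add hfs).add hgs).add (hfs.add (hgs.add (.const 5))),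
    fun a => ?_⟩
  obtain ⟨m, hm, e⟩ := hc a
  obtain ⟨m', hm', e'⟩ := hc' a
  rw [Store.init_eq_four, Store.init_eq_four]
  refine ⟨_, ?_, .seq (.assign_one _ _ _ _ _) (.seq (e.odd_four _ _ _)
    (.seq (e'.even_four _) (.seq (.assign_zero _ _ _ _ _) (.assign_one _ _ _ _ _))))⟩
  simp only [Expr.time, Expr.eval, Store.four, sz, Data.size]
  simp
  omega

theorem fst {f : α → β × γ} (hf : PolyTime f) : PolyTime fun a => (f a).1 :=
  comp (of_expr (f := fun p : β × γ => p.1) (.left (.var 0)) (fun _ => rfl)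
    ((PolyBdd.sz.add PolyBdd.sz).mono fun _ =>
      Nat.add_le_add_left (Data.size_left_le _) _)) hf

theorem snd {f : α → β × γ} (hf : PolyTime f) : PolyTime fun a => (f a).2 :=
  comp (of_expr (f := fun p : β × γ => p.2) (.right (.var 0)) (fun _ => rfl)
    ((PolyBdd.sz.add PolyBdd.sz).mono fun _ =>
      Nat.add_le_add_left (Data.size_right_le _) _)) hf

/-- The first branch need only be computable where the test succeeds. This is how the assumed
algorithm is called on feasible instances only. The time bound uses the polynomial `p₁`, since `t₁`
itself is undefined elsewhere. -/
theorem dite {b : α → Bool} {f : {a // b a = true} → β} {g : α → β} (hb : PolyTime b)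
    (hf : PolyTime f) (hg : PolyTime g) :
    PolyTime fun a => if h : b a = true then f ⟨a, h⟩ else g a := by
  have hbs := hb.sz_bdd
  obtain ⟨c, t, ht, hc⟩ := hb
  obtain ⟨c₁, t₁, ⟨p₁, ht₁⟩, hc₁⟩ := hf
  obtain ⟨c₂, t₂, ht₂, hc₂⟩ := hg
  refine ⟨.seq (.assign 1 (.var 0)) (.seq (c.rename (2 * · + 1))
    (.cond (.var 1) (.seq (.assign 1 .nil) c₁) (.seq (.assign 1 .nil) c₂))), _,
    (((PolyBdd.sz.add ht).add ⟨p₁, fun _ => le_rfl⟩).add ht₂).add (hbs.add (.const 5)),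
    fun a => ?_⟩
  obtain ⟨m, hm, e⟩ := hc a
  by_cases h : b a = true
  · obtain ⟨m₁, hm₁, e₁⟩ := hc₁ ⟨a, h⟩
    have h₁ := hm₁.trans (ht₁ ⟨a, h⟩)
    change Exec c₁ (Store.init (enc a)) _ _ at e₁
    rw [Store.init_eq_four (enc a)] at e₁
    beta_reduce
    rw [dif_pos h, Store.init_eq_four (enc a)]
    refine ⟨_, ?_, .seq (.assign_one _ _ _ _ _) (.seq (e.odd_four _ _ _)
      (.cond_true ?_ (.seq (.assign_one _ _ _ _ _) e₁)))⟩
    · simp only [Expr.time, Store.four, sz] at h₁ ⊢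
      simp
      change m₁ ≤ Polynomial.eval (enc a).size p₁ at h₁
      omega
    · simp only [Expr.eval, Store.four, h]
      simp [enc, Data.ofBool]
  · obtain ⟨m₁, hm₁, e₁⟩ := hc₂ a
    rw [Store.init_eq_four (enc a)] at e₁
    beta_reduce
    rw [dif_neg h, Store.init_eq_four (enc a)]
    refine ⟨_, ?_, .seq (.assign_one _ _ _ _ _) (.seq (e.odd_four _ _ _)
      (.cond_false ?_ (.seq (.assign_one _ _ _ _ _) e₁)))⟩
    · simp only [Expr.time, Store.four, sz]
      simp
      omega
    · simp only [Expr.eval, Store.four, h]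
      simp [enc, Data.ofBool]

theorem subtype_val {P : α → Prop} : PolyTime fun a : {a // P a} => a.1 := of_enc_eq fun _ => rfl

theorem ite {P : α → Prop} [DecidablePred P] {f g : α → β} (hP : PolyTime fun a => decide (P a))
    (hf : PolyTime f) (hg : PolyTime g) : PolyTime fun a => if P a then f a else g a :=
  (dite hP (hf.comp subtype_val) hg).congr fun a => by
    by_cases h : P a <;> simp [h]

theorem bool_decide {b : α → Bool} (hb : PolyTime b) : PolyTime fun a => decide (b a = true) :=
  hb.congr fun a => by simp

theorem cons {f : α → β} {l : α → List β} (hf : PolyTime f) (hl : PolyTime l) :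
    PolyTime fun a => f a :: l a :=
  (hf.pair hl).congr_enc fun _ => rfl

theorem tail {l : α → List β} (hl : PolyTime l) : PolyTime fun a => (l a).tail :=
  comp (of_expr (f := fun l : List β => l.tail) (.right (.var 0))
    (fun l => by cases l <;> rfl)
    ((PolyBdd.sz.add PolyBdd.sz).mono fun _ =>
      Nat.add_le_add_left (Data.size_right_le _) _)) hl

/-- The loop that computes a left fold. -/
theorem exec_foldl {f : γ → σ → α → σ} {c : Prog} {t : γ × σ × α → ℕ}
    (hc : ∀ p, ∃ m ≤ t p, Exec c (.init (enc p)) (.init (enc (f p.1 p.2.1 p.2.2))) m)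
    (x : γ) (T B : ℕ) (l : List α) : ∀ s : σ,
    (∀ l' a, l' ++ [a] <+: l → t (x, l'.foldl (f x) s, a) ≤ T) →
    (∀ l', l' <+: l → sz (l'.foldl (f x) s) ≤ B) →
    ∃ m ≤ (l.length + 1) * (T + 10 * (sz x + B + sz l) + 20),
      -- Variable `0` holds the remaining list, `2` the parameter and `4` the state; the odd
      -- variables are the workspace of a single step.
      Exec (.loop (.var 0) (.seq (.assign 1 (.node (.var 2) (.node (.var 4) (.left (.var 0)))))
        (.seq (c.rename (2 * · + 1)) (.seq (.assign 4 (.var 1)) (.seq (.assign 1 .nil)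
          (.assign 0 (.right (.var 0))))))))
        (.four (enc l) .nil (enc x) (enc s))
        (.four .nil .nil (enc x) (enc (l.foldl (f x) s))) m := by
  induction l with
  | nil =>
    intro s _ _
    refine ⟨_, ?_, .loop_false rfl⟩
    simp [Expr.time, Store.four, enc, Data.ofList, Data.size]
  | cons a l ih =>
    intro s hT hB
    obtain ⟨m, hm, e⟩ := ih (f x s a)
      (fun l' b h => hT (a :: l') b (by simpa using h))
      (fun l' h => hB (a :: l') (by simpa using h))
    obtain ⟨m₁, hm₁, e₁⟩ := hc (x, s, a)
    have hT' := hT [] a (by simp)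
    have hB₀ := hB [] (by simp)
    have hB₁ := hB [a] (by simp)
    simp only [List.foldl_nil, List.foldl_cons] at hT' hB₀ hB₁
    refine ⟨_, ?_, .loop_true ?_ (.seq (.assign_one _ _ _ _ _) (.seq (e₁.odd_four _ _ _)
      (.seq (.assign_four _ _ _ _ _) (.seq (.assign_one _ _ _ _ _)
        (.assign_zero _ _ _ _ _))))) e⟩
    · have h₁ : (enc (a :: l)).size = sz a + sz l + 1 := rfl
      have h₂ : (enc (a :: l)).left = enc a := rfl
      have h₃ : (enc (a :: l)).right = enc l := rfl
      have h₄ : (l.length + 1) * (T + 10 * (sz x + B + sz l) + 20) ≤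
        (l.length + 1) * (T + 10 * (sz x + B + sz (a :: l)) + 20) := by
        gcongr; simp only [sz_cons]; omega
      rw [List.length_cons, add_mul (l.length + 1), one_mul]
      have h₅ := hm.trans h₄
      simp only [sz_cons] at h₅ ⊢
      have h₆ : (enc (f x s a)).size = sz (f x s a) := rfl
      simp [Expr.time, Expr.eval, Store.four, Data.size, h₁, h₂, h₃, h₆]
      have h₇ : (enc x).size = sz x := rfl
      have h₈ : (enc s).size = sz s := rfl
      have h₉ : (enc a).size = sz a := rfl
      have h₁₀ : (enc l).size = sz l := rfl
      rw [h₇, h₈, h₉, h₁₀]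
      omega
    · simp [Expr.eval, Store.four, enc, Data.ofList]

/-- Iterating a polynomial-time step may produce exponentially large states, so a bound `B` is
required; it is needed only for the states actually reached, those after prefixes of the list. -/
theorem foldl {f : γ → σ → α → σ} {s : γ → σ} {l : γ → List α}
    (hf : PolyTime fun p : γ × σ × α => f p.1 p.2.1 p.2.2) (hs : PolyTime s) (hl : PolyTime l)
    {B : γ → ℕ} (hB : PolyBdd B) (h : ∀ x l', l' <+: l x → sz (l'.foldl (f x) (s x)) ≤ B x) :
    PolyTime fun x => (l x).foldl (f x) (s x) := by
  have hls := hl.sz_bdd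
  obtain ⟨c, t, ⟨p, ht⟩, hc⟩ := hf
  -- The program receives parameter, state and list as its input. On the subtype the last two are
  -- determined by the first, so all bounds can be stated in terms of the parameter.
  have key : PolyTime fun q : {q : γ × σ × List α // q.2.1 = s q.1 ∧ q.2.2 = l q.1} =>
      q.1.2.2.foldl (f q.1.1) q.1.2.1 := by
    have hγ : PolyBdd fun q : {q : γ × σ × List α // q.2.1 = s q.1 ∧ q.2.2 = l q.1} => sz q.1.1 :=
      PolyBdd.sz.mono fun ⟨⟨x, y, z⟩, h⟩ => by
        change sz x ≤ sz (x, y, z); rw [sz_pair]; omega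
    have hB' := hB.comp hγ
    have hl' := hls.comp hγ
    let T := fun q : {q : γ × σ × List α // q.2.1 = s q.1 ∧ q.2.2 = l q.1} =>
      p.eval (sz q.1.1 + (B q.1.1 + sz (l q.1.1) + 1) + 1)
    have hT : PolyBdd T := (hγ.add ((hB'.add hl').add (.const 1)) |>.add (.const 1)).eval p
    refine ⟨.seq (.assign 2 (.left (.var 0))) (.seq (.assign 4 (.left (.right (.var 0))))
      (.seq (.assign 0 (.right (.right (.var 0)))) (.seq (.loop (.var 0)
        (.seq (.assign 1 (.node (.var 2) (.node (.var 4) (.left (.var 0)))))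
        (.seq (c.rename (2 * · + 1)) (.seq (.assign 4 (.var 1)) (.seq (.assign 1 .nil)
          (.assign 0 (.right (.var 0)))))))) (.seq (.assign 0 (.var 4))
            (.seq (.assign 2 .nil) (.assign 4 .nil)))))), _,
      (((PolyBdd.sz.mul (.const 20)).add (hl'.mul ((hT.add
        ((PolyBdd.const 10).mul ((hγ.add hB').add hl'))).add (.const 20)))).add hB').add (.const 20),
      ?_⟩
    rintro ⟨⟨x, y, z⟩, hy, hz⟩
    dsimp only at hy hz
    subst hy hz
    obtain ⟨m, hm, e⟩ := exec_foldl hc x (T ⟨(x, s x, l x), rfl, rfl⟩) (B x) (l x) (s x)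
      (by
        intro l' a hla
        refine (ht _).trans (p.eval_mono_nat ?_)
        have h₁ := h x l' ((List.prefix_append _ _).trans hla)
        have h₂ := sz_lt_of_mem (hla.subset (by simp : a ∈ l' ++ [a]))
        simp only [sz_pair]
        omega)
      (h x)
    change ∃ m ≤ _, Exec _ (Store.init (enc (x, s x, l x))) _ _
    rw [Store.init_eq_four, Store.init_eq_four]
    refine ⟨_, ?_, .seq (.assign_two _ _ _ _ _) (.seq (.assign_four _ _ _ _ _)
      (.seq (.assign_zero _ _ _ _ _) (.seq e (.seq (.assign_zero _ _ _ _ _)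
        (.seq (.assign_two _ _ _ _ _) (.assign_four _ _ _ _ _))))))⟩
    have h₁ := h x (l x) List.prefix_rfl
    have h₂ : m ≤ sz (l x) * (T ⟨(x, s x, l x), rfl, rfl⟩ +
        10 * (sz x + B x + sz (l x)) + 20) :=
      hm.trans (Nat.mul_le_mul_right _ (length_lt_sz (l x)))
    simp [Expr.time, Expr.eval, Store.four]
    change _ ≤ sz (x, s x, l x) * 20 + _ + _ + 20
    change _ + _ + 1 + (_ + _ + _ + 1 + (_ + _ + _ + 1 + (m + (sz ((l x).foldl (f x) (s x)) + 1 +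
      (1 + 1 + (1 + 1)))))) ≤ sz (x, s x, l x) * 20 + _ + _ + 20
    have h₃ : Data.size (enc (x, s x, l x)) = sz (x, s x, l x) := rfl
    have h₄ := Data.size_left_le (enc (x, s x, l x))
    have h₅ := Data.size_right_le (enc (x, s x, l x))
    have h₆ := Data.size_left_le (enc (x, s x, l x)).right
    have h₇ := Data.size_right_le (enc (x, s x, l x)).right
    omega
  have := key.comp (g := fun x => ⟨(x, s x, l x), rfl, rfl⟩)
    ((PolyTime.id.pair (hs.pair hl)).congr_enc fun _ => rfl)
  exact this

/-- A left fold whose steps increase the size by a bounded amount. -/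
theorem foldl_of_le_add {f : γ → σ → α → σ} {s : γ → σ} {l : γ → List α}
    (hf : PolyTime fun p : γ × σ × α => f p.1 p.2.1 p.2.2) (hs : PolyTime s) (hl : PolyTime l)
    {K : γ → ℕ} (hK : PolyBdd K) (h : ∀ x s, ∀ a ∈ l x, sz (f x s a) ≤ sz s + K x) :
    PolyTime fun x => (l x).foldl (f x) (s x) := by
  refine foldl hf hs hl (hs.sz_bdd.add (hl.sz_bdd.mul hK)) fun x l' hl' => ?_
  have h₁ : ∀ l' : List α, (∀ a ∈ l', a ∈ l x) → ∀ y,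
      sz (l'.foldl (f x) y) ≤ sz y + l'.length * K x := by
    intro l'
    induction l' with
    | nil => intro _ y; simp
    | cons a l' ih =>
      intro hl' y
      have h₁ := h x y a (hl' a (by simp))
      have h₂ := ih (fun b hb => hl' b (by simp [hb])) (f x y a)
      simp only [List.foldl_cons, List.length_cons, add_mul, one_mul]
      omega
  refine (h₁ l' (fun a ha => hl'.subset ha) _).trans ?_
  gcongr
  exact hl'.length_le.trans (length_lt_sz _).le

end PolyTime

/-! ### Lists and natural numbers in polynomial time -/

theorem sz_bool_le (b : Bool) : sz b ≤ 3 := by cases b <;> simp [sz, enc, Data.ofBool, Data.size]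

theorem sz_nat (n : ℕ) : sz n = sz n.bits := rfl

theorem sz_nat_le (n : ℕ) : sz n ≤ 4 * n.size + 1 := by
  have h : sz n.bits ≤ n.bits.length * (3 + 1) + 1 := sz_list_le fun b _ => sz_bool_le b
  rw [sz_nat, ← Nat.size_eq_bits_len]
  omega

theorem le_sz_nat (n : ℕ) : 2 * n.size + 1 ≤ sz n := by
  have h : ∀ l : List Bool, 2 * l.length + 1 ≤ sz l := by
    intro l
    induction l with
    | nil => simp [sz_nil]
    | cons b l ih =>
      have := sz_pos b
      simp only [List.length_cons, sz_cons]
      omega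
  rw [sz_nat, ← Nat.size_eq_bits_len]
  exact h _

/-- Encoded size is not monotone, because a digit `1` takes more nodes than a digit `0`; passing
through the bit length costs a factor 2. -/
theorem sz_nat_mono {m n : ℕ} (h : m ≤ n) : sz m ≤ 2 * sz n := by
  have h₁ := sz_nat_le m
  have h₂ := le_sz_nat n
  have h₃ := Nat.size_le_size h
  omega

theorem sz_nat_le_self (n : ℕ) : sz n ≤ 4 * n + 1 := by
  have h₁ := sz_nat_le n
  have h₂ : n.size ≤ n := Nat.size_le.2 Nat.lt_two_pow_self
  omega

theorem Nat.size_add_le (a b : ℕ) : (a + b).size ≤ a.size + b.size + 1 := by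
  rw [Nat.size_le]
  have h₁ := Nat.lt_size_self a
  have h₂ := Nat.lt_size_self b
  have h₃ : 2 ^ a.size ≤ 2 ^ (a.size + b.size) := Nat.pow_le_pow_right (by simp) (by omega)
  have h₄ : 2 ^ b.size ≤ 2 ^ (a.size + b.size) := Nat.pow_le_pow_right (by simp) (by omega)
  rw [pow_succ]
  omega

theorem Nat.size_mul_le (a b : ℕ) : (a * b).size ≤ a.size + b.size := by
  rw [Nat.size_le, pow_add]
  exact Nat.mul_lt_mul'' (Nat.lt_size_self a) (Nat.lt_size_self b)

theorem sz_mul_le (a b : ℕ) : sz (a * b) ≤ 2 * (sz a + sz b) := by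
  have h₁ := sz_nat_le (a * b)
  have h₂ := le_sz_nat a
  have h₃ := le_sz_nat b
  have h₄ := Nat.size_mul_le a b
  omega

theorem sz_sum_le (l : List ℕ) : sz l.sum ≤ 2 * sz l := by
  have h : 2 * l.sum.size + 1 ≤ sz l := by
    induction l with
    | nil => simp [sz_nil]
    | cons a l ih =>
      have h₁ := le_sz_nat a
      have h₂ := Nat.size_add_le a l.sum
      simp only [List.sum_cons, sz_cons]
      omega
  have := sz_nat_le l.sum
  omega

theorem sz_reverse {α : Type} [Enc α] (l : List α) : sz l.reverse = sz l := by
  induction l with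
  | nil => rfl
  | cons a l ih =>
    have h := sz_append l.reverse [a]
    simp only [sz_cons, sz_nil] at h ⊢
    rw [List.reverse_cons]
    omega

theorem sz_suffix_le {α : Type} [Enc α] {l l' : List α} (h : l' <:+ l) : sz l' ≤ sz l := by
  obtain ⟨r, rfl⟩ := h
  have h₁ := sz_append r l'
  have h₂ := sz_pos r
  omega

namespace PolyTime

variable {α β γ δ σ : Type} [Enc α] [Enc β] [Enc γ] [Enc δ] [Enc σ]

theorem reverse {l : α → List β} (hl : PolyTime l) : PolyTime fun x => (l x).reverse := by
  refine (foldl_of_le_add (f := fun _ s a => a :: s) (s := fun _ => []) (l := l)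
    (K := fun x => sz (l x) + 1) (id.snd.snd.cons id.snd.fst) (const _) hl
    (hl.sz_bdd.add (.const 1)) ?_).congr ?_
  · intro x s a ha
    have := sz_lt_of_mem ha
    simp only [sz_cons]
    omega
  · intro x
    simp

/-- A right fold is a left fold over the reversed list, so the states to be bounded belong to
suffixes. -/
theorem foldr {f : γ → α → σ → σ} {s : γ → σ} {l : γ → List α}
    (hf : PolyTime fun p : γ × σ × α => f p.1 p.2.2 p.2.1) (hs : PolyTime s) (hl : PolyTime l)
    {B : γ → ℕ} (hB : PolyBdd B) (h : ∀ x l', l' <:+ l x → sz (l'.foldr (f x) (s x)) ≤ B x) :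
    PolyTime fun x => (l x).foldr (f x) (s x) := by
  refine (foldl (f := fun x s a => f x a s) hf hs hl.reverse hB ?_).congr fun x => by simp
  intro x l' hl'
  have := h x l'.reverse (by rw [← List.reverse_prefix]; simpa using hl')
  simpa using this

theorem foldr_of_le_add {f : γ → α → σ → σ} {s : γ → σ} {l : γ → List α}
    (hf : PolyTime fun p : γ × σ × α => f p.1 p.2.2 p.2.1) (hs : PolyTime s) (hl : PolyTime l)
    {K : γ → ℕ} (hK : PolyBdd K) (h : ∀ x s, ∀ a ∈ l x, sz (f x a s) ≤ sz s + K x) :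
    PolyTime fun x => (l x).foldr (f x) (s x) :=
  (foldl_of_le_add (f := fun x s a => f x a s) hf hs hl.reverse hK
    fun x s a ha => h x s a (by simpa using ha)).congr fun x => by simp

/-- A bound for a function of an element of a list. -/
theorem sz_bdd_mem {f : γ → α → β} {l : γ → List α} (hf : PolyTime fun p : γ × α => f p.1 p.2)
    (hl : PolyTime l) : ∃ K : γ → ℕ, PolyBdd K ∧ ∀ x, ∀ a ∈ l x, sz (f x a) ≤ K x := by
  obtain ⟨p, hp⟩ := hf.sz_bdd
  refine ⟨_, ((PolyBdd.sz.add hl.sz_bdd).add (.const 1)).eval p, fun x a ha => ?_⟩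
  refine (hp (x, a)).trans (p.eval_mono_nat ?_)
  have := sz_lt_of_mem ha
  simp only [sz_pair]
  omega

theorem map {f : γ → α → β} {l : γ → List α} (hl : PolyTime l)
    (hf : PolyTime fun p : γ × α => f p.1 p.2) : PolyTime fun x => (l x).map (f x) := by
  obtain ⟨K, hK, h⟩ := sz_bdd_mem hf hl
  refine (foldr_of_le_add (f := fun x a s => f x a :: s) (s := fun _ => []) (l := l)
    (K := fun x => K x + 1) ((hf.comp (id.fst.pair id.snd.snd)).cons id.snd.fst) (const _) hl
    (hK.add (.const 1)) ?_).congr ?_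
  · intro x s a ha
    have := h x a ha
    simp only [sz_cons]
    omega
  · intro x
    simp

theorem filter {p : γ → α → Bool} {l : γ → List α} (hl : PolyTime l)
    (hp : PolyTime fun q : γ × α => p q.1 q.2) : PolyTime fun x => (l x).filter (p x) := by
  refine (foldr_of_le_add (f := fun x a s => if p x a = true then a :: s else s)
    (s := fun _ => []) (l := l) (K := fun x => sz (l x) + 1)
    (ite (hp.comp (id.fst.pair id.snd.snd)).bool_decide (id.snd.snd.cons id.snd.fst) id.snd.fst)
    (const _) hl (hl.sz_bdd.add (.const 1)) ?_).congr ?_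
  · intro x s a ha
    have := sz_lt_of_mem ha
    split_ifs
    · simp only [sz_cons]; omega
    · omega
  · intro x
    induction l x with
    | nil => rfl
    | cons a l ih => simp only [List.filter_cons, List.foldr_cons, ih]

theorem append {l l' : γ → List α} (hl : PolyTime l) (hl' : PolyTime l') :
    PolyTime fun x => l x ++ l' x := by
  refine (foldr_of_le_add (f := fun _ a s => a :: s) (s := l') (l := l)
    (K := fun x => sz (l x) + 1) (id.snd.snd.cons id.snd.fst) hl' hl
    (hl.sz_bdd.add (.const 1)) ?_).congr ?_
  · intro x s a ha
    have := sz_lt_of_mem ha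
    simp only [sz_cons]
    omega
  · intro x
    simp

theorem flatMap {f : γ → α → List β} {l : γ → List α} (hl : PolyTime l)
    (hf : PolyTime fun p : γ × α => f p.1 p.2) :
    PolyTime fun x => (l x).flatMap (f x) := by
  obtain ⟨K, hK, h⟩ := sz_bdd_mem hf hl
  refine (foldr_of_le_add (f := fun x a s => f x a ++ s) (s := fun _ => []) (l := l)
    (K := K) ((hf.comp (id.fst.pair id.snd.snd)).append id.snd.fst) (const _) hl
    hK ?_).congr ?_
  · intro x s a ha
    have := h x a ha
    have := sz_append (f x a) s
    omega
  · intro x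
    induction l x with
    | nil => rfl
    | cons a l ih => simp only [List.flatMap_cons, List.foldr_cons, ih]

theorem isEmpty {l : γ → List α} (hl : PolyTime l) : PolyTime fun x => (l x).isEmpty := by
  refine (foldr_of_le_add (f := fun _ _ _ => false) (s := fun _ => true) (l := l)
    (K := fun _ => 3) (const _) (const _) hl (.const 3) ?_).congr ?_
  · intro x s a ha
    have := sz_bool_le false
    omega
  · intro x
    cases l x <;> rfl

theorem headD {l : γ → List α} {d : γ → α} (hl : PolyTime l) (hd : PolyTime d) :
    PolyTime fun x => (l x).headD (d x) := by
  refine (foldr_of_le_add (f := fun _ a _ => a) (s := d) (l := l)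
    (K := fun x => sz (l x)) id.snd.snd hd hl hl.sz_bdd ?_).congr ?_
  · intro x s a ha
    have := sz_lt_of_mem ha
    omega
  · intro x
    cases l x <;> rfl

/-! Booleans -/

theorem cond {b : α → Bool} {f g : α → β} (hb : PolyTime b) (hf : PolyTime f) (hg : PolyTime g) :
    PolyTime fun a => bif b a then f a else g a :=
  (ite hb.bool_decide hf hg).congr fun a => by cases b a <;> rfl

theorem not {f : α → Bool} (hf : PolyTime f) : PolyTime fun a => !f a :=
  (hf.cond (const false) (const true)).congr fun a => by cases f a <;> rfl

theorem and {f g : α → Bool} (hf : PolyTime f) (hg : PolyTime g) : PolyTime fun a => f a && g a :=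
  (hf.cond hg (const false)).congr fun a => by cases f a <;> rfl

theorem or {f g : α → Bool} (hf : PolyTime f) (hg : PolyTime g) : PolyTime fun a => f a || g a :=
  (hf.cond (const true) hg).congr fun a => by cases f a <;> rfl

theorem xor {f g : α → Bool} (hf : PolyTime f) (hg : PolyTime g) :
    PolyTime fun a => Bool.xor (f a) (g a) :=
  (hf.cond hg.not hg).congr fun a => by cases f a <;> simp

theorem decide_and {P Q : α → Prop} [DecidablePred P] [DecidablePred Q]
    (hP : PolyTime fun a => decide (P a)) (hQ : PolyTime fun a => decide (Q a)) :
    PolyTime fun a => decide (P a ∧ Q a) :=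
  (hP.and hQ).congr fun a => by simp

/-! Natural numbers -/

theorem bits {f : α → ℕ} (hf : PolyTime f) : PolyTime fun a => (f a).bits :=
  comp (of_enc_eq (f := fun n : ℕ => n.bits) fun _ => rfl) hf

/-- Prepending a digit is correct except for a `0` in front of the number `0`, whose digit list must
remain empty. -/
theorem bit {b : α → Bool} {f : α → ℕ} (hb : PolyTime b) (hf : PolyTime f) :
    PolyTime fun a => Nat.bit (b a) (f a) := by
  refine (cond (hb.or hf.bits.isEmpty.not) (hb.cons hf.bits) (const ([] : List Bool))).congr_enc ?_
  intro a
  cases hb' : b a with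
  | true =>
    change enc (Nat.bits _) = _
    rw [Nat.bits_append_bit _ _ (by simp)]
    rfl
  | false =>
    by_cases h : f a = 0
    · rw [h]; rfl
    · change enc (Nat.bits _) = _
      rw [Nat.bits_append_bit _ _ (by simp [h])]
      have : (f a).bits.isEmpty = false := by
        rw [← Bool.not_eq_true, List.isEmpty_iff]
        intro h'
        have h₁ := Nat.size_eq_bits_len (f a)
        rw [h'] at h₁
        exact h (Nat.size_eq_zero.1 h₁.symm)
      rw [this]
      rfl

theorem half {f : α → ℕ} (hf : PolyTime f) : PolyTime fun a => (f a).div2 :=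
  hf.bits.tail.congr_enc fun a => by
    change enc (Nat.bits _) = _
    rw [Nat.div2_bits_eq_tail]

theorem bodd {f : α → ℕ} (hf : PolyTime f) : PolyTime fun a => (f a).bodd :=
  (hf.bits.headD (const default)).congr fun a => by
    rw [Nat.bodd_eq_bits_head]
    cases (f a).bits <;> rfl

end PolyTime

/-! ### Binary addition and comparison -/

theorem sz_bit_le (b : Bool) (n : ℕ) : sz (Nat.bit b n) ≤ sz n + 4 := by
  by_cases h : n = 0 → b = true
  · rw [sz_nat, Nat.bits_append_bit _ _ h, sz_cons, sz_nat]
    have := sz_bool_le b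
    omega
  · have : n = 0 ∧ b = false := by simpa using h
    rw [this.1, this.2]
    simp

theorem sz_div2_le (n : ℕ) : sz n.div2 ≤ sz n := by
  rw [sz_nat, Nat.div2_bits_eq_tail, sz_nat n]
  exact sz_suffix_le (List.tail_suffix _)

/-- One step of binary addition: the state consists of the remaining digits of the summands,
the carry, and the digits computed so far. -/
def addStep (s : ℕ × ℕ × Bool × List Bool) : ℕ × ℕ × Bool × List Bool :=
  (s.1.div2, s.2.1.div2,
    (s.1.bodd && s.2.1.bodd) || (s.2.2.1 && (s.1.bodd || s.2.1.bodd)),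
    Bool.xor s.1.bodd (Bool.xor s.2.1.bodd s.2.2.1) :: s.2.2.2)

/-- The number whose binary digits are those in the list, read in reverse order, preceded by
those of `n`. -/
def digitsOnto (l : List Bool) (n : ℕ) : ℕ := l.foldl (fun n b => Nat.bit b n) n

/-- The invariant of addition: the sum of the remaining summands and the carry, with the computed
digits attached below, is constant. -/
theorem digitsOnto_addStep (s : ℕ × ℕ × Bool × List Bool) :
    digitsOnto (addStep s).2.2.2 ((addStep s).1 + (addStep s).2.1 + (addStep s).2.2.1.toNat) =
      digitsOnto s.2.2.2 (s.1 + s.2.1 + s.2.2.1.toNat) := by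
  obtain ⟨a, b, c, l⟩ := s
  simp only [addStep, digitsOnto, List.foldl_cons]
  congr 1
  have ha := Nat.bodd_add_div2 a
  have hb := Nat.bodd_add_div2 b
  rw [Nat.bit_val]
  revert ha hb
  cases a.bodd <;> cases b.bodd <;> cases c <;> simp <;> omega

theorem foldl_div2 {α : Type} (l : List α) (n : ℕ) (h : n.size ≤ l.length) :
    l.foldl (fun n _ => n.div2) n = 0 := by
  induction l generalizing n with
  | nil =>
    have : n.size = 0 := by simpa using h
    simpa using Nat.size_eq_zero.1 this
  | cons a l ih =>
    rw [List.foldl_cons]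
    apply ih
    rw [Nat.size_le, Nat.div2_val]
    have := Nat.size_le.1 h
    rw [List.length_cons, pow_succ] at this
    omega

theorem foldl_addStep {α : Type} (l : List α) (s : ℕ × ℕ × Bool × List Bool) :
    (l.foldl (fun s _ => addStep s) s).1 = l.foldl (fun n _ => n.div2) s.1 ∧
    (l.foldl (fun s _ => addStep s) s).2.1 = l.foldl (fun n _ => n.div2) s.2.1 ∧
    digitsOnto (l.foldl (fun s _ => addStep s) s).2.2.2 ((l.foldl (fun s _ => addStep s) s).1 +
      (l.foldl (fun s _ => addStep s) s).2.1 + (l.foldl (fun s _ => addStep s) s).2.2.1.toNat) =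
      digitsOnto s.2.2.2 (s.1 + s.2.1 + s.2.2.1.toNat) := by
  induction l generalizing s with
  | nil => simp
  | cons a l ih =>
    obtain ⟨h₁, h₂, h₃⟩ := ih (addStep s)
    exact ⟨h₁, h₂, h₃.trans (digitsOnto_addStep s)⟩

/-- The list `a.bits ++ b.bits` is only a clock, long enough to exhaust both summands; the last
carry becomes the top digit. -/
theorem add_eq_digitsOnto (a b : ℕ) :
    a + b = digitsOnto ((a.bits ++ b.bits).foldl (fun s _ => addStep s) (a, b, false, [])).2.2.2
      (Nat.bit ((a.bits ++ b.bits).foldl (fun s _ => addStep s) (a, b, false, [])).2.2.1 0) := by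
  obtain ⟨h₁, h₂, h₃⟩ := foldl_addStep (a.bits ++ b.bits) (a, b, false, [])
  rw [foldl_div2 _ _ (by simp [← Nat.size_eq_bits_len])] at h₁ h₂
  rw [h₁, h₂] at h₃
  simp only [digitsOnto, List.foldl_nil, Bool.toNat_false, add_zero, zero_add] at h₃
  rw [← h₃]
  rfl

/-- One step of binary comparison. -/
def leStep (s : ℕ × ℕ × Bool) : ℕ × ℕ × Bool :=
  (s.1.div2, s.2.1.div2, bif Bool.xor s.1.bodd s.2.1.bodd then s.2.1.bodd else s.2.2)

/-- Digits arrive from the least significant one, so the last difference seen decides and `r`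
survives only if there is none. -/
theorem foldl_leStep {α : Type} (l : List α) (a b : ℕ) (r : Bool) (ha : a.size ≤ l.length)
    (hb : b.size ≤ l.length) :
    (l.foldl (fun s _ => leStep s) (a, b, r)).2.2 = if a = b then r else decide (a < b) := by
  induction l generalizing a b r with
  | nil =>
    have h₁ : a.size = 0 := by simpa using ha
    have h₂ : b.size = 0 := by simpa using hb
    simp [Nat.size_eq_zero.1 h₁, Nat.size_eq_zero.1 h₂]
  | cons x l ih =>
    rw [List.foldl_cons, leStep, ih]
    · have h₁ := Nat.bodd_add_div2 a
      have h₂ := Nat.bodd_add_div2 b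
      dsimp only
      generalize a.div2 = a' at *
      generalize b.div2 = b' at *
      cases h₃ : a.bodd <;> cases h₄ : b.bodd <;> rw [h₃] at h₁ <;> rw [h₄] at h₂ <;>
        simp at h₁ h₂ ⊢ <;> subst h₁ h₂ <;> split_ifs <;> grind
    all_goals
      rw [Nat.size_le, Nat.div2_val]
      first
        | (have := Nat.size_le.1 ha; rw [List.length_cons, pow_succ] at this; dsimp only; omega)
        | (have := Nat.size_le.1 hb; rw [List.length_cons, pow_succ] at this; dsimp only; omega)

namespace PolyTime

variable {α β γ δ σ : Type} [Enc α] [Enc β] [Enc γ] [Enc δ] [Enc σ]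

theorem add {f g : α → ℕ} (hf : PolyTime f) (hg : PolyTime g) : PolyTime fun a => f a + g a := by
  have h₁ : PolyTime fun a : α =>
      ((f a).bits ++ (g a).bits).foldl (fun s _ => addStep s) (f a, g a, false, []) := by
    refine foldl_of_le_add (f := fun _ s _ => addStep s) (s := fun a => (f a, g a, false, []))
      (K := fun _ => 10) ?_ (hf.pair (hg.pair (const _))) (hf.bits.append hg.bits) (.const _) ?_
    · have h : PolyTime fun p : α × (ℕ × ℕ × Bool × List Bool) × Bool => p.2.1 := id.snd.fst
      have ha := h.fst.bodd
      have hb := h.snd.fst.bodd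
      have hc := h.snd.snd.fst
      exact h.fst.half.pair (h.snd.fst.half.pair (((ha.and hb).or (hc.and (ha.or hb))).pair
        ((ha.xor (hb.xor hc)).cons h.snd.snd.snd)))
    · rintro _ ⟨a, b, c, l⟩ _ _
      have h₁ := sz_div2_le a
      have h₂ := sz_div2_le b
      have h₃ := sz_bool_le ((a.bodd && b.bodd) || (c && (a.bodd || b.bodd)))
      have h₄ := sz_bool_le (Bool.xor a.bodd (Bool.xor b.bodd c))
      simp only [addStep, sz_pair, sz_cons]
      omega
  refine (foldl_of_le_add (f := fun _ s b => Nat.bit b s) (K := fun _ => 4)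
    (id.snd.snd.bit id.snd.fst) (h₁.snd.snd.fst.bit (const 0)) h₁.snd.snd.snd (.const _)
    fun _ s a _ => sz_bit_le a s).congr fun a => add_eq_digitsOnto (f a) (g a)

theorem decide_le {f g : α → ℕ} (hf : PolyTime f) (hg : PolyTime g) :
    PolyTime fun a => decide (f a ≤ g a) := by
  refine (foldl_of_le_add (f := fun _ s _ => leStep s) (s := fun a => (f a, g a, true))
    (l := fun a => (f a).bits ++ (g a).bits)
    (K := fun _ => 10) ?_ (hf.pair (hg.pair (const _))) (hf.bits.append hg.bits) (.const _)
    ?_).snd.snd.congr ?_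
  · have h : PolyTime fun p : α × (ℕ × ℕ × Bool) × Bool => p.2.1 := id.snd.fst
    have ha := h.fst.bodd
    have hb := h.snd.fst.bodd
    exact h.fst.half.pair (h.snd.fst.half.pair ((ha.xor hb).cond hb h.snd.snd))
  · rintro _ ⟨a, b, c⟩ _ _
    have h₁ := sz_div2_le a
    have h₂ := sz_div2_le b
    have h₃ := sz_bool_le (bif Bool.xor a.bodd b.bodd then b.bodd else c)
    simp only [leStep, sz_pair]
    omega
  · intro a
    rw [foldl_leStep _ _ _ _ (by simp [← Nat.size_eq_bits_len])
      (by simp [← Nat.size_eq_bits_len])]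
    split_ifs with h <;> grind

theorem decide_lt {f g : α → ℕ} (hf : PolyTime f) (hg : PolyTime g) :
    PolyTime fun a => decide (f a < g a) :=
  (hg.decide_le hf).not.congr fun a => by simp [← decide_not]

theorem decide_eq {f g : α → ℕ} (hf : PolyTime f) (hg : PolyTime g) :
    PolyTime fun a => decide (f a = g a) :=
  ((hf.decide_le hg).and (hg.decide_le hf)).congr fun a => by
    rw [← Bool.decide_and, decide_eq_decide, le_antisymm_iff]

theorem decide_eq_pair {f g : α → ℕ × ℕ} (hf : PolyTime f) (hg : PolyTime g) :
    PolyTime fun a => decide (f a = g a) :=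
  ((hf.fst.decide_eq hg.fst).and (hf.snd.decide_eq hg.snd)).congr fun a => by
    rw [← Bool.decide_and, decide_eq_decide, Prod.ext_iff]

theorem min {f g : α → ℕ} (hf : PolyTime f) (hg : PolyTime g) :
    PolyTime fun a => Min.min (f a) (g a) :=
  (ite (hf.decide_le hg) hf hg).congr fun a => by rw [min_def]

theorem mul {f g : α → ℕ} (hf : PolyTime f) (hg : PolyTime g) : PolyTime fun a => f a * g a := by
  have h : ∀ (l : List Bool) (n : ℕ), l.foldr (fun b s => if b = true then s + s + n else s + s) 0 =
      l.foldr Nat.bit 0 * n := by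
    intro l n
    induction l with
    | nil => simp
    | cons b l ih =>
      rw [List.foldr_cons, List.foldr_cons, ih, Nat.bit_val]
      cases b <;> simp <;> ring
  have h' : ∀ n : ℕ, n.bits.foldr Nat.bit 0 = n := by
    intro n
    induction n using Nat.binaryRec' with
    | zero => simp
    | bit b n hn ih => rw [Nat.bits_append_bit _ _ hn, List.foldr_cons, ih]
  -- Horner's rule meets the leading digits of `f a`, which are suffixes of its digit list; so no
  -- intermediate value exceeds the product.
  have hm : ∀ l l' : List Bool, l' <:+ l → l'.foldr Nat.bit 0 ≤ l.foldr Nat.bit 0 := by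
    rintro _ l' ⟨r, rfl⟩
    induction r with
    | nil => simp
    | cons b r ih =>
      rw [List.cons_append, List.foldr_cons, Nat.bit_val]
      omega
  refine (foldr (f := fun a b s => if b = true then s + s + g a else s + s) (s := fun _ => 0)
    (l := fun a => (f a).bits) (B := fun a => 2 * (2 * (sz (f a) + sz (g a))))
    (ite id.snd.snd.bool_decide ((id.snd.fst.add id.snd.fst).add (hg.comp id.fst))
      (id.snd.fst.add id.snd.fst)) (const _) hf.bits
      ((PolyBdd.const 2).mul ((PolyBdd.const 2).mul (hf.sz_bdd.add hg.sz_bdd))) ?_).congr ?_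
  · intro a l hl
    rw [h]
    refine (sz_nat_mono (n := f a * g a) ?_).trans (Nat.mul_le_mul_left _ (sz_mul_le _ _))
    gcongr
    exact (hm _ _ hl).trans (h' _).le
  · intro a
    rw [h, h']

theorem sum {l : α → List ℕ} (hl : PolyTime l) : PolyTime fun a => (l a).sum := by
  refine foldr (f := fun _ a s => a + s) (s := fun _ => 0)
    (id.snd.snd.add id.snd.fst) (const _) hl
    ((PolyBdd.const 2).mul hl.sz_bdd) fun a l' hl' => ?_
  exact (sz_sum_le l').trans (Nat.mul_le_mul_left _ (sz_suffix_le hl'))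

theorem length {l : γ → List α} (hl : PolyTime l) : PolyTime fun a => (l a).length :=
  (hl.map (f := fun _ _ => 1) (const 1)).sum.congr fun a => by simp

theorem zipIdx {l : γ → List α} (hl : PolyTime l) : PolyTime fun a => (l a).zipIdx := by
  have key : ∀ (l : List α) (i : ℕ) (r : List (α × ℕ)),
      l.foldl (fun (p : ℕ × List (α × ℕ)) a => (p.1 + 1, (a, p.1) :: p.2)) (i, r) =
        (i + l.length, (l.zipIdx i).reverse ++ r) := by
    intro l
    induction l with
    | nil => simp
    | cons a l ih =>
      intro i r
      rw [List.foldl_cons, ih]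
      simp
      omega
  refine (foldl (f := fun _ (p : ℕ × List (α × ℕ)) a => (p.1 + 1, (a, p.1) :: p.2))
    (s := fun _ => (0, [])) (l := l)
    (B := fun x => (4 * sz (l x) + 1) + (sz (l x) * (sz (l x) + (4 * sz (l x) + 1) + 2) + 1) + 1)
    ?_ (const _) hl ?_ ?_).snd.reverse.congr ?_
  · exact (id.snd.fst.fst.add (const 1)).pair ((id.snd.snd.pair id.snd.fst.fst).cons id.snd.fst.snd)
  · have h := hl.sz_bdd
    have h' := ((PolyBdd.const 4).mul h).add (.const 1)
    exact (h'.add ((h.mul ((h.add h').add (.const 2))).add (.const 1))).add (.const 1)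
  · intro x l' hl'
    have hlen := hl'.length_le.trans (length_lt_sz (l x)).le
    rw [key, sz_pair, List.append_nil, sz_reverse]
    have h₁ := sz_nat_le_self (0 + l'.length)
    have h₂ : sz l'.zipIdx ≤ l'.zipIdx.length * (sz (l x) + (4 * sz (l x) + 1) + 1 + 1) + 1 := by
      refine sz_list_le ?_
      rintro ⟨a, i⟩ h
      have h₁ := List.mem_zipIdx h
      have h₂ := sz_nat_le_self i
      have h₃ : a ∈ l x := hl'.subset (by rw [h₁.2.2]; exact List.getElem_mem _)
      have h₄ := sz_lt_of_mem h₃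
      rw [sz_pair]
      omega
    rw [List.length_zipIdx] at h₂
    have h₃ : l'.length * (sz (l x) + (4 * sz (l x) + 1) + 1 + 1) ≤
      sz (l x) * (sz (l x) + (4 * sz (l x) + 1) + 2) := by gcongr
    omega
  · intro x
    rw [key]
    simp

end PolyTime

/-- Look-up in an association list, with default value `0`. -/
def look {κ : Type} [DecidableEq κ] (l : List (κ × ℕ)) (k : κ) : ℕ :=
  l.foldr (fun p r => if p.1 = k then p.2 else r) 0

theorem look_cons {κ : Type} [DecidableEq κ] (p : κ × ℕ) (l : List (κ × ℕ)) (k : κ) :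
    look (p :: l) k = if p.1 = k then p.2 else look l k := rfl

theorem look_map {κ : Type} [DecidableEq κ] (l : List κ) (f : κ → ℕ) {k : κ} (hk : k ∈ l) :
    look (l.map fun k => (k, f k)) k = f k := by
  induction l with
  | nil => simp at hk
  | cons a l ih =>
    rw [List.map_cons, look_cons]
    split_ifs with h
    · dsimp only at h ⊢; rw [h]
    · exact ih ((List.mem_cons.1 hk).resolve_left fun h' => h h'.symm)

theorem look_mem {κ : Type} [DecidableEq κ] {l : List (κ × ℕ)} {k : κ} (h : ∃ p ∈ l, p.1 = k) :
    (k, look l k) ∈ l := by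
  induction l with
  | nil => simp at h
  | cons a l ih =>
    rw [look_cons]
    split_ifs with h'
    · simp [← h']
    · obtain ⟨p, hp, rfl⟩ := h
      have := ih ⟨p, (List.mem_cons.1 hp).resolve_left fun h => h' (by rw [h]), rfl⟩
      simp [this]

/-- The element of a list of numbers at a given position, with default value `0`. -/
theorem look_zipIdx (l : List ℕ) (i : ℕ) :
    look (l.zipIdx.map fun p => (p.2, p.1)) i = l.getD i 0 := by
  have key : ∀ (l : List ℕ) (s i : ℕ), look ((l.zipIdx s).map fun p => (p.2, p.1)) (s + i) =
      l.getD i 0 := by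
    intro l
    induction l with
    | nil => intro s i; simp [look]
    | cons a l ih =>
      intro s i
      rw [List.zipIdx_cons, List.map_cons, look_cons]
      cases i with
      | zero => simp
      | succ i =>
        rw [if_neg (by dsimp only; omega), List.getD_cons_succ, ← ih (s + 1) i]
        congr 1
        omega
  simpa using key l 0 i

namespace PolyTime

variable {α β γ δ σ : Type} [Enc α] [Enc β] [Enc γ] [Enc δ] [Enc σ]

theorem look {κ : Type} [Enc κ] [DecidableEq κ]
    (heq : PolyTime fun p : κ × κ => decide (p.1 = p.2)) {l : α → List (κ × ℕ)} {k : α → κ}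
    (hl : PolyTime l) (hk : PolyTime k) : PolyTime fun a => look (l a) (k a) := by
  refine foldr_of_le_add (f := fun a p r => if p.1 = k a then p.2 else r) (s := fun _ => 0) (l := l)
    (K := fun a => sz (l a))
    (ite (heq.comp (g := fun p : α × ℕ × κ × ℕ => (p.2.2.1, k p.1))
      (id.snd.snd.fst.pair (hk.comp id.fst))) id.snd.snd.snd id.snd.fst) (const _) hl
    hl.sz_bdd ?_
  intro a s p hp
  have := sz_lt_of_mem hp
  have h : sz p = sz p.1 + sz p.2 + 1 := rfl
  split_ifs <;> omega

theorem look_nat {l : α → List (ℕ × ℕ)} {k : α → ℕ}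
    (hl : PolyTime l) (hk : PolyTime k) : PolyTime fun a => _root_.look (l a) (k a) :=
  look (id.fst.decide_eq id.snd) hl hk

theorem look_pair {l : α → List ((ℕ × ℕ) × ℕ)} {k : α → ℕ × ℕ}
    (hl : PolyTime l) (hk : PolyTime k) : PolyTime fun a => _root_.look (l a) (k a) :=
  look (id.fst.decide_eq_pair id.snd) hl hk

theorem getD {l : α → List ℕ} {i : α → ℕ} (hl : PolyTime l) (hi : PolyTime i) :
    PolyTime fun a => (l a).getD (i a) 0 :=
  ((hl.zipIdx.map (f := fun _ p => (p.2, p.1)) (id.snd.snd.pair id.snd.fst)).look_nat hi).congr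
    fun _ => (look_zipIdx _ _).symm

/-- The cheapest element of a list and a further element. -/
theorem foldl_min {f : γ → α → ℕ} {s : γ → α} {l : γ → List α}
    (hf : PolyTime fun p : γ × α => f p.1 p.2) (hs : PolyTime s) (hl : PolyTime l) :
    PolyTime fun x => (l x).foldl (fun s a => if f x a < f x s then a else s) (s x) := by
  refine foldl_of_le_add (f := fun x s a => if f x a < f x s then a else s)
    (K := fun x => sz (l x)) (ite ((hf.comp (id.fst.pair id.snd.snd)).decide_lt
      (hf.comp (id.fst.pair id.snd.fst))) id.snd.snd id.snd.fst) hs hl hl.sz_bdd ?_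
  intro x s a ha
  have := sz_lt_of_mem ha
  split_ifs <;> omega

end PolyTime

/-! ### Balanced orientations of multigraphs -/

/-- A trail: its first vertex, its last vertex, and its arcs in any order. -/
abbrev Trail := ℕ × ℕ × List (ℕ × ℕ)

namespace Trail

/-- The trails have a common end. -/
def Meets (e s : Trail) : Prop := (e.1 = s.1 ∨ e.1 = s.2.1) ∨ (e.2.1 = s.1 ∨ e.2.1 = s.2.1)

instance (e s : Trail) : Decidable (Meets e s) := by unfold Meets; infer_instance

/-- Concatenation of two trails at a common end, after reversal of one of them if necessary. -/
def join (e s : Trail) : Trail :=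
  if e.2.1 = s.1 then (e.1, s.2.1, e.2.2 ++ s.2.2)
  else if e.2.1 = s.2.1 then (e.1, s.1, e.2.2 ++ s.2.2.map Prod.swap)
  else if e.1 = s.2.1 then (s.1, e.2.1, e.2.2 ++ s.2.2)
  else (s.2.1, e.2.1, e.2.2 ++ s.2.2.map Prod.swap)

/-- Joins the first trail with the given one if they meet, and sets the latter aside if not. -/
def absorb (p : Trail × List Trail) (s : Trail) : Trail × List Trail :=
  if Meets p.1 s then (join p.1 s, p.2) else (p.1, s :: p.2)

/-- Adds an edge to a system of trails no two of which meet. -/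
def insert (S : List Trail) (a : ℕ × ℕ) : List Trail :=
  (S.foldl absorb ((a.1, a.2, [a]), [])).1 :: (S.foldl absorb ((a.1, a.2, [a]), [])).2

end Trail

/-- Out-degree minus in-degree. -/
def excess (L : List (ℕ × ℕ)) (v : ℕ) : ℤ :=
  (L.countP fun a => decide (a.1 = v)) - (L.countP fun a => decide (a.2 = v))

theorem excess_append (L L' : List (ℕ × ℕ)) (v : ℕ) :
    excess (L ++ L') v = excess L v + excess L' v := by
  simp only [excess, List.countP_append]
  push_cast
  ring

theorem excess_swap (L : List (ℕ × ℕ)) (v : ℕ) : excess (L.map Prod.swap) v = - excess L v := by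
  simp only [excess, List.countP_map, Function.comp_def, Prod.fst_swap, Prod.snd_swap]
  ring

/-- Indicator of equality. -/
def delta (u v : ℕ) : ℤ := if u = v then 1 else 0

namespace Trail

/-- The arcs form a directed trail between the given ends, as far as degrees are concerned. -/
def Good (e : Trail) : Prop := ∀ v, excess e.2.2 v = delta e.1 v - delta e.2.1 v

/-- The contributions of the common end cancel; reversing a trail negates its excess and exchanges
its ends. -/
theorem Good.join {e s : Trail} (he : e.Good) (hs : s.Good) (h : Meets e s) : (join e s).Good := by
  intro v
  have h₁ := he v
  have h₂ := hs v
  unfold Trail.join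
  split_ifs with ha hb hc
  · rw [excess_append, h₁, h₂, ha]; ring
  · rw [excess_append, excess_swap, h₁, h₂, hb]; ring
  · rw [excess_append, h₁, h₂, hc]; ring
  · have hd : e.1 = s.1 := by unfold Meets at h; tauto
    rw [excess_append, excess_swap, h₁, h₂, hd]; ring

theorem Meets.of_join {e s k : Trail} (h : Meets (join e s) k) : Meets e k ∨ Meets s k := by
  unfold join at h
  unfold Meets at *
  split_ifs at h <;> dsimp only at h <;> tauto

theorem meets_comm {e s : Trail} : Meets e s ↔ Meets s e := by
  unfold Meets
  constructor <;> (intro h; rcases h with (h | h) | (h | h) <;> simp [h])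

/-- Total weight of the arcs. -/
def weight (f : ℕ × ℕ → ℕ) (S : List Trail) : ℕ := (S.map fun e => (e.2.2.map f).sum).sum

theorem sum_join {f : ℕ × ℕ → ℕ} (hf : ∀ a, f a.swap = f a) (e s : Trail) :
    ((join e s).2.2.map f).sum = (e.2.2.map f).sum + (s.2.2.map f).sum := by
  unfold join
  split_ifs <;> simp [Function.comp_def, hf]

/-- Trails that are good and pairwise disjoint at their ends. -/
def GoodSystem (S : List Trail) : Prop :=
  (∀ e ∈ S, e.Good) ∧ S.Pairwise fun e s => ¬ Meets e s

/-- A trail set aside meets neither the growing trail nor the trails still to come. Joining creates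
no new ends, so this persists and one pass suffices. -/
theorem foldl_absorb (S : List Trail) : ∀ p : Trail × List Trail, p.1.Good → GoodSystem S →
    GoodSystem p.2 → (∀ k ∈ p.2, ¬ Meets p.1 k) → (∀ k ∈ p.2, ∀ s ∈ S, ¬ Meets k s) →
    GoodSystem ((S.foldl absorb p).1 :: (S.foldl absorb p).2) := by
  induction S with
  | nil =>
    rintro ⟨e, K⟩ he _ hK h _
    refine ⟨?_, List.pairwise_cons.2 ⟨h, hK.2⟩⟩
    intro k hk
    rcases List.mem_cons.1 hk with rfl | hk
    · exact he
    · exact hK.1 k hk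
  | cons s S ih =>
    rintro ⟨e, K⟩ he hS hK h h'
    have hS' : GoodSystem S := ⟨fun k hk => hS.1 k (by simp [hk]), (List.pairwise_cons.1 hS.2).2⟩
    have hs := (List.pairwise_cons.1 hS.2).1
    rw [List.foldl_cons, absorb]
    dsimp only at *
    split_ifs with hm
    · refine ih (join e s, K) (he.join (hS.1 s (by simp)) hm) hS' hK ?_
        fun k hk t ht => h' k hk t (by simp [ht])
      intro k hk hj
      rcases hj.of_join with hj | hj
      · exact h k hk hj
      · exact h' k hk s (by simp) (meets_comm.1 hj)
    · refine ih (e, s :: K) he hS' ⟨?_, List.pairwise_cons.2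
        ⟨fun k hk => fun hc => h' k hk s (by simp) (meets_comm.1 hc), hK.2⟩⟩ ?_ ?_
      · intro k hk
        rcases List.mem_cons.1 hk with rfl | hk
        · exact hS.1 k (by simp)
        · exact hK.1 k hk
      · intro k hk
        rcases List.mem_cons.1 hk with rfl | hk
        · exact hm
        · exact h k hk
      · intro k hk t ht
        rcases List.mem_cons.1 hk with rfl | hk
        · exact hs t ht
        · exact h' k hk t (by simp [ht])

theorem weight_foldl_absorb {f : ℕ × ℕ → ℕ} (hf : ∀ a, f a.swap = f a) (S : List Trail) :
    ∀ p : Trail × List Trail, weight f ((S.foldl absorb p).1 :: (S.foldl absorb p).2) =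
      weight f (p.1 :: p.2) + weight f S := by
  induction S with
  | nil => simp [weight]
  | cons s S ih =>
    intro p
    rw [List.foldl_cons, ih, absorb]
    split_ifs
    · simp only [weight, List.map_cons, List.sum_cons, sum_join hf]; omega
    · simp only [weight, List.map_cons, List.sum_cons]; omega

theorem GoodSystem.insert {S : List Trail} (hS : GoodSystem S) (a : ℕ × ℕ) :
    GoodSystem (insert S a) := by
  refine foldl_absorb S _ ?_ hS ⟨by simp, by simp⟩ (by simp) (by simp)
  intro v
  simp only [excess, List.countP_singleton, delta]
  split_ifs <;> simp_all

theorem weight_insert {f : ℕ × ℕ → ℕ} (hf : ∀ a, f a.swap = f a) (S : List Trail) (a : ℕ × ℕ) :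
    weight f (insert S a) = f a + weight f S := by
  rw [insert, weight_foldl_absorb hf]
  simp [weight]

theorem excess_flatMap_of_forall_ne {S : List Trail} (hS : ∀ e ∈ S, e.Good) {v : ℕ}
    (h : ∀ e ∈ S, e.1 ≠ v ∧ e.2.1 ≠ v) : excess (S.flatMap fun e => e.2.2) v = 0 := by
  induction S with
  | nil => simp [excess]
  | cons e S ih =>
    rw [List.flatMap_cons, excess_append, ih (fun s hs => hS s (by simp [hs]))
      (fun s hs => h s (by simp [hs])), hS e (by simp)]
    simp [delta, h e (by simp)]

/-- A vertex is an end of at most one trail, and all other trails are balanced there; a closed trail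
contributes zero as well. -/
theorem GoodSystem.excess_flatMap {S : List Trail} (hS : GoodSystem S) (v : ℕ) :
    |excess (S.flatMap fun e => e.2.2) v| ≤ 1 := by
  induction S with
  | nil => simp [excess]
  | cons e S ih =>
    have hS' : GoodSystem S := ⟨fun k hk => hS.1 k (by simp [hk]), (List.pairwise_cons.1 hS.2).2⟩
    have hs := (List.pairwise_cons.1 hS.2).1
    rw [List.flatMap_cons, excess_append, hS.1 e (by simp)]
    by_cases hv : e.1 = v ∨ e.2.1 = v
    · rw [excess_flatMap_of_forall_ne hS'.1 (v := v)]
      · unfold delta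
        split_ifs <;> simp
      · intro s hs'
        have := hs s hs'
        unfold Meets at this
        rcases hv with rfl | rfl <;> constructor <;> intro h <;> simp [h] at this
    · have : delta e.1 v = 0 ∧ delta e.2.1 v = 0 := by
        unfold delta
        rw [not_or] at hv
        simp [hv]
      rw [this.1, this.2]
      simpa using ih hS'

end Trail

/-- An orientation of the multigraph with the given list of edges. -/
def orient (E : List (ℕ × ℕ)) : List (ℕ × ℕ) := (E.foldl Trail.insert []).flatMap fun e => e.2.2

theorem abs_excess_orient_le (E : List (ℕ × ℕ)) (v : ℕ) : |excess (orient E) v| ≤ 1 := by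
  have h : ∀ (E : List (ℕ × ℕ)) (S : List Trail), Trail.GoodSystem S →
      Trail.GoodSystem (E.foldl Trail.insert S) := by
    intro E
    induction E with
    | nil => exact fun S hS => hS
    | cons a E ih => exact fun S hS => ih _ (hS.insert a)
  exact (h E [] ⟨by simp, by simp⟩).excess_flatMap v

/-- This for all symmetric weights is the usable form of the fact that `orient` only permutes and
reverses edges. -/
theorem sum_orient {f : ℕ × ℕ → ℕ} (hf : ∀ a, f a.swap = f a) (E : List (ℕ × ℕ)) :
    ((orient E).map f).sum = (E.map f).sum := by
  have h : ∀ (E : List (ℕ × ℕ)) (S : List Trail),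
      Trail.weight f (E.foldl Trail.insert S) = (E.map f).sum + Trail.weight f S := by
    intro E
    induction E with
    | nil => simp
    | cons a E ih =>
      intro S
      rw [List.foldl_cons, ih, Trail.weight_insert hf]
      simp; ring
  have h' : ∀ S : List Trail, ((S.flatMap fun e => e.2.2).map f).sum = Trail.weight f S := by
    intro S
    induction S with
    | nil => simp [Trail.weight]
    | cons e S ih => simp_all [Trail.weight]
  rw [orient, h', h]
  simp [Trail.weight]

theorem List.sum_map_ite_eq_countP {α : Type*} (p : α → Bool) (l : List α) :
    (l.map fun a => if p a = true then 1 else 0).sum = l.countP p := by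
  induction l with
  | nil => simp
  | cons a l ih => rw [List.map_cons, List.sum_cons, ih, List.countP_cons]; omega

/-! ### Splitting an assignment into two halves -/

/-- The edge of the bipartite graph that joins the point `p.1` to the location `p.2`. -/
def toEdge (p : ℕ × ℕ) : ℕ × ℕ := (Nat.bit false p.1, Nat.bit true p.2)

/-- The edges oriented from points to locations. -/
def forwardHalf (E : List (ℕ × ℕ)) : List (ℕ × ℕ) :=
  ((orient (E.map toEdge)).filter fun a => !a.1.bodd).map fun a => (a.1.div2, a.2.div2)

/-- The edges oriented from locations to points. -/
def backwardHalf (E : List (ℕ × ℕ)) : List (ℕ × ℕ) :=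
  ((orient (E.map toEdge)).filter fun a => a.1.bodd).map fun a => (a.2.div2, a.1.div2)

theorem bodd_ne_of_mem_orient {E : List (ℕ × ℕ)} {a : ℕ × ℕ} (h : a ∈ orient (E.map toEdge)) :
    a.1.bodd ≠ a.2.bodd := by
  -- The indicator of an edge within one side is a symmetric weight with total zero.
  have hs := sum_orient (f := fun a => if a.1.bodd = a.2.bodd then 1 else 0)
    (fun a => by simp only [Prod.fst_swap, Prod.snd_swap, eq_comm]) (E.map toEdge)
  rw [List.map_map, List.sum_eq_zero (l := E.map _)] at hs
  · have := List.sum_eq_zero_iff.1 hs _ (List.mem_map_of_mem h)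
    simpa using this
  · intro n hn
    obtain ⟨p, _, rfl⟩ := List.mem_map.1 hn
    simp [toEdge]

theorem sum_halves (f : ℕ × ℕ → ℕ) (E : List (ℕ × ℕ)) :
    ((forwardHalf E).map f).sum + ((backwardHalf E).map f).sum = (E.map f).sum := by
  -- `F` makes `f` symmetric: the parities of the ends tell point from location, whatever the
  -- direction of the edge.
  let F : ℕ × ℕ → ℕ := fun a => if a.1.bodd = a.2.bodd then 0 else
    if a.1.bodd then f (a.2.div2, a.1.div2) else f (a.1.div2, a.2.div2)
  have hF : ∀ a, F a.swap = F a := by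
    rintro ⟨a, b⟩
    simp only [F, Prod.swap_prod_mk]
    cases a.bodd <;> cases b.bodd <;> simp
  have h₁ : (E.map f).sum = ((orient (E.map toEdge)).map F).sum := by
    rw [sum_orient hF, List.map_map]
    congr 1
    refine List.map_congr_left fun p _ => ?_
    simp [F, toEdge]
  have h₂ : ∀ a ∈ orient (E.map toEdge), a.1.bodd ≠ a.2.bodd := fun a ha =>
    bodd_ne_of_mem_orient ha
  rw [h₁, forwardHalf, backwardHalf]
  generalize orient (E.map toEdge) = O at h₂
  induction O with
  | nil => simp
  | cons a O ih =>
    have h₃ := ih fun b hb => h₂ b (by simp [hb])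
    have h₄ := h₂ a (by simp)
    rw [List.map_cons, List.sum_cons, ← h₃]
    simp only [F, if_neg h₄]
    cases ha : a.1.bodd
    · simp [ha]; omega
    · simp [ha]; omega

theorem countP_halves (p : ℕ × ℕ → Bool) (E : List (ℕ × ℕ)) :
    (forwardHalf E).countP p + (backwardHalf E).countP p = E.countP p := by
  simp only [← List.sum_map_ite_eq_countP]
  exact sum_halves _ E

theorem even_iff_div2 (a x : ℕ) : (a.bodd = false ∧ a.div2 = x) ↔ a = Nat.bit false x := by
  constructor
  · rintro ⟨h, rfl⟩
    rw [← h, Nat.bit_bodd_div2]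
  · rintro rfl
    simp

theorem odd_iff_div2 (a x : ℕ) : (a.bodd = true ∧ a.div2 = x) ↔ a = Nat.bit true x := by
  constructor
  · rintro ⟨h, rfl⟩
    rw [← h, Nat.bit_bodd_div2]
  · rintro rfl
    simp

/-- Forward edges leave the vertex of the point `x` and backward edges enter it, so the difference
is its excess in the orientation. -/
theorem abs_fst_halves_le (E : List (ℕ × ℕ)) (x : ℕ) :
    |((forwardHalf E).countP fun p => decide (p.1 = x) : ℤ) -
      (backwardHalf E).countP fun p => decide (p.1 = x)| ≤ 1 := by
  convert abs_excess_orient_le (E.map toEdge) (Nat.bit false x) using 1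
  rw [excess, forwardHalf, backwardHalf, List.countP_map, List.countP_map, List.countP_filter,
    List.countP_filter]
  congr 2
  · congr 1
    refine List.countP_congr fun a ha => ?_
    simp only [Function.comp_apply, Bool.and_eq_true, decide_eq_true_eq, ← even_iff_div2,
      Bool.not_eq_true', and_comm]
  · congr 1
    refine List.countP_congr fun a ha => ?_
    have := bodd_ne_of_mem_orient ha
    simp only [Function.comp_apply, Bool.and_eq_true, decide_eq_true_eq, ← even_iff_div2]
    cases h₁ : a.1.bodd <;> cases h₂ : a.2.bodd <;> simp_all

theorem abs_snd_halves_le (E : List (ℕ × ℕ)) (x : ℕ) :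
    |((forwardHalf E).countP fun p => decide (p.2 = x) : ℤ) -
      (backwardHalf E).countP fun p => decide (p.2 = x)| ≤ 1 := by
  rw [abs_sub_comm]
  convert abs_excess_orient_le (E.map toEdge) (Nat.bit true x) using 1
  rw [excess, forwardHalf, backwardHalf, List.countP_map, List.countP_map, List.countP_filter,
    List.countP_filter]
  congr 2
  · congr 1
    refine List.countP_congr fun a ha => ?_
    simp only [Function.comp_apply, Bool.and_eq_true, decide_eq_true_eq, ← odd_iff_div2, and_comm]
  · congr 1
    refine List.countP_congr fun a ha => ?_
    have := bodd_ne_of_mem_orient ha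
    simp only [Function.comp_apply, Bool.and_eq_true, decide_eq_true_eq, ← odd_iff_div2]
    cases h₁ : a.1.bodd <;> cases h₂ : a.2.bodd <;> simp_all

/-- The cheaper half of an assignment. -/
def halve (w : ℕ × ℕ → ℕ) (E : List (ℕ × ℕ)) : List (ℕ × ℕ) :=
  if ((forwardHalf E).map w).sum ≤ ((backwardHalf E).map w).sum then forwardHalf E
  else backwardHalf E

theorem halve_eq (w : ℕ × ℕ → ℕ) (E : List (ℕ × ℕ)) :
    halve w E = forwardHalf E ∨ halve w E = backwardHalf E := by
  unfold halve
  split_ifs <;> simp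

theorem cost_halve (w : ℕ × ℕ → ℕ) (E : List (ℕ × ℕ)) :
    2 * ((halve w E).map w).sum ≤ (E.map w).sum := by
  have := sum_halves w E
  unfold halve
  split_ifs <;> omega

/-- Two counts with even sum that differ by at most one are equal. -/
theorem countP_fst_halve {w : ℕ × ℕ → ℕ} {E : List (ℕ × ℕ)} {x h : ℕ}
    (hE : (E.countP fun p => decide (p.1 = x)) = 2 * h) :
    ((halve w E).countP fun p => decide (p.1 = x)) = h := by
  have h₁ := countP_halves (fun p => decide (p.1 = x)) E
  have h₂ := abs_le.1 (abs_fst_halves_le E x)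
  rcases halve_eq w E with h | h <;> rw [h] <;> omega

/-- If one half exceeded `h`, the other would be at least `h` and the sum more than `2 * h`. So the
bound is inherited exactly, with no rounding loss. -/
theorem countP_snd_halve_le {w : ℕ × ℕ → ℕ} {E : List (ℕ × ℕ)} {x h : ℕ}
    (hE : (E.countP fun p => decide (p.2 = x)) ≤ 2 * h) :
    ((halve w E).countP fun p => decide (p.2 = x)) ≤ h := by
  have h₁ := countP_halves (fun p => decide (p.2 = x)) E
  have h₂ := abs_le.1 (abs_snd_halves_le E x)
  rcases halve_eq w E with h | h <;> rw [h] <;> omega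

theorem countP_halve_le (w : ℕ × ℕ → ℕ) (E : List (ℕ × ℕ)) (p : ℕ × ℕ → Bool) :
    (halve w E).countP p ≤ E.countP p := by
  have h₁ := countP_halves p E
  rcases halve_eq w E with h | h <;> rw [h] <;> omega

/-- Repeated halving, once for each element of the list `m`. -/
def halvings {α : Type} (w : ℕ × ℕ → ℕ) (m : List α) (E : List (ℕ × ℕ)) : List (ℕ × ℕ) :=
  m.foldl (fun E _ => halve w E) E

section halvings

variable {α : Type} (w : ℕ × ℕ → ℕ)

theorem cost_halvings (m : List α) : ∀ E : List (ℕ × ℕ),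
    2 ^ m.length * ((halvings w m E).map w).sum ≤ (E.map w).sum := by
  induction m with
  | nil => simp [halvings]
  | cons a m ih =>
    intro E
    have h₁ := ih (halve w E)
    have h₂ := cost_halve w E
    change _ * ((halvings w m (halve w E)).map w).sum ≤ _
    rw [List.length_cons, pow_succ, mul_comm _ 2, mul_assoc]
    omega

theorem countP_fst_halvings {x h : ℕ} (m : List α) : ∀ E : List (ℕ × ℕ),
    (E.countP fun p => decide (p.1 = x)) = 2 ^ m.length * h →
    ((halvings w m E).countP fun p => decide (p.1 = x)) = h := by
  induction m with
  | nil => simp [halvings]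
  | cons a m ih =>
    intro E hE
    refine ih (halve w E) (countP_fst_halve ?_)
    rw [hE, List.length_cons, pow_succ]
    ring

theorem countP_snd_halvings_le {x h : ℕ} (m : List α) : ∀ E : List (ℕ × ℕ),
    (E.countP fun p => decide (p.2 = x)) ≤ 2 ^ m.length * h →
    ((halvings w m E).countP fun p => decide (p.2 = x)) ≤ h := by
  induction m with
  | nil => simp [halvings]
  | cons a m ih =>
    intro E hE
    refine ih (halve w E) (countP_snd_halve_le (hE.trans (le_of_eq ?_)))
    rw [List.length_cons, pow_succ]
    ring

theorem countP_halvings_le (p : ℕ × ℕ → Bool) (m : List α) : ∀ E : List (ℕ × ℕ),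
    (halvings w m E).countP p ≤ E.countP p := by
  induction m with
  | nil => simp [halvings]
  | cons a m ih => exact fun E => (ih (halve w E)).trans (countP_halve_le w E p)

theorem mem_of_mem_halvings {m : List α} {E : List (ℕ × ℕ)} {p : ℕ × ℕ}
    (h : p ∈ halvings w m E) : p ∈ E := by
  have h₁ := countP_halvings_le w (fun q => decide (q = p)) m E
  have h₂ : 0 < (halvings w m E).countP fun q => decide (q = p) :=
    List.countP_pos_iff.2 ⟨p, h, by simp⟩
  obtain ⟨q, hq, hqp⟩ := List.countP_pos_iff.1 (h₂.trans_le h₁)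
  rw [decide_eq_true_eq] at hqp
  rwa [← hqp]

theorem length_halvings_le (m : List α) (E : List (ℕ × ℕ)) :
    (halvings w m E).length ≤ E.length := by
  have := countP_halvings_le w (fun _ => true) m E
  simpa using this

end halvings

/-! ### The rounding runs in polynomial time -/

theorem sz_swap (L : List (ℕ × ℕ)) : sz (L.map Prod.swap) = sz L := by
  induction L with
  | nil => rfl
  | cons a L ih =>
    rw [List.map_cons, sz_cons, sz_cons, ih]
    change sz (a.2, a.1) + _ + _ = sz (a.1, a.2) + _ + _
    simp only [sz_pair]
    omega

theorem sz_join_le (e s : Trail) : sz (Trail.join e s) ≤ sz e + sz s := by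
  obtain ⟨a, b, L⟩ := e
  obtain ⟨c, d, L'⟩ := s
  have h₁ := sz_append L L'
  have h₂ := sz_append L (L'.map Prod.swap)
  rw [sz_swap] at h₂
  unfold Trail.join
  dsimp only
  split_ifs <;> simp only [sz_pair] <;> omega

theorem sz_absorb_le (p : Trail × List Trail) (s : Trail) :
    sz (Trail.absorb p s) ≤ sz p + sz s + 1 := by
  obtain ⟨e, K⟩ := p
  have := sz_join_le e s
  unfold Trail.absorb
  split_ifs
  · rw [sz_pair e K, sz_pair (Trail.join e s) K]; omega
  · rw [sz_pair e K, sz_pair e (s :: K), sz_cons]; omega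

theorem sz_foldl_absorb_le (S : List Trail) : ∀ p : Trail × List Trail,
    sz (S.foldl Trail.absorb p) + 1 ≤ sz p + sz S := by
  induction S with
  | nil => intro p; simp [sz_nil]
  | cons s S ih =>
    intro p
    have h₁ := ih (Trail.absorb p s)
    have h₂ := sz_absorb_le p s
    rw [List.foldl_cons, sz_cons]
    omega

theorem sz_insert_le (S : List Trail) (a : ℕ × ℕ) : sz (Trail.insert S a) ≤ sz S + (2 * sz a + 6) := by
  have h := sz_foldl_absorb_le S ((a.1, a.2, [a]), [])
  have h₁ : sz (Trail.insert S a) = sz (S.foldl Trail.absorb ((a.1, a.2, [a]), [])) := rfl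
  have h₂ : sz a = sz a.1 + sz a.2 + 1 := rfl
  rw [h₁]
  simp only [sz_pair, sz_cons, sz_nil] at h
  omega

namespace PolyTime

variable {α β γ δ σ : Type} [Enc α] [Enc β] [Enc γ] [Enc δ] [Enc σ]

theorem decide_or {P Q : α → Prop} [DecidablePred P] [DecidablePred Q]
    (hP : PolyTime fun a => decide (P a)) (hQ : PolyTime fun a => decide (Q a)) :
    PolyTime fun a => decide (P a ∨ Q a) :=
  (hP.or hQ).congr fun a => by simp

theorem map_swap {L : α → List (ℕ × ℕ)} (hL : PolyTime L) :
    PolyTime fun a => (L a).map Prod.swap :=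
  hL.map (f := fun _ p => p.swap) (id.snd.snd.pair id.snd.fst)

theorem join {e s : α → Trail} (he : PolyTime e) (hs : PolyTime s) :
    PolyTime fun a => Trail.join (e a) (s a) :=
  ite (he.snd.fst.decide_eq hs.fst) (he.fst.pair (hs.snd.fst.pair (he.snd.snd.append hs.snd.snd)))
    (ite (he.snd.fst.decide_eq hs.snd.fst)
      (he.fst.pair (hs.fst.pair (he.snd.snd.append hs.snd.snd.map_swap)))
    (ite (he.fst.decide_eq hs.snd.fst)
      (hs.fst.pair (he.snd.fst.pair (he.snd.snd.append hs.snd.snd)))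
      (hs.snd.fst.pair (he.snd.fst.pair (he.snd.snd.append hs.snd.snd.map_swap)))))

theorem absorb {p : α → Trail × List Trail} {s : α → Trail} (hp : PolyTime p) (hs : PolyTime s) :
    PolyTime fun a => Trail.absorb (p a) (s a) := by
  refine ite ?_ ((hp.fst.join hs).pair hp.snd) (hp.fst.pair (hs.cons hp.snd))
  exact ((hp.fst.fst.decide_eq hs.fst).decide_or (hp.fst.fst.decide_eq hs.snd.fst)).decide_or
    ((hp.fst.snd.fst.decide_eq hs.fst).decide_or (hp.fst.snd.fst.decide_eq hs.snd.fst))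

theorem insert {S : α → List Trail} {a : α → ℕ × ℕ} (hS : PolyTime S) (ha : PolyTime a) :
    PolyTime fun x => Trail.insert (S x) (a x) := by
  have h : PolyTime fun x => (S x).foldl Trail.absorb (((a x).1, (a x).2, [a x]), []) := by
    refine foldl_of_le_add (f := fun _ p s => Trail.absorb p s) (K := fun x => sz (S x) + 1)
      (id.snd.fst.absorb id.snd.snd)
      ((ha.fst.pair (ha.snd.pair (ha.cons (const [])))).pair (const [])) hS
      (hS.sz_bdd.add (.const 1)) ?_
    intro x p s hs
    have h₁ := sz_absorb_le p s
    have h₂ := sz_lt_of_mem hs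
    omega
  exact h.fst.cons h.snd

theorem orient {E : α → List (ℕ × ℕ)} (hE : PolyTime E) : PolyTime fun x => orient (E x) := by
  have h : PolyTime fun x => (E x).foldl Trail.insert [] := by
    refine foldl_of_le_add (f := fun _ S a => Trail.insert S a) (s := fun _ => [])
      (K := fun x => 2 * sz (E x) + 6)
      (id.snd.fst.insert id.snd.snd) (const []) hE
      (((PolyBdd.const 2).mul hE.sz_bdd).add (.const 6)) ?_
    intro x S a ha
    have h₁ := sz_insert_le S a
    have h₂ := sz_lt_of_mem ha
    omega
  exact h.flatMap (f := fun _ e => e.2.2) id.snd.snd.snd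

theorem orient_toEdge {E : α → List (ℕ × ℕ)} (hE : PolyTime E) :
    PolyTime fun x => _root_.orient ((E x).map toEdge) :=
  (hE.map (f := fun _ p => toEdge p) (((const false).bit id.snd.fst).pair
    ((const true).bit id.snd.snd))).orient

theorem forwardHalf {E : α → List (ℕ × ℕ)} (hE : PolyTime E) :
    PolyTime fun x => forwardHalf (E x) :=
  map (f := fun _ (a : ℕ × ℕ) => (a.1.div2, a.2.div2))
    (hE.orient_toEdge.filter (p := fun _ (a : ℕ × ℕ) => !a.1.bodd) id.snd.fst.bodd.not)
    (id.snd.fst.half.pair id.snd.snd.half)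

theorem backwardHalf {E : α → List (ℕ × ℕ)} (hE : PolyTime E) :
    PolyTime fun x => backwardHalf (E x) :=
  map (f := fun _ (a : ℕ × ℕ) => (a.2.div2, a.1.div2))
    (hE.orient_toEdge.filter (p := fun _ (a : ℕ × ℕ) => a.1.bodd) id.snd.fst.bodd)
    (id.snd.snd.half.pair id.snd.fst.half)

/-- Total weight, where the weights are given by a table. -/
theorem cost {T : α → List ((ℕ × ℕ) × ℕ)} {E : α → List (ℕ × ℕ)} (hT : PolyTime T)
    (hE : PolyTime E) : PolyTime fun x => ((E x).map (_root_.look (T x))).sum :=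
  (hE.map (f := fun x p => _root_.look (T x) p) ((hT.comp id.fst).look_pair id.snd)).sum

theorem halve {T : α → List ((ℕ × ℕ) × ℕ)} {E : α → List (ℕ × ℕ)} (hT : PolyTime T)
    (hE : PolyTime E) : PolyTime fun x => halve (_root_.look (T x)) (E x) :=
  ite ((hT.cost hE.forwardHalf).decide_le (hT.cost hE.backwardHalf)) hE.forwardHalf hE.backwardHalf

theorem halvings {T : γ → List ((ℕ × ℕ) × ℕ)} {E : γ → List (ℕ × ℕ)} {m : γ → List α}
    (hT : PolyTime T) (hm : PolyTime m) (hE : PolyTime E) :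
    PolyTime fun x => halvings (_root_.look (T x)) (m x) (E x) := by
  refine foldl (f := fun x E _ => _root_.halve (_root_.look (T x)) E)
    ((hT.comp id.fst).halve id.snd.fst) hE hm
    (B := fun x => sz (E x) * (sz (E x) + 1) + 1)
    ((hE.sz_bdd.mul (hE.sz_bdd.add (.const 1))).add (.const 1)) ?_
  intro x l' _
  refine (sz_list_le (K := sz (E x)) fun p hp => (sz_lt_of_mem (mem_of_mem_halvings _ hp)).le).trans ?_
  gcongr
  exact (length_halvings_le _ _ _).trans (length_lt_sz _).le

end PolyTime

/-! ### Opening facilities of bounded capacity -/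

/-- Assigns a further client to a facility at location `c`: the first one in the list that is not
full, or a new one. The list consists of the locations and the loads of the open facilities; the
result also contains the position of the chosen facility. -/
def place (u c : ℕ) : List (ℕ × ℕ) → List (ℕ × ℕ) × ℕ
  | [] => ([(c, 1)], 0)
  | f :: F => if f.1 = c ∧ f.2 < u then ((f.1, f.2 + 1) :: F, 0)
      else (f :: (place u c F).1, (place u c F).2 + 1)

/-- Assigns clients one by one to facilities at the given locations. -/
def pack (u : ℕ) (l : List ℕ) : List (ℕ × ℕ) × List ℕ :=
  l.foldl (fun p c => ((place u c p.1).1, p.2 ++ [(place u c p.1).2])) ([], [])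

/-- Number of clients served from location `c`. -/
def loadAt (c : ℕ) (F : List (ℕ × ℕ)) : ℕ := (F.map fun f => if f.1 = c then f.2 else 0).sum

/-- Number of facilities at location `c`. -/
def openAt (c : ℕ) (F : List (ℕ × ℕ)) : ℕ := (F.map fun f => if f.1 = c then 1 else 0).sum

section place

variable (u c : ℕ)

theorem loadAt_place (c' : ℕ) (F : List (ℕ × ℕ)) :
    loadAt c' (place u c F).1 = loadAt c' F + if c = c' then 1 else 0 := by
  induction F with
  | nil => simp [place, loadAt]
  | cons f F ih =>
    rw [place]
    split_ifs with h h'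
    · simp [loadAt, ← h', h.1]; omega
    · have : f.1 ≠ c' := fun h'' => h' (h.1.symm.trans h'')
      simp [loadAt, this]
    · simp only [loadAt, List.map_cons, List.sum_cons] at ih ⊢
      rw [ih, if_pos (c := c = c') ‹_›]; ring
    · simp only [loadAt, List.map_cons, List.sum_cons] at ih ⊢
      rw [ih, if_neg (c := c = c') ‹_›]; ring

/-- A new facility is opened at `c` only when all facilities there are full. -/
theorem openAt_place (F : List (ℕ × ℕ)) :
    (∀ c', openAt c' (place u c F).1 = openAt c' F) ∨
    (∀ c', openAt c' (place u c F).1 = openAt c' F + if c = c' then 1 else 0) ∧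
      u * openAt c F ≤ loadAt c F := by
  induction F with
  | nil => right; simp [place, openAt, loadAt]
  | cons f F ih =>
    rw [place]
    split_ifs with h
    · left; intro c'; simp [openAt]
    · rcases ih with ih | ⟨ih, ih'⟩
      · left
        intro c'
        have := ih c'
        simp only [openAt, List.map_cons, List.sum_cons] at this ⊢
        omega
      · right
        refine ⟨fun c' => ?_, ?_⟩
        · have := ih c'
          simp only [openAt, List.map_cons, List.sum_cons] at this ⊢
          omega
        · simp only [openAt, loadAt, List.map_cons, List.sum_cons] at ih' ⊢
          rw [mul_add]
          by_cases hc : f.1 = c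
          · have : u ≤ f.2 := by
              by_contra h'
              exact h ⟨hc, by omega⟩
            simp only [hc, if_true]
            omega
          · simp only [hc, if_false]
            omega

theorem place_getD (F : List (ℕ × ℕ)) (j : ℕ) :
    ((place u c F).1.getD j (0, 0)).2 =
      (F.getD j (0, 0)).2 + if j = (place u c F).2 then 1 else 0 := by
  induction F generalizing j with
  | nil => cases j <;> simp [place]
  | cons f F ih =>
    rw [place]
    by_cases h : f.1 = c ∧ f.2 < u
    · rw [if_pos h]
      cases j <;> simp
    · rw [if_neg h]
      cases j with
      | zero => simp
      | succ j => simpa using ih j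

theorem place_getD_fst (F : List (ℕ × ℕ)) (j : ℕ) (hj : j < F.length) :
    ((place u c F).1.getD j (0, 0)).1 = (F.getD j (0, 0)).1 := by
  induction F generalizing j with
  | nil => simp at hj
  | cons f F ih =>
    rw [place]
    split_ifs with h <;> cases j
    · simp
    · simp
    · simp
    · simpa using ih _ (by simpa using hj)

theorem place_snd (F : List (ℕ × ℕ)) : (place u c F).2 < (place u c F).1.length ∧
    ((place u c F).1.getD (place u c F).2 (0, 0)).1 = c := by
  induction F with
  | nil => simp [place]
  | cons f F ih =>
    rw [place]
    split_ifs with h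
    · simp [h.1]
    · simpa using ih

theorem length_place (F : List (ℕ × ℕ)) : F.length ≤ (place u c F).1.length ∧
    (place u c F).1.length ≤ F.length + 1 := by
  induction F with
  | nil => simp [place]
  | cons f F ih =>
    rw [place]
    split_ifs with h
    · simp
    · simpa using ih

theorem mem_place {F : List (ℕ × ℕ)} {f : ℕ × ℕ} (hf : f ∈ (place u c F).1) :
    f ∈ F ∨ f = (c, 1) ∨ ∃ g ∈ F, f = (g.1, g.2 + 1) ∧ g.2 < u := by
  induction F with
  | nil => simpa [place] using hf
  | cons g F ih =>
    rw [place] at hf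
    split_ifs at hf with h
    · rcases List.mem_cons.1 hf with rfl | hf
      · exact .inr (.inr ⟨g, by simp, rfl, h.2⟩)
      · exact .inl (by simp [hf])
    · rcases List.mem_cons.1 hf with rfl | hf
      · simp
      · rcases ih hf with h | h | ⟨g', hg, h⟩
        · simp [h]
        · simp [h]
        · exact .inr (.inr ⟨g', by simp [hg], h⟩)

end place

theorem pack_concat (u : ℕ) (l : List ℕ) (c : ℕ) :
    pack u (l ++ [c]) = ((place u c (pack u l).1).1, (pack u l).2 ++ [(place u c (pack u l).1).2]) := by
  simp [pack]

theorem length_pack (u : ℕ) (l : List ℕ) :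
    (pack u l).2.length = l.length ∧ (pack u l).1.length ≤ l.length := by
  induction l using List.reverseRecOn with
  | nil => simp [pack]
  | append_singleton l c ih =>
    have := length_place u c (pack u l).1
    simp only [pack_concat, List.length_append, List.length_singleton]
    omega

theorem mem_pack {u : ℕ} {l : List ℕ} {f : ℕ × ℕ} (hf : f ∈ (pack u l).1) :
    f.1 ∈ l ∧ f.2 ≤ l.length ∧ (1 ≤ u → f.2 ≤ u) := by
  induction l using List.reverseRecOn generalizing f with
  | nil => simp [pack] at hf
  | append_singleton l c ih =>
    rw [pack_concat] at hf
    rcases mem_place _ _ hf with h | rfl | ⟨g, hg, rfl, h⟩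
    · have := ih h
      refine ⟨by simp [this.1], ?_, this.2.2⟩
      simp; omega
    · simp
    · have := ih hg
      refine ⟨by simp [this.1], ?_, fun _ => h⟩
      simp; omega

theorem pack_assign (u : ℕ) (l : List ℕ) {i : ℕ} (hi : i < l.length) :
    (pack u l).2.getD i 0 < (pack u l).1.length ∧
      ((pack u l).1.getD ((pack u l).2.getD i 0) (0, 0)).1 = l.getD i 0 := by
  induction l using List.reverseRecOn generalizing i with
  | nil => simp at hi
  | append_singleton l c ih =>
    have h₁ := length_place u c (pack u l).1
    have h₂ := length_pack u l
    rw [pack_concat]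
    dsimp only
    by_cases h : i < l.length
    · have h₃ := ih h
      rw [List.getD_append _ _ _ _ (by omega), List.getD_append _ _ _ _ h,
        place_getD_fst _ _ _ _ h₃.1]
      exact ⟨by omega, h₃.2⟩
    · have : i = l.length := by simp at hi; omega
      subst this
      have h₃ := place_snd u c (pack u l).1
      rw [List.getD_append_right _ _ _ _ (by omega), List.getD_append_right _ _ _ _ (by omega)]
      simpa [h₂.1] using h₃

theorem count_pack (u : ℕ) (l : List ℕ) (j : ℕ) :
    (pack u l).2.count j = ((pack u l).1.getD j (0, 0)).2 := by
  induction l using List.reverseRecOn with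
  | nil => simp [pack]
  | append_singleton l c ih =>
    rw [pack_concat, List.count_append, ih, place_getD, List.count_singleton]
    simp only [beq_iff_eq]
    congr 1
    exact if_congr eq_comm rfl rfl

theorem count_pack_le {u : ℕ} (hu : 1 ≤ u) (l : List ℕ) (j : ℕ) : (pack u l).2.count j ≤ u := by
  rw [count_pack]
  by_cases hj : j < (pack u l).1.length
  · rw [List.getD_eq_getElem _ _ hj]
    exact (mem_pack (List.getElem_mem hj)).2.2 hu
  · rw [List.getD_eq_default _ _ (by omega)]
    omega

theorem loadAt_pack (u : ℕ) (l : List ℕ) (c : ℕ) : loadAt c (pack u l).1 = l.count c := by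
  induction l using List.reverseRecOn with
  | nil => simp [pack, loadAt]
  | append_singleton l c' ih =>
    rw [pack_concat, List.count_append, ← ih, loadAt_place, List.count_singleton]
    simp

/-- At most one facility per location is partly filled: the number at `c` is at most the load
divided by `u`, rounded up. The hypothesis `1 ≤ u` is needed since a new facility starts with load
1. -/
theorem openAt_pack {u : ℕ} (hu : 1 ≤ u) (l : List ℕ) (c : ℕ) :
    u * openAt c (pack u l).1 + 1 ≤ l.count c + u := by
  induction l using List.reverseRecOn with
  | nil => simp [pack, openAt, hu]
  | append_singleton l c' ih =>
    rw [pack_concat, List.count_append, List.count_singleton]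
    rcases openAt_place u c' (pack u l).1 with h | ⟨h, h'⟩
    · rw [h]; omega
    · rw [h]
      by_cases hc : c' = c
      · subst hc
        rw [loadAt_pack] at h'
        simp [mul_add]
        omega
      · simp [hc]; omega

/-- The number of facilities that are opened is the least possible. -/
theorem length_pack_le {u : ℕ} (hu : 1 ≤ u) {l : List ℕ} {n : ℕ} (hl : ∀ c ∈ l, c < n)
    {b : ℕ → ℕ} (hb : ∀ c < n, l.count c ≤ u * b c) :
    (pack u l).1.length ≤ ∑ c ∈ Finset.range n, b c := by
  have h₁ : ∀ F : List (ℕ × ℕ), (∀ f ∈ F, f.1 < n) →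
      F.length = ∑ c ∈ Finset.range n, openAt c F := by
    intro F hF
    induction F with
    | nil => simp [openAt]
    | cons f F ih =>
      simp only [openAt, List.map_cons, List.sum_cons, Finset.sum_add_distrib] at ih ⊢
      rw [← ih fun g hg => hF g (by simp [hg]), Finset.sum_ite_eq]
      simp [hF f (by simp)]
      omega
  rw [h₁ _ fun f hf => hl _ (mem_pack hf).1]
  refine Finset.sum_le_sum fun c hc => ?_
  have h₂ := openAt_pack hu l c
  have h₃ := hb c (Finset.mem_range.1 hc)
  have h₄ : u * openAt c (pack u l).1 < u * (b c + 1) := by rw [mul_add]; omega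
  exact Nat.lt_succ_iff.1 (Nat.lt_of_mul_lt_mul_left h₄)

theorem sz_succ_le (n : ℕ) : sz (n + 1) ≤ 2 * sz n + 7 := by
  have h₁ := sz_nat_le (n + 1)
  have h₂ := Nat.size_add_le n 1
  have h₃ := le_sz_nat n
  have h₄ : Nat.size 1 = 1 := Nat.size_one
  omega

namespace PolyTime

variable {α β γ δ σ : Type} [Enc α] [Enc β] [Enc γ] [Enc δ] [Enc σ]

/-- The recursion in `place` also uses the unchanged tail, so the fold carries that tail along with
the result. -/
theorem place {u c : α → ℕ} {F : α → List (ℕ × ℕ)} (hu : PolyTime u) (hc : PolyTime c)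
    (hF : PolyTime F) : PolyTime fun x => place (u x) (c x) (F x) := by
  have key : ∀ (u c : ℕ) (F : List (ℕ × ℕ)),
      F.foldr (fun f s => (f :: s.1, if f.1 = c ∧ f.2 < u then ((f.1, f.2 + 1) :: s.1, 0)
        else (f :: s.2.1, s.2.2 + 1))) (([] : List (ℕ × ℕ)), [(c, 1)], 0) =
        (F, _root_.place u c F) := by
    intro u c F
    induction F with
    | nil => rfl
    | cons f F ih => rw [List.foldr_cons, ih, _root_.place]
  have hf : PolyTime fun p : α × (List (ℕ × ℕ) × List (ℕ × ℕ) × ℕ) × (ℕ × ℕ) => p.2.2 := id.snd.snd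
  have hs : PolyTime fun p : α × (List (ℕ × ℕ) × List (ℕ × ℕ) × ℕ) × (ℕ × ℕ) => p.2.1 := id.snd.fst
  refine (foldr (f := fun x (f : ℕ × ℕ) (s : List (ℕ × ℕ) × List (ℕ × ℕ) × ℕ) =>
      (f :: s.1, if f.1 = c x ∧ f.2 < u x then ((f.1, f.2 + 1) :: s.1, 0)
        else (f :: s.2.1, s.2.2 + 1)))
    (s := fun x => ([], [(c x, 1)], 0)) (l := F)
    (B := fun x => sz (F x) + ((sz (F x) * (2 * sz (F x) + 7 + sz (c x) + sz 1 + 2) + 1) +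
      (4 * sz (F x) + 1) + 1) + 1)
    ?_ ?_ hF ?_ ?_).snd.congr ?_
  · refine (hf.cons hs.fst).pair (ite ?_ (((hf.fst.pair (hf.snd.add (const 1))).cons hs.fst).pair
      (const 0)) ((hf.cons hs.snd.fst).pair (hs.snd.snd.add (const 1))))
    exact (hf.fst.decide_eq (hc.comp id.fst)).decide_and (hf.snd.decide_lt (hu.comp id.fst))
  · exact (const []).pair (((hc.pair (const 1)).cons (const [])).pair (const 0))
  · have h₁ := hF.sz_bdd
    have h₂ := hc.sz_bdd
    exact (h₁.add ((((h₁.mul ((((((PolyBdd.const 2).mul h₁).add (.const 7)).add h₂).add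
      (.const (sz 1))).add (.const 2))).add (.const 1)).add
        (((PolyBdd.const 4).mul h₁).add (.const 1))).add (.const 1))).add (.const 1)
  · intro x F' hF'
    rw [key, sz_pair]
    have h₀ := sz_suffix_le hF'
    have h₁ : sz (_root_.place (u x) (c x) F') = sz (_root_.place (u x) (c x) F').1 +
      sz (_root_.place (u x) (c x) F').2 + 1 := rfl
    have h₂ := sz_nat_le_self (_root_.place (u x) (c x) F').2
    have h₃ := place_snd (u x) (c x) F'
    have h₄ := length_place (u x) (c x) F'
    have h₅ := length_lt_sz F'
    have h₆ : sz (_root_.place (u x) (c x) F').1 ≤ (_root_.place (u x) (c x) F').1.length *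
        (2 * sz (F x) + 7 + sz (c x) + sz 1 + 1 + 1) + 1 := by
      refine sz_list_le fun f hf => ?_
      rcases mem_place _ _ hf with h | rfl | ⟨g, hg, rfl, _⟩
      · have := sz_lt_of_mem h
        omega
      · rw [sz_pair]; omega
      · have h₁ := sz_lt_of_mem hg
        have h₂ : sz g = sz g.1 + sz g.2 + 1 := rfl
        have h₃ := sz_succ_le g.2
        rw [sz_pair]; omega
    have h₇ : (_root_.place (u x) (c x) F').1.length *
        (2 * sz (F x) + 7 + sz (c x) + sz 1 + 1 + 1) ≤
        sz (F x) * (2 * sz (F x) + 7 + sz (c x) + sz 1 + 2) :=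
      Nat.mul_le_mul_right _ (by omega)
    omega
  · intro x
    rw [key]

theorem pack {u : α → ℕ} {l : α → List ℕ} (hu : PolyTime u) (hl : PolyTime l) :
    PolyTime fun x => pack (u x) (l x) := by
  have hp : PolyTime fun p : α × (List (ℕ × ℕ) × List ℕ) × ℕ => p.2.1 := id.snd.fst
  have h := (hu.comp (g := fun p : α × (List (ℕ × ℕ) × List ℕ) × ℕ => p.1) id.fst).place
    id.snd.snd hp.fst
  refine foldl (f := fun x (p : List (ℕ × ℕ) × List ℕ) c =>
      ((_root_.place (u x) c p.1).1, p.2 ++ [(_root_.place (u x) c p.1).2])) (s := fun _ => ([], []))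
    (B := fun x => (sz (l x) * (sz (l x) + (4 * sz (l x) + 1) + 2) + 1) +
      (sz (l x) * (4 * sz (l x) + 1 + 1) + 1) + 1)
    (h.fst.pair (hp.snd.append (h.snd.cons (const [])))) (const _) hl ?_ ?_
  · have h := hl.sz_bdd
    have h' := ((PolyBdd.const 4).mul h).add (.const 1)
    exact (((h.mul ((h.add h').add (.const 2))).add (.const 1)).add
      ((h.mul (h'.add (.const 1))).add (.const 1))).add (.const 1)
  · intro x l' hl'
    change sz ((_root_.pack (u x) l').1, (_root_.pack (u x) l').2) ≤ _
    have h₁ := hl'.length_le.trans (length_lt_sz (l x)).le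
    have h₂ := length_pack (u x) l'
    rw [sz_pair]
    refine Nat.add_le_add (Nat.add_le_add ?_ ?_) le_rfl
    · refine (sz_list_le (K := sz (l x) + (4 * sz (l x) + 1) + 1) fun f hf => ?_).trans
        (Nat.add_le_add_right (Nat.mul_le_mul_right _ (h₂.2.trans h₁)) 1)
      have h₃ := mem_pack hf
      have h₄ := sz_lt_of_mem (hl'.subset h₃.1)
      have h₅ := sz_nat_le_self f.2
      have h₆ : sz f = sz f.1 + sz f.2 + 1 := rfl
      omega
    · refine (sz_list_le (K := 4 * sz (l x) + 1) fun i hi => ?_).trans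
        (Nat.add_le_add_right (Nat.mul_le_mul_right _ (h₂.1.le.trans h₁)) 1)
      obtain ⟨j, hj, rfl⟩ := List.mem_iff_getElem.1 hi
      have h₃ := (pack_assign (u x) l' (i := j) (by omega)).1
      rw [List.getD_eq_getElem _ _ hj] at h₃
      have h₄ := sz_nat_le_self (_root_.pack (u x) l').2[j]
      omega

end PolyTime

/-! ### Clearing denominators -/

/-- The entries of a matrix, with their positions. -/
def entries {α : Type} (m : List (List α)) : List ((ℕ × ℕ) × α) :=
  m.zipIdx.flatMap fun r => r.1.zipIdx.map fun q => ((r.2, q.2), q.1)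

/-- Multiplies a list of fractions by the product of their denominators, which is also returned. -/
def scale {κ : Type} (l : List (κ × ℕ × ℕ)) : List (κ × ℕ) × ℕ :=
  l.foldr (fun e s => ((e.1, e.2.1 * s.2) :: s.1.map (fun r => (r.1, r.2 * e.2.2)), e.2.2 * s.2))
    ([], 1)

theorem scale_cons {κ : Type} (e : κ × ℕ × ℕ) (l : List (κ × ℕ × ℕ)) :
    scale (e :: l) = ((e.1, e.2.1 * (scale l).2) :: (scale l).1.map (fun r => (r.1, r.2 * e.2.2)),
      e.2.2 * (scale l).2) := rfl

theorem scale_eq {κ : Type} (q : κ → ℚ≥0) (l : List κ) :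
    0 < (scale (l.map fun k => (k, (q k).num, (q k).den))).2 ∧
    ∃ W : κ → ℕ, (scale (l.map fun k => (k, (q k).num, (q k).den))).1 = l.map (fun k => (k, W k)) ∧
      ∀ k ∈ l, (W k : ℚ≥0) = (scale (l.map fun k => (k, (q k).num, (q k).den))).2 * q k := by
  classical
  induction l with
  | nil => exact ⟨by simp [scale], fun _ => 0, by simp [scale], by simp⟩
  | cons a l ih =>
    obtain ⟨h₀, W, h₁, h₂⟩ := ih
    simp only [List.map_cons, scale_cons]
    generalize (scale (l.map fun k => (k, (q k).num, (q k).den))).2 = L at *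
    refine ⟨Nat.mul_pos (q a).den_pos h₀,
      -- Multiplying the old values by the new denominator gives the same value at `a` if `a` occurs
      -- again in `l`, so `W` is well defined despite repetitions.
      fun k => if k = a then (q a).num * L else W k * (q a).den, ?_, ?_⟩
    · rw [h₁, List.map_map]
      congr 1
      · simp
      refine List.map_congr_left fun k hk => ?_
      dsimp only [Function.comp_apply]
      split_ifs with h
      · subst h
        congr 1
        have h₃ := h₂ k hk
        have h₄ : (q k : ℚ≥0) * (q k).den = (q k).num := NNRat.mul_den_eq_num (q k)
        have : ((W k * (q k).den : ℕ) : ℚ≥0) = ((q k).num * L : ℕ) := by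
          push_cast
          rw [h₃, mul_assoc, h₄, mul_comm]
        exact_mod_cast this
      · rfl
    · intro k hk
      dsimp only
      split_ifs with h
      · subst h
        have h₄ : (q k : ℚ≥0) * (q k).den = (q k).num := NNRat.mul_den_eq_num (q k)
        push_cast
        rw [← h₄]
        ring
      · push_cast
        rw [h₂ k ((List.mem_cons.1 hk).resolve_left h)]
        ring

/-- Bit lengths add under multiplication, so even the product of all denominators is no longer than
the input, up to a constant factor. -/
theorem scale_size {κ : Type} [Enc κ] (l : List (κ × ℕ × ℕ)) :
    2 * (scale l).2.size ≤ sz l + 1 ∧ (scale l).1.length = l.length ∧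
      ∀ r ∈ (scale l).1, sz r.1 ≤ sz l ∧ 2 * r.2.size ≤ sz l + 1 := by
  induction l with
  | nil => simp [scale, sz_nil]
  | cons e l ih =>
    obtain ⟨h₁, h₂, h₃⟩ := ih
    have h : sz (e :: l) = sz e.1 + (sz e.2.1 + sz e.2.2 + 1) + 1 + sz l + 1 := rfl
    have ha := le_sz_nat e.2.1
    have hb := le_sz_nat e.2.2
    rw [scale_cons, h]
    dsimp only
    refine ⟨?_, by simp [h₂], ?_⟩
    · have := Nat.size_mul_le e.2.2 (scale l).2
      omega
    · intro r hr
      rcases List.mem_cons.1 hr with rfl | hr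
      · have := Nat.size_mul_le e.2.1 (scale l).2
        dsimp only
        omega
      · obtain ⟨s, hs, rfl⟩ := List.mem_map.1 hr
        have h₄ := h₃ s hs
        have := Nat.size_mul_le s.2 e.2.2
        dsimp only
        omega

/-! ### Components of threshold graphs -/

/-- Replaces the label `a` by `b`. -/
def relabel (a b : ℕ) (g : List (ℕ × ℕ)) : List (ℕ × ℕ) :=
  g.map fun p => (p.1, if p.2 = a then b else p.2)

/-- Labels the points by representatives of the components of the graph whose edges are the
pairs in the table `T` with a value of at most `D`. -/
def components (T : List ((ℕ × ℕ) × ℕ)) (D : ℕ) (idx : List ℕ) : List (ℕ × ℕ) :=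
  T.foldl (fun g e => if e.2 ≤ D then relabel (look g e.1.1) (look g e.1.2) g else g)
    (idx.map fun x => (x, x))

/-- `R` is any equivalence containing the threshold edges; taking connectivity shows that labels
never merge different components, while equal labels along edges show that components are fully
merged. -/
theorem components_spec {idx : List ℕ} {R : ℕ → ℕ → Prop} (hR : Equivalence R) {D : ℕ}
    (T : List ((ℕ × ℕ) × ℕ)) (hT : ∀ e ∈ T, e.1.1 ∈ idx ∧ e.1.2 ∈ idx)
    (hTR : ∀ e ∈ T, e.2 ≤ D → R e.1.1 e.1.2) :
    ∃ f : ℕ → ℕ, components T D idx = idx.map (fun x => (x, f x)) ∧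
      (∀ x ∈ idx, f x ∈ idx ∧ R x (f x)) ∧ ∀ e ∈ T, e.2 ≤ D → f e.1.1 = f e.1.2 := by
  induction T using List.reverseRecOn with
  | nil => exact ⟨fun x => x, by simp [components], fun x hx => ⟨hx, hR.refl x⟩, by simp⟩
  | append_singleton T e ih =>
    obtain ⟨f, h₁, h₂, h₃⟩ := ih (fun a ha => hT a (by simp [ha])) (fun a ha => hTR a (by simp [ha]))
    have he := hT e (by simp)
    rw [components, List.foldl_append, List.foldl_cons, List.foldl_nil, ← components, h₁]
    by_cases hD : e.2 ≤ D
    · rw [if_pos hD, look_map _ _ he.1, look_map _ _ he.2]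
      refine ⟨fun x => if f x = f e.1.1 then f e.1.2 else f x, ?_, ?_, ?_⟩
      · simp [relabel]
      · intro x hx
        have h₄ := h₂ x hx
        dsimp only
        split_ifs with h
        · refine ⟨(h₂ _ he.2).1, ?_⟩
          have h₅ := hTR e (by simp) hD
          have h₆ := (h₂ _ he.1).2
          rw [← h] at h₆
          exact hR.trans h₄.2 (hR.trans (hR.symm h₆) (hR.trans h₅ (h₂ _ he.2).2))
        · exact h₄
      · intro a ha haD
        rcases List.mem_append.1 ha with ha | ha
        · simp only [h₃ a ha haD]
        · rw [List.mem_singleton.1 ha]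
          simp
    · rw [if_neg hD]
      refine ⟨f, rfl, h₂, fun a ha haD => ?_⟩
      rcases List.mem_append.1 ha with ha | ha
      · exact h₃ a ha haD
      · rw [List.mem_singleton.1 ha] at haD
        exact absurd haD hD

theorem look_mem_or_eq_zero {κ : Type} [DecidableEq κ] (l : List (κ × ℕ)) (k : κ) :
    (k, look l k) ∈ l ∨ look l k = 0 := by
  by_cases h : ∃ p ∈ l, p.1 = k
  · exact .inl (look_mem h)
  · right
    induction l with
    | nil => rfl
    | cons a l ih =>
      rw [look_cons, if_neg fun h' => h ⟨a, by simp, h'⟩]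
      exact ih fun ⟨p, hp, h'⟩ => h ⟨p, by simp [hp], h'⟩

theorem mem_components {T : List ((ℕ × ℕ) × ℕ)} {D : ℕ} {idx : List ℕ} :
    (components T D idx).length = idx.length ∧
    ∀ p ∈ components T D idx, p.1 ∈ idx ∧ (p.2 ∈ idx ∨ p.2 = 0) := by
  induction T using List.reverseRecOn with
  | nil => simp +contextual [components]
  | append_singleton T e ih =>
    rw [components, List.foldl_append, List.foldl_cons, List.foldl_nil, ← components]
    split_ifs with hD
    · refine ⟨by simp [relabel, ih.1], fun p hp => ?_⟩
      obtain ⟨q, hq, rfl⟩ := List.mem_map.1 hp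
      refine ⟨(ih.2 q hq).1, ?_⟩
      dsimp only
      split_ifs
      · rcases look_mem_or_eq_zero (components T D idx) e.1.2 with h | h
        · exact (ih.2 _ h).2
        · exact .inr h
      · exact (ih.2 q hq).2
    · exact ih

theorem foldl_min_spec {α : Type} (f : α → ℕ) (l : List α) : ∀ s : α,
    (l.foldl (fun s a => if f a < f s then a else s) s ∈ s :: l) ∧
    ∀ a ∈ s :: l, f (l.foldl (fun s a => if f a < f s then a else s) s) ≤ f a := by
  induction l with
  | nil => simp
  | cons b l ih =>
    intro s
    rw [List.foldl_cons]
    have h := ih (if f b < f s then b else s)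
    have hm : f (if f b < f s then b else s) ≤ f b ∧ f (if f b < f s then b else s) ≤ f s := by
      split_ifs <;> omega
    refine ⟨?_, fun a ha => ?_⟩
    · rcases List.mem_cons.1 h.1 with h' | h'
      · rw [h']
        split_ifs <;> simp
      · simp [h']
    · have h₀ := h.2 _ (List.mem_cons_self ..)
      rcases List.mem_cons.1 ha with rfl | ha
      · omega
      · rcases List.mem_cons.1 ha with rfl | ha
        · omega
        · exact h.2 a (by simp [ha])

/-- Total weight of an assignment. -/
def totalCost (T : List ((ℕ × ℕ) × ℕ)) (E : List (ℕ × ℕ)) : ℕ := (E.map (look T)).sum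

/-- The labelings by components that need at most `k` facilities. -/
def candidates (T : List ((ℕ × ℕ) × ℕ)) (idx : List ℕ) (k u : ℕ) : List (List (ℕ × ℕ)) :=
  (T.map fun e => components T e.2 idx).filter fun g =>
    decide ((pack u (g.map Prod.snd)).1.length ≤ k)

/-- The cheapest candidate, or the assignment of all points to the first one. -/
def fallback (T : List ((ℕ × ℕ) × ℕ)) (idx : List ℕ) (k u : ℕ) : List (ℕ × ℕ) :=
  (candidates T idx k u).foldl (fun s g => if totalCost T g < totalCost T s then g else s)
    (idx.map fun x => (x, 0))

namespace PolyTime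

variable {α β γ δ σ : Type} [Enc α] [Enc β] [Enc γ] [Enc δ] [Enc σ]

theorem entries {m : α → List (List β)} (hm : PolyTime m) : PolyTime fun x => entries (m x) :=
  hm.zipIdx.flatMap (f := fun _ (r : List β × ℕ) => r.1.zipIdx.map fun (q : β × ℕ) => ((r.2, q.2), q.1))
    (id.snd.fst.zipIdx.map (f := fun (p : α × List β × ℕ) (q : β × ℕ) => ((p.2.2, q.2), q.1))
      ((id.fst.snd.snd.pair id.snd.snd).pair id.snd.fst))

theorem scale {κ : Type} [Enc κ] {l : α → List (κ × ℕ × ℕ)} (hl : PolyTime l) :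
    PolyTime fun x => scale (l x) := by
  have he : PolyTime fun p : α × (List (κ × ℕ) × ℕ) × (κ × ℕ × ℕ) => p.2.2 := id.snd.snd
  have hs : PolyTime fun p : α × (List (κ × ℕ) × ℕ) × (κ × ℕ × ℕ) => p.2.1 := id.snd.fst
  refine foldr (f := fun _ (e : κ × ℕ × ℕ) (s : List (κ × ℕ) × ℕ) =>
    ((e.1, e.2.1 * s.2) :: s.1.map (fun r => (r.1, r.2 * e.2.2)), e.2.2 * s.2))
    (s := fun _ => ([], 1))
    (B := fun x => (sz (l x) * (sz (l x) + (2 * sz (l x) + 3) + 2) + 1) + (2 * sz (l x) + 3) + 1)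
    ?_ (const _) hl ?_ ?_
  · exact ((he.fst.pair (he.snd.fst.mul hs.snd)).cons (hs.fst.map
      (f := fun (p : α × (List (κ × ℕ) × ℕ) × (κ × ℕ × ℕ)) (r : κ × ℕ) => (r.1, r.2 * p.2.2.2.2))
      (id.snd.fst.pair (id.snd.snd.mul id.fst.snd.snd.snd.snd)))).pair (he.snd.snd.mul hs.snd)
  · have h := hl.sz_bdd
    have h' := ((PolyBdd.const 2).mul h).add (.const 3)
    exact (((h.mul ((h.add h').add (.const 2))).add (.const 1)).add h').add (.const 1)
  · intro x l' hl'
    obtain ⟨h₁, h₂, h₃⟩ := scale_size l'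
    have h₀ := sz_suffix_le hl'
    change sz (_root_.scale l').1 + sz (_root_.scale l').2 + 1 ≤ _
    refine Nat.add_le_add (Nat.add_le_add ?_ ?_) le_rfl
    · refine (sz_list_le (K := sz (l x) + (2 * sz (l x) + 3) + 1) fun r hr => ?_).trans
        (Nat.add_le_add_right (Nat.mul_le_mul_right _ ?_) 1)
      · have h₄ := h₃ r hr
        have h₅ := sz_nat_le r.2
        have h₆ : sz r = sz r.1 + sz r.2 + 1 := rfl
        omega
      · have := length_lt_sz l'
        omega
    · have h₅ := sz_nat_le (_root_.scale l').2
      omega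

theorem relabel {a b : α → ℕ} {g : α → List (ℕ × ℕ)} (ha : PolyTime a) (hb : PolyTime b)
    (hg : PolyTime g) : PolyTime fun x => relabel (a x) (b x) (g x) :=
  hg.map (f := fun x (p : ℕ × ℕ) => (p.1, if p.2 = a x then b x else p.2))
    (id.snd.fst.pair (ite (id.snd.snd.decide_eq (ha.comp id.fst)) (hb.comp id.fst) id.snd.snd))

theorem components {T : α → List ((ℕ × ℕ) × ℕ)} {D : α → ℕ} {idx : α → List ℕ} (hT : PolyTime T)
    (hD : PolyTime D) (hi : PolyTime idx) :
    PolyTime fun x => components (T x) (D x) (idx x) := by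
  have hg : PolyTime fun p : α × List (ℕ × ℕ) × ((ℕ × ℕ) × ℕ) => p.2.1 := id.snd.fst
  have he : PolyTime fun p : α × List (ℕ × ℕ) × ((ℕ × ℕ) × ℕ) => p.2.2 := id.snd.snd
  refine foldl (f := fun x (g : List (ℕ × ℕ)) (e : (ℕ × ℕ) × ℕ) => if e.2 ≤ D x then
      _root_.relabel (_root_.look g e.1.1) (_root_.look g e.1.2) g else g)
    (s := fun x => (idx x).map fun y => (y, y))
    (B := fun x => sz (idx x) * (2 * sz (idx x) + 2) + 1) ?_ ?_ hT ?_ ?_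
  · exact ite (he.snd.decide_le (hD.comp id.fst))
      (relabel (hg.look_nat he.fst.fst) (hg.look_nat he.fst.snd) hg) hg
  · exact hi.map (f := fun _ y => (y, y)) (id.snd.pair id.snd)
  · have h := hi.sz_bdd
    exact (h.mul (((PolyBdd.const 2).mul h).add (.const 2))).add (.const 1)
  · intro x T' _
    change sz (_root_.components T' (D x) (idx x)) ≤ _
    have h := mem_components (T := T') (D := D x) (idx := idx x)
    have h₀ := length_lt_sz (idx x)
    refine (sz_list_le (K := 2 * sz (idx x) + 1) fun p hp => ?_).trans
      (Nat.add_le_add_right (Nat.mul_le_mul_right _ (by omega)) 1)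
    have h₁ := h.2 p hp
    have h₂ := sz_lt_of_mem h₁.1
    have h₃ : sz p = sz p.1 + sz p.2 + 1 := rfl
    rcases h₁.2 with h₄ | h₄
    · have := sz_lt_of_mem h₄
      omega
    · rw [h₄] at h₃
      have : sz 0 = 1 := rfl
      omega

theorem totalCost {T : α → List ((ℕ × ℕ) × ℕ)} {E : α → List (ℕ × ℕ)} (hT : PolyTime T)
    (hE : PolyTime E) : PolyTime fun x => totalCost (T x) (E x) := hT.cost hE

theorem map_snd {E : α → List (β × γ)} (hE : PolyTime E) :
    PolyTime fun x => (E x).map Prod.snd :=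
  hE.map (f := fun _ p => p.2) id.snd.snd

theorem map_fst {E : α → List (β × γ)} (hE : PolyTime E) :
    PolyTime fun x => (E x).map Prod.fst :=
  hE.map (f := fun _ p => p.1) id.snd.fst

theorem candidates {T : α → List ((ℕ × ℕ) × ℕ)} {idx : α → List ℕ} {k u : α → ℕ}
    (hT : PolyTime T) (hi : PolyTime idx) (hk : PolyTime k) (hu : PolyTime u) :
    PolyTime fun x => candidates (T x) (idx x) (k x) (u x) :=
  filter (p := fun x (g : List (ℕ × ℕ)) => decide ((_root_.pack (u x) (g.map Prod.snd)).1.length ≤ k x))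
    (hT.map (f := fun x (e : (ℕ × ℕ) × ℕ) => _root_.components (T x) e.2 (idx x))
      ((hT.comp id.fst).components id.snd.snd (hi.comp id.fst)))
    (((hu.comp id.fst).pack id.snd.map_snd).fst.length.decide_le (hk.comp id.fst))

theorem fallback {T : α → List ((ℕ × ℕ) × ℕ)} {idx : α → List ℕ} {k u : α → ℕ}
    (hT : PolyTime T) (hi : PolyTime idx) (hk : PolyTime k) (hu : PolyTime u) :
    PolyTime fun x => fallback (T x) (idx x) (k x) (u x) :=
  foldl_min (f := fun x g => _root_.totalCost (T x) g) ((hT.comp id.fst).totalCost id.snd)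
    (hi.map (f := fun _ x => (x, 0)) (id.snd.pair (const 0))) (hT.candidates hi hk hu)

end PolyTime

/-! ### Integral metrics and the fallback solution -/

/-- All pairs of numbers below `n`. -/
def pairs (n : ℕ) : List (ℕ × ℕ) := (List.range n).flatMap fun x => (List.range n).map fun y => (x, y)

theorem mem_pairs {n : ℕ} {p : ℕ × ℕ} : p ∈ pairs n ↔ p.1 < n ∧ p.2 < n := by
  obtain ⟨x, y⟩ := p
  simp [pairs]

/-- The table of a function on pairs. -/
def table (n : ℕ) (W : ℕ × ℕ → ℕ) : List ((ℕ × ℕ) × ℕ) := (pairs n).map fun p => (p, W p)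

theorem look_table {n : ℕ} (W : ℕ × ℕ → ℕ) {p : ℕ × ℕ} (h₁ : p.1 < n) (h₂ : p.2 < n) :
    look (table n W) p = W p :=
  look_map _ _ (mem_pairs.2 ⟨h₁, h₂⟩)

theorem totalCost_table {n : ℕ} (W : ℕ × ℕ → ℕ) {E : List (ℕ × ℕ)}
    (hE : ∀ p ∈ E, p.1 < n ∧ p.2 < n) : totalCost (table n W) E = (E.map W).sum := by
  rw [totalCost]
  congr 1
  exact List.map_congr_left fun p hp => look_table W (hE p hp).1 (hE p hp).2

/-- The function `W` is a metric on the numbers below `n`. -/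
structure IsNatMetric (n : ℕ) (W : ℕ × ℕ → ℕ) : Prop where
  eq_zero : ∀ x < n, ∀ y < n, W (x, y) = 0 ↔ x = y
  comm : ∀ x < n, ∀ y < n, W (x, y) = W (y, x)
  triangle : ∀ x < n, ∀ y < n, ∀ z < n, W (x, z) ≤ W (x, y) + W (y, z)

/-- A path visits each vertex at most once, so it has fewer than `n` edges, each of length at most
`D`. -/
theorem IsNatMetric.le_of_reachable {n : ℕ} {W : ℕ × ℕ → ℕ} (hW : IsNatMetric n W) {D : ℕ}
    {G : SimpleGraph (Fin n)} (hG : ∀ x y, G.Adj x y → W (x, y) ≤ D) {x y : Fin n}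
    (h : G.Reachable x y) : W (x, y) ≤ n * D := by
  have key : ∀ {x y : Fin n} (p : G.Walk x y), W (x, y) ≤ p.length * D := by
    intro x y p
    induction p with
    | nil => rw [(hW.eq_zero _ (Fin.is_lt _) _ (Fin.is_lt _)).2 rfl]; omega
    | @cons x y z hxy p ih =>
      have h₁ := hW.triangle x x.2 y y.2 z z.2
      have h₂ := hG x y hxy
      rw [SimpleGraph.Walk.length_cons, add_mul, one_mul]
      omega
  obtain ⟨p, hp⟩ := h.exists_isPath
  have h₁ := hp.length_lt
  rw [Fintype.card_fin] at h₁
  exact (key p).trans (Nat.mul_le_mul_right _ h₁.le)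

theorem IsNatMetric.components_table {n : ℕ} {W : ℕ × ℕ → ℕ} (hW : IsNatMetric n W) (D : ℕ) :
    ∃ f : ℕ → ℕ, components (table n W) D (List.range n) = (List.range n).map (fun x => (x, f x)) ∧
      (∀ x < n, f x < n ∧ W (x, f x) ≤ n * D) ∧
      ∀ x < n, ∀ y < n, W (x, y) ≤ D → f x = f y := by
  let G : SimpleGraph (Fin n) := SimpleGraph.fromRel fun x y => W (x, y) ≤ D
  have hG : ∀ x y : Fin n, G.Adj x y → W (x, y) ≤ D := by
    intro x y h
    rcases (SimpleGraph.fromRel_adj _ _ _).1 h with ⟨_, h | h⟩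
    · exact h
    · rwa [hW.comm x x.2 y y.2]
  -- The equality case makes `R` reflexive on numbers that are not points.
  let R : ℕ → ℕ → Prop := fun x y => x = y ∨ ∃ (hx : x < n) (hy : y < n), G.Reachable ⟨x, hx⟩ ⟨y, hy⟩
  have hR : Equivalence R := by
    refine ⟨fun x => .inl rfl, ?_, ?_⟩
    · rintro x y (h | ⟨hx, hy, h⟩)
      · exact .inl h.symm
      · exact .inr ⟨hy, hx, h.symm⟩
    · rintro x y z (rfl | ⟨hx, hy, h⟩) (rfl | ⟨hy', hz, h'⟩)
      · exact .inl rfl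
      · exact .inr ⟨hy', hz, h'⟩
      · exact .inr ⟨hx, hy, h⟩
      · exact .inr ⟨hx, hz, h.trans h'⟩
  have hT : ∀ e ∈ table n W, e.1.1 < n ∧ e.1.2 < n ∧ e.2 = W e.1 := by
    intro e he
    obtain ⟨p, hp, rfl⟩ := List.mem_map.1 he
    exact ⟨(mem_pairs.1 hp).1, (mem_pairs.1 hp).2, rfl⟩
  obtain ⟨f, h₁, h₂, h₃⟩ := components_spec (idx := List.range n) hR (D := D) (table n W)
    (fun e he => by simpa using ⟨(hT e he).1, (hT e he).2.1⟩)
    (by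
      intro e he hD
      obtain ⟨hx, hy, hw⟩ := hT e he
      by_cases hxy : e.1.1 = e.1.2
      · exact .inl hxy
      · refine .inr ⟨hx, hy, SimpleGraph.Adj.reachable ?_⟩
        refine (SimpleGraph.fromRel_adj _ _ _).2 ⟨by simpa using hxy, .inl ?_⟩
        rw [hw] at hD
        exact hD)
  refine ⟨f, h₁, fun x hx => ?_, fun x hx y hy hD => ?_⟩
  · obtain ⟨h₄, h₅⟩ := h₂ x (by simpa using hx)
    rw [List.mem_range] at h₄
    refine ⟨h₄, ?_⟩
    rcases h₅ with h | ⟨hx, hy, h⟩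
    · rw [(hW.eq_zero x hx _ h₄).2 h]; omega
    · exact hW.le_of_reachable hG h
  · exact h₃ ((x, y), W (x, y)) (List.mem_map.2 ⟨(x, y), mem_pairs.2 ⟨hx, hy⟩, rfl⟩) hD

theorem sum_map_range (n : ℕ) (F : ℕ → ℕ) : ((List.range n).map F).sum = ∑ x : Fin n, F x := by
  rw [← Finset.sum_range (fun x => F x)]
  rfl

theorem count_map_range (n : ℕ) (f : ℕ → ℕ) (c : ℕ) :
    ((List.range n).map f).count c = (Finset.univ.filter fun x : Fin n => f x = c).card := by
  rw [Finset.card_filter, ← sum_map_range n fun x => if f x = c then 1 else 0,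
    List.count, List.countP_map, ← List.sum_map_ite_eq_countP]
  simp

/-- A labeling that is constant on the clients of each facility needs no more facilities. -/
theorem SoftCkMSol.length_pack_le {I : SoftCkMInst} (S : SoftCkMSol I) (hu : 1 ≤ I.u) {f : ℕ → ℕ}
    (hf : ∀ x < I.space.n, f x < I.space.n)
    (h : ∀ x : Fin I.space.n, f x = f (S.facility (S.assign x))) :
    (pack I.u ((List.range I.space.n).map f)).1.length ≤ I.k := by
  refine (_root_.length_pack_le hu (n := I.space.n) (b := fun c =>
    (Finset.univ.filter fun j => f (S.facility j) = c).card) ?_ ?_).trans ?_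
  · intro c hc
    obtain ⟨x, hx, rfl⟩ := List.mem_map.1 hc
    exact hf x (List.mem_range.1 hx)
  · intro c _
    rw [count_map_range]
    refine Finset.card_le_mul_card_image_of_maps_to (f := S.assign) ?_ _ ?_
    · intro x hx
      simp only [Finset.mem_univ, true_and, Finset.mem_filter] at hx ⊢
      rw [← h, hx]
    · intro j _
      refine (Finset.card_le_card ?_).trans (S.capacity j)
      intro x hx
      simp only [Finset.mem_filter] at hx ⊢
      exact ⟨Finset.mem_univ _, hx.2⟩
  · rw [← Finset.card_eq_sum_card_fiberwise (f := fun j => f (S.facility j)) (s := Finset.univ)]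
    · simpa using S.numFacilities_le
    · intro j _
      simpa using hf _ (Fin.is_lt _)

/-- Cost of a solution with respect to integral distances. -/
def SoftCkMSol.natCost {I : SoftCkMInst} (S : SoftCkMSol I) (W : ℕ × ℕ → ℕ) : ℕ :=
  ∑ x : Fin I.space.n, W (x, S.facility (S.assign x))

/-- Let `D` be the largest distance between a client and its facility in `S`. At threshold `D` both
lie in one component, so moving each facility to the representative of its component keeps `S`
feasible, and the labeling needs at most `k` facilities. Each point travels at most `n * D`, and `D`
is at most the cost of `S`. As `D` occurs in the table, trying all entries suffices. -/
theorem fallback_spec {I : SoftCkMInst} {W : ℕ × ℕ → ℕ} (hW : IsNatMetric I.space.n W)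
    (hn : 0 < I.space.n) (hu : 1 ≤ I.u) (hk : I.space.n ≤ I.k * I.u) :
    ∃ f : ℕ → ℕ, fallback (table I.space.n W) (List.range I.space.n) I.k I.u =
        (List.range I.space.n).map (fun x => (x, f x)) ∧
      (∀ x < I.space.n, f x < I.space.n) ∧
      (pack I.u ((List.range I.space.n).map f)).1.length ≤ I.k ∧
      ∀ S : SoftCkMSol I, ∑ x : Fin I.space.n, W (x, f x) ≤
        I.space.n * I.space.n * S.natCost W := by
  set n := I.space.n with hn'
  set T := table n W with hT
  obtain ⟨hmem, hmin⟩ := foldl_min_spec (totalCost T) (candidates T (List.range n) I.k I.u)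
    ((List.range n).map fun x => (x, 0))
  change fallback T (List.range n) I.k I.u ∈ _ at hmem
  change ∀ a ∈ _, totalCost T (fallback T (List.range n) I.k I.u) ≤ _ at hmin
  have hfun : ∃ f : ℕ → ℕ, fallback T (List.range n) I.k I.u =
      (List.range n).map (fun x => (x, f x)) ∧ (∀ x < n, f x < n) ∧
      (pack I.u ((List.range n).map f)).1.length ≤ I.k := by
    rcases List.mem_cons.1 hmem with h | h
    · refine ⟨fun _ => 0, h, fun _ _ => hn, ?_⟩
      -- All points go to location `0`, where `k` facilities suffice because `n ≤ k * u`.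
      refine (length_pack_le hu (n := n) (b := fun c => if c = 0 then I.k else 0) ?_ ?_).trans ?_
      · intro c hc
        obtain ⟨x, hx, rfl⟩ := List.mem_map.1 hc
        exact hn
      · intro c _
        split_ifs with hc
        · refine List.count_le_length.trans ?_
          rw [mul_comm]
          simpa using hk
        · rw [List.count_eq_zero_of_not_mem]
          · omega
          · intro h
            obtain ⟨x, hx, rfl⟩ := List.mem_map.1 h
            exact hc rfl
      · rw [Finset.sum_ite_eq']
        split_ifs <;> omega
    · obtain ⟨h₁, h₂⟩ := List.mem_filter.1 h
      obtain ⟨e, _, he⟩ := List.mem_map.1 h₁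
      obtain ⟨f, h₃, h₄, _⟩ := hW.components_table e.2
      refine ⟨f, he.symm.trans h₃, fun x hx => (h₄ x hx).1, ?_⟩
      rw [← he, h₃, List.map_map] at h₂
      simpa [Function.comp_def] using h₂
  obtain ⟨f, hf₁, hf₂, hf₃⟩ := hfun
  have hcost : ∀ f : ℕ → ℕ, (∀ x < n, f x < n) →
      totalCost T ((List.range n).map fun x => (x, f x)) = ∑ x : Fin n, W (x, f x) := by
    intro f hf
    rw [hT, totalCost_table, List.map_map, sum_map_range]
    · rfl
    · intro p hp
      obtain ⟨x, hx, rfl⟩ := List.mem_map.1 hp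
      rw [List.mem_range] at hx
      exact ⟨hx, hf x hx⟩
  refine ⟨f, hf₁, hf₂, hf₃, fun S => ?_⟩
  rw [← hcost f hf₂, ← hf₁]
  obtain ⟨x₀, _, hx₀⟩ := Finset.exists_max_image (Finset.univ : Finset (Fin n))
    (fun x => W (x, S.facility (S.assign x))) ⟨⟨0, hn⟩, Finset.mem_univ _⟩
  set D := W (x₀, S.facility (S.assign x₀)) with hD
  obtain ⟨g, hg₁, hg₂, hg₃⟩ := hW.components_table D
  have hle : D ≤ S.natCost W :=
    Finset.single_le_sum (f := fun x : Fin n => W (x, S.facility (S.assign x)))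
      (fun _ _ => Nat.zero_le _) (Finset.mem_univ x₀)
  refine (hmin ((List.range n).map fun x => (x, g x)) (List.mem_cons_of_mem _ ?_)).trans ?_
  · refine List.mem_filter.2 ⟨List.mem_map.2 ⟨((x₀, S.facility (S.assign x₀)), D), ?_, hg₁⟩, ?_⟩
    · exact List.mem_map.2 ⟨_, mem_pairs.2 ⟨x₀.2, Fin.is_lt _⟩, rfl⟩
    · rw [List.map_map]
      have := S.length_pack_le hu (f := g) (fun x hx => (hg₂ x hx).1)
        (fun x => hg₃ x x.2 _ (Fin.is_lt _) (hx₀ x (Finset.mem_univ x)))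
      simpa [Function.comp_def] using this
  · rw [hcost g fun x hx => (hg₂ x hx).1]
    calc ∑ x : Fin n, W (x, g x) ≤ ∑ x : Fin n, n * D :=
          Finset.sum_le_sum fun x _ => (hg₂ x x.2).2
      _ = n * n * D := by simp [mul_assoc]
      _ ≤ _ := Nat.mul_le_mul_left _ hle

/-! ### The integral metric of a rational metric -/

/-- The distance matrix. -/
def FinMetric.matrix (X : FinMetric) : List (List (ℕ × ℕ)) :=
  List.ofFn fun x => List.ofFn fun y => ((X.dist x y).num, (X.dist x y).den)

theorem FinMetric.enc_matrix (X : FinMetric) : enc X.matrix = X.encode := by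
  simp only [enc, FinMetric.matrix, FinMetric.encode, Data.ofFn, List.map_ofFn, Function.comp_def]
  rfl

/-- The distance, as a function on natural numbers. -/
def FinMetric.natDist (X : FinMetric) (p : ℕ × ℕ) : ℚ≥0 :=
  if h : p.1 < X.n ∧ p.2 < X.n then X.dist ⟨p.1, h.1⟩ ⟨p.2, h.2⟩ else 0

theorem FinMetric.natDist_coe (X : FinMetric) (x y : Fin X.n) : X.natDist (x, y) = X.dist x y := by
  simp [natDist]

theorem List.ofFn_eq_map_range {α : Type*} {n : ℕ} (f : Fin n → α) (g : ℕ → α)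
    (h : ∀ x : Fin n, f x = g x) : List.ofFn f = (List.range n).map g := by
  rw [List.ofFn_eq_map, ← List.map_coe_finRange_eq_range, List.map_map]
  exact List.map_congr_left fun x _ => h x

theorem List.zipIdx_map_range {α : Type*} (n : ℕ) (g : ℕ → α) :
    ((List.range n).map g).zipIdx = (List.range n).map fun x => (g x, x) := by
  apply List.ext_getElem
  · simp
  · intro i h₁ h₂
    simp

theorem entries_map_range {α : Type} (n : ℕ) (g : ℕ × ℕ → α) :
    entries ((List.range n).map fun x => (List.range n).map fun y => g (x, y)) =
      (pairs n).map fun p => (p, g p) := by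
  rw [entries, pairs, List.zipIdx_map_range, List.map_flatMap, List.flatMap_map]
  congr 1
  funext x
  rw [List.zipIdx_map_range, List.map_map, List.map_map]
  rfl

theorem FinMetric.matrix_eq (X : FinMetric) :
    X.matrix = (List.range X.n).map fun x => (List.range X.n).map fun y =>
      ((X.natDist (x, y)).num, (X.natDist (x, y)).den) := by
  refine List.ofFn_eq_map_range _ _ fun x => List.ofFn_eq_map_range _ _ fun y => ?_
  rw [natDist_coe]

/-- The table of the integral distances. -/
def distTable (m : List (List (ℕ × ℕ))) : List ((ℕ × ℕ) × ℕ) := (scale (entries m)).1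

theorem FinMetric.exists_natMetric (X : FinMetric) : ∃ (L : ℕ) (W : ℕ × ℕ → ℕ), 0 < L ∧
    distTable X.matrix = table X.n W ∧ IsNatMetric X.n W ∧
    ∀ x y : Fin X.n, (W (x, y) : ℚ≥0) = L * X.dist x y := by
  obtain ⟨h₀, W, h₁, h₂⟩ := scale_eq X.natDist (pairs X.n)
  rw [← entries_map_range, ← X.matrix_eq] at h₀ h₁ h₂
  generalize (scale (entries X.matrix)).2 = L at h₀ h₂
  have h₃ : ∀ x y : Fin X.n, (W (x, y) : ℚ≥0) = L * X.dist x y := by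
    intro x y
    rw [h₂ (x, y) (mem_pairs.2 ⟨x.2, y.2⟩), natDist_coe]
  have hL : (L : ℚ≥0) ≠ 0 := by exact_mod_cast h₀.ne'
  refine ⟨L, W, h₀, h₁, ⟨?_, ?_, ?_⟩, h₃⟩
  · intro x hx y hy
    have := h₃ ⟨x, hx⟩ ⟨y, hy⟩
    rw [← Nat.cast_eq_zero (R := ℚ≥0), this, mul_eq_zero, X.dist_eq_zero]
    simp [hL]
  · intro x hx y hy
    have h := h₃ ⟨x, hx⟩ ⟨y, hy⟩
    rw [X.dist_comm, ← h₃] at h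
    exact_mod_cast h
  · intro x hx y hy z hz
    have h : (W (x, z) : ℚ≥0) ≤ W (x, y) + W (y, z) := by
      rw [h₃ ⟨x, hx⟩ ⟨z, hz⟩, h₃ ⟨x, hx⟩ ⟨y, hy⟩, h₃ ⟨y, hy⟩ ⟨z, hz⟩, ← mul_add]
      gcongr
      exact X.dist_triangle _ _ _
    exact_mod_cast h

theorem PolyTime.distTable {α : Type} [Enc α] {m : α → List (List (ℕ × ℕ))} (hm : PolyTime m) :
    PolyTime fun x => distTable (m x) := hm.entries.scale.fst

/-! ### The reduction on lists -/

/-- The positions in a list. -/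
def indices {α : Type} (m : List α) : List ℕ := m.zipIdx.map Prod.snd

theorem indices_eq {α : Type} (m : List α) : indices m = List.range m.length := by
  rw [indices, List.zipIdx_eq_zip_range', List.map_snd_zip (by simp), List.range_eq_range']

/-- Truncation of the values in a table. -/
def truncate (B : ℕ) (T : List ((ℕ × ℕ) × ℕ)) : List ((ℕ × ℕ) × ℕ) :=
  T.map fun e => (e.1, min e.2 B)

theorem truncate_table (B n : ℕ) (W : ℕ × ℕ → ℕ) :
    truncate B (table n W) = table n fun p => min (W p) B := by
  simp [truncate, table]

/-- A list whose length is the binary logarithm of the number of copies. -/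
def logCopies (c : ℕ) (l : List ℕ) : List Bool :=
  l.length.bits ++ (l.length.bits ++ (l.length.bits ++ List.replicate c true))

/-- Three digit lists of `n` contribute a factor of at least `n³`, which pays for the permits; the
factor `2 ^ c` depends only on `ε`. By `two_pow_size_le` the product is still polynomial, so the
copies can be written out. -/
theorem two_pow_logCopies (c : ℕ) (l : List ℕ) :
    2 ^ (logCopies c l).length = (2 ^ l.length.size) ^ 3 * 2 ^ c := by
  simp only [logCopies, List.length_append, List.length_replicate, Nat.size_eq_bits_len, pow_add]
  ring

theorem two_pow_size_le (n : ℕ) : 2 ^ n.size ≤ 2 * n + 1 := by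
  rcases Nat.eq_zero_or_pos n with rfl | hn
  · simp
  · have h₁ : 0 < n.size := Nat.size_pos.2 hn
    have h₂ : 2 ^ (n.size - 1) ≤ n := Nat.lt_size.1 (by omega)
    have h₃ : 2 ^ n.size = 2 ^ (n.size - 1) * 2 := by
      rw [← pow_succ]
      congr 1
      omega
    omega

/-- Doubles a list once for each element of `r`. -/
def copies (r : List Bool) (l : List ℕ) : List ℕ := r.foldl (fun l _ => l ++ l) l

theorem sum_map_copies (f : ℕ → ℕ) (r : List Bool) : ∀ l : List ℕ,
    ((copies r l).map f).sum = 2 ^ r.length * (l.map f).sum := by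
  induction r with
  | nil => simp [copies]
  | cons b r ih =>
    intro l
    have := ih (l ++ l)
    change ((copies r (l ++ l)).map f).sum = _
    rw [this, List.map_append, List.sum_append, List.length_cons, pow_succ]
    ring

theorem mem_copies {x : ℕ} (r : List Bool) : ∀ l : List ℕ, x ∈ copies r l → x ∈ l := by
  induction r with
  | nil => exact fun l h => h
  | cons b r ih =>
    intro l h
    simpa using ih (l ++ l) h

theorem sz_copies_le (r : List Bool) : ∀ l : List ℕ, sz (copies r l) ≤ 2 ^ r.length * sz l := by
  induction r with
  | nil => simp [copies]
  | cons b r ih =>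
    intro l
    have h₁ := ih (l ++ l)
    have h₂ := sz_append l l
    change sz (copies r (l ++ l)) ≤ _
    rw [List.length_cons, pow_succ, mul_assoc]
    exact h₁.trans (Nat.mul_le_mul_left _ (by omega))

/-- The points of the fair instance: copies of all points in group `0`, and at most `k` points in
group `1`. -/
def fairPoints (r : List Bool) (l : List ℕ) (k : ℕ) : List (ℕ × ℕ) :=
  (copies r l).map (fun x => (x, 0)) ++ (l.filter fun x => decide (x < k)).map fun x => (x, 1)

/-- Multiplication by a power of two. -/
def shift (r : List Bool) (u : ℕ) : ℕ := r.foldl (fun t _ => Nat.bit false t) u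

theorem shift_eq (r : List Bool) : ∀ u, shift r u = u * 2 ^ r.length := by
  induction r with
  | nil => simp [shift]
  | cons b r ih =>
    intro u
    change shift r (Nat.bit false u) = _
    rw [ih, List.length_cons, pow_succ, Nat.bit_val]
    simp
    ring

/-- The matrix of integral fractions given by a table. -/
def tableMatrix (T : List ((ℕ × ℕ) × ℕ)) (l : List ℕ) : List (List (ℕ × ℕ)) :=
  l.map fun x => l.map fun y => (look T (x, y), 1)

/-- Instances of the capacitated problem, as lists. -/
abbrev SoftData := List (List (ℕ × ℕ)) × ℕ × ℕ

namespace SoftData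

/-- The integral distances. -/
def T (d : SoftData) : List ((ℕ × ℕ) × ℕ) := distTable d.1

def idx (d : SoftData) : List ℕ := indices d.1

def start (d : SoftData) : List (ℕ × ℕ) := fallback d.T d.idx d.2.1 d.2.2

/-- The distances, truncated above the cost of the fallback solution. -/
def T' (d : SoftData) : List ((ℕ × ℕ) × ℕ) := truncate (totalCost d.T d.start + 1) d.T

/-- With `M` copies per point the balance parameter is `u * M`: one point of group `1` permits all
copies of `u` clients. -/
def fair (c : ℕ) (d : SoftData) : List (List (ℕ × ℕ)) × List (ℕ × ℕ) × ℕ × ℕ :=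
  (tableMatrix d.T' d.idx, fairPoints (logCopies c d.idx) d.idx d.2.1, d.2.1,
    shift (logCopies c d.idx) d.2.2)

end SoftData

/-- The fractional assignment given by the centers and the assignment of a fair clustering. -/
def fairEdges (P : List (ℕ × ℕ)) (s : List ℕ × List ℕ) : List (ℕ × ℕ) :=
  (P.zipIdx.filter fun q => decide (q.1.2 = 0)).map fun q => (q.1.1, s.1.getD (s.2.getD q.2 0) 0)

namespace SoftData

/-- The integral assignment obtained from a fair clustering. -/
def rounded (c : ℕ) (d : SoftData) (s : List ℕ × List ℕ) : List (ℕ × ℕ) :=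
  d.idx.map fun x => (x, look (halvings (look d.T') (logCopies c d.idx)
    (fairEdges (d.fair c).2.1 s)) x)

/-- The better one of the two assignments. -/
def final (c : ℕ) (d : SoftData) (s : List ℕ × List ℕ) : List (ℕ × ℕ) :=
  if totalCost d.T (d.rounded c s) < totalCost d.T d.start then d.rounded c s else d.start

/-- The facilities and the assignment of the resulting solution. -/
def result (c : ℕ) (d : SoftData) (s : List ℕ × List ℕ) : List ℕ × List ℕ :=
  ((pack d.2.2 ((d.final c s).map Prod.snd)).1.map Prod.fst,
    (pack d.2.2 ((d.final c s).map Prod.snd)).2)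

end SoftData

namespace PolyTime

variable {α β γ δ σ : Type} [Enc α] [Enc β] [Enc γ] [Enc δ] [Enc σ]

theorem indices {m : α → List β} (hm : PolyTime m) : PolyTime fun x => indices (m x) :=
  hm.zipIdx.map_snd

theorem truncate {B : α → ℕ} {T : α → List ((ℕ × ℕ) × ℕ)} (hB : PolyTime B) (hT : PolyTime T) :
    PolyTime fun x => truncate (B x) (T x) :=
  hT.map (f := fun x (e : (ℕ × ℕ) × ℕ) => (e.1, Min.min e.2 (B x)))
    (id.snd.fst.pair (id.snd.snd.min (hB.comp id.fst)))

theorem logCopies (c : ℕ) {l : α → List ℕ} (hl : PolyTime l) :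
    PolyTime fun x => logCopies c (l x) :=
  hl.length.bits.append (hl.length.bits.append (hl.length.bits.append (const _)))

theorem two_pow_logCopies_bdd (c : ℕ) {l : α → List ℕ} (hl : PolyTime l) :
    PolyBdd fun x => 2 ^ (_root_.logCopies c (l x)).length := by
  have h := ((PolyBdd.const 2).mul hl.sz_bdd).add (.const 1)
  refine (((h.mul h).mul h).mul (.const (2 ^ c))).mono fun x => ?_
  rw [two_pow_logCopies, pow_succ, pow_two]
  have h₁ : 2 ^ (l x).length.size ≤ 2 * sz (l x) + 1 :=
    (two_pow_size_le _).trans (by have := length_lt_sz (l x); omega)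
  gcongr

theorem copies (c : ℕ) {l : α → List ℕ} (hl : PolyTime l) :
    PolyTime fun x => copies (_root_.logCopies c (l x)) (l x) := by
  refine foldl (f := fun _ l _ => l ++ l) (id.snd.fst.append id.snd.fst) hl (logCopies c hl)
    ((two_pow_logCopies_bdd c hl).mul hl.sz_bdd) fun x r hr => ?_
  refine (sz_copies_le r (l x)).trans (Nat.mul_le_mul_right _ ?_)
  exact Nat.pow_le_pow_right (by simp) hr.length_le

theorem fairPoints (c : ℕ) {l : α → List ℕ} {k : α → ℕ} (hl : PolyTime l) (hk : PolyTime k) :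
    PolyTime fun x => fairPoints (_root_.logCopies c (l x)) (l x) (k x) :=
  ((copies c hl).map (f := fun _ x => (x, 0)) (id.snd.pair (const 0))).append
    ((hl.filter (p := fun a x => decide (x < k a)) (id.snd.decide_lt (hk.comp id.fst))).map
      (f := fun _ x => (x, 1)) (id.snd.pair (const 1)))

theorem shift {r : α → List Bool} {u : α → ℕ} (hr : PolyTime r) (hu : PolyTime u) :
    PolyTime fun x => shift (r x) (u x) :=
  foldl_of_le_add (f := fun _ t _ => Nat.bit false t) ((const false).bit id.snd.fst) hu hr
    (.const 4) fun _ _ _ _ => sz_bit_le _ _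

theorem tableMatrix {T : α → List ((ℕ × ℕ) × ℕ)} {l : α → List ℕ} (hT : PolyTime T)
    (hl : PolyTime l) : PolyTime fun x => tableMatrix (T x) (l x) :=
  hl.map (f := fun a x => (l a).map fun y => (_root_.look (T a) (x, y), 1))
    ((hl.comp id.fst).map (f := fun (p : α × ℕ) y => (_root_.look (T p.1) (p.2, y), 1))
      (((hT.comp id.fst.fst).look_pair (id.fst.snd.pair id.snd)).pair (const 1)))

theorem fairEdges {P : α → List (ℕ × ℕ)} {s : α → List ℕ × List ℕ} (hP : PolyTime P)
    (hs : PolyTime s) : PolyTime fun x => fairEdges (P x) (s x) :=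
  map (f := fun x (q : (ℕ × ℕ) × ℕ) => (q.1.1, (s x).1.getD ((s x).2.getD q.2 0) 0))
    (hP.zipIdx.filter (p := fun _ (q : (ℕ × ℕ) × ℕ) => decide (q.1.2 = 0))
      (id.snd.fst.snd.decide_eq (const 0)))
    (id.snd.fst.fst.pair ((hs.comp id.fst).fst.getD ((hs.comp id.fst).snd.getD id.snd.snd)))

variable {d : α → SoftData}

theorem softData_T (hd : PolyTime d) : PolyTime fun x => (d x).T := hd.fst.distTable

theorem softData_idx (hd : PolyTime d) : PolyTime fun x => (d x).idx := hd.fst.indices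

theorem softData_start (hd : PolyTime d) : PolyTime fun x => (d x).start :=
  hd.softData_T.fallback hd.softData_idx hd.snd.fst hd.snd.snd

theorem softData_T' (hd : PolyTime d) : PolyTime fun x => (d x).T' :=
  ((hd.softData_T.totalCost hd.softData_start).add (const 1)).truncate hd.softData_T

theorem softData_fair (c : ℕ) (hd : PolyTime d) : PolyTime fun x => (d x).fair c :=
  (hd.softData_T'.tableMatrix hd.softData_idx).pair ((fairPoints c hd.softData_idx hd.snd.fst).pair
    (hd.snd.fst.pair ((logCopies c hd.softData_idx).shift hd.snd.snd)))

theorem softData_rounded (c : ℕ) {s : α → List ℕ × List ℕ} (hd : PolyTime d) (hs : PolyTime s) :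
    PolyTime fun x => (d x).rounded c (s x) :=
  hd.softData_idx.map (f := fun x y => (y, _root_.look (_root_.halvings (_root_.look (d x).T')
      (_root_.logCopies c (d x).idx) (_root_.fairEdges ((d x).fair c).2.1 (s x))) y))
    (id.snd.pair (look_nat ((hd.softData_T'.halvings (logCopies c hd.softData_idx)
      ((softData_fair c hd).snd.fst.fairEdges hs)).comp id.fst) id.snd))

theorem softData_result (c : ℕ) {s : α → List ℕ × List ℕ} (hd : PolyTime d) (hs : PolyTime s) :
    PolyTime fun x => (d x).result c (s x) := by
  have h₁ := softData_rounded c hd hs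
  have h₂ : PolyTime fun x => (d x).final c (s x) :=
    ite ((hd.softData_T.totalCost h₁).decide_lt (hd.softData_T.totalCost hd.softData_start))
      h₁ hd.softData_start
  have h₃ := hd.snd.snd.pack h₂.map_snd
  exact h₃.fst.map_fst.pair h₃.snd

end PolyTime

/-! ### The fair instance -/

/-- Truncation at `0` would identify all points, hence `0 < B`. -/
theorem IsNatMetric.truncate {n : ℕ} {W : ℕ × ℕ → ℕ} (hW : IsNatMetric n W) {B : ℕ} (hB : 0 < B) :
    IsNatMetric n fun p => min (W p) B where
  eq_zero x hx y hy := by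
    rw [← hW.eq_zero x hx y hy]
    omega
  comm x hx y hy := by simp only [hW.comm x hx y hy]
  triangle x hx y hy z hz := by
    have := hW.triangle x hx y hy z hz
    omega

/-- The metric space given by integral distances. -/
def IsNatMetric.space {n : ℕ} {W : ℕ × ℕ → ℕ} (hW : IsNatMetric n W) : FinMetric where
  n := n
  dist x y := W (x, y)
  dist_eq_zero x y := by
    rw [Nat.cast_eq_zero, hW.eq_zero x x.2 y y.2, Fin.ext_iff]
  dist_comm x y := by rw [hW.comm x x.2 y y.2]
  dist_triangle x y z := by exact_mod_cast hW.triangle x x.2 y y.2 z z.2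

/-- The fair instance with given integral distances and a given list of points. -/
def IsNatMetric.fairInst {n : ℕ} {W : ℕ × ℕ → ℕ} (hW : IsNatMetric n W) (P : List (ℕ × ℕ))
    (hP : ∀ p ∈ P, p.1 < n ∧ p.2 < 2) (k t : ℕ) (ht : 1 ≤ t) : PairwiseFairInst 2 where
  space := hW.space
  N := P.length
  loc p := ⟨(P.get p).1, (hP _ (P.get_mem p)).1⟩
  group p := ⟨(P.get p).2, (hP _ (P.get_mem p)).2⟩
  k := k
  t := t
  one_le_t := ht

theorem IsNatMetric.encode_fairInst {n : ℕ} {W : ℕ × ℕ → ℕ} (hW : IsNatMetric n W)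
    (P : List (ℕ × ℕ)) (hP : ∀ p ∈ P, p.1 < n ∧ p.2 < 2) (k t : ℕ) (ht : 1 ≤ t) :
    (hW.fairInst P hP k t ht).encode = enc (tableMatrix (table n W) (List.range n), P, k, t) := by
  have h₁ : hW.space.matrix = tableMatrix (table n W) (List.range n) := by
    refine List.ofFn_eq_map_range _ _ fun x => List.ofFn_eq_map_range _ _ fun y => ?_
    rw [look_table W x.2 y.2]
    simp [IsNatMetric.space]
  have h₂ : (Data.ofFn fun p => .node (Data.ofNat ((hW.fairInst P hP k t ht).loc p))
      (Data.ofNat ((hW.fairInst P hP k t ht).group p))) = enc P := by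
    have : P = List.ofFn P.get := (List.ofFn_get P).symm
    conv_rhs => rw [this]
    simp only [Data.ofFn, enc, List.map_ofFn]
    rfl
  rw [← h₁]
  change Data.node _ _ = Data.node (enc hW.space.matrix) (Data.node (enc P) _)
  rw [FinMetric.enc_matrix, ← h₂]
  rfl

theorem sum_get {α M : Type*} [AddCommMonoid M] (l : List α) (f : α → M) :
    ∑ i : Fin l.length, f (l.get i) = (l.map f).sum := by
  rw [← List.sum_ofFn]
  congr 1
  conv_rhs => rw [← List.ofFn_get l]
  rw [List.map_ofFn]
  rfl

theorem sum_fairPoints (r : List Bool) (n k : ℕ) (f : ℕ × ℕ → ℕ) :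
    ((fairPoints r (List.range n) k).map f).sum = 2 ^ r.length * ∑ x : Fin n, f (x, 0) +
      ∑ x : Fin n, if (x : ℕ) < k then f (x, 1) else 0 := by
  rw [fairPoints, List.map_append, List.sum_append, List.map_map, List.map_map]
  congr 1
  · have := sum_map_copies (fun x => f (x, 0)) r (List.range n)
    rw [sum_map_range n fun x => f (x, 0)] at this
    exact this
  · rw [← sum_map_range n fun x => if x < k then f (x, 1) else 0]
    induction List.range n with
    | nil => simp
    | cons a l ih =>
      by_cases h : a < k <;> simp_all

theorem mem_fairPoints {r : List Bool} {n k : ℕ} : ∀ p ∈ fairPoints r (List.range n) k,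
    p.1 < n ∧ p.2 < 2 := by
  intro p hp
  rcases List.mem_append.1 hp with hp | hp
  · obtain ⟨x, hx, rfl⟩ := List.mem_map.1 hp
    exact ⟨List.mem_range.1 (mem_copies r _ hx), by simp⟩
  · obtain ⟨x, hx, rfl⟩ := List.mem_map.1 hp
    exact ⟨List.mem_range.1 (List.mem_filter.1 hx).1, by simp⟩

/-- The facilities in use can be enumerated by the points of the second group. -/
theorem SoftCkMSol.exists_enum {I : SoftCkMInst} (S : SoftCkMSol I) (hn : 0 < I.space.n) :
    ∃ h : ℕ → Fin S.numFacilities, (∀ i, ∃ x, S.assign x = h i) ∧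
      ∀ x, ∃ i : Fin I.space.n, (i : ℕ) < I.k ∧ h i = S.assign x := by
  let U := Finset.univ.image S.assign
  refine ⟨fun i => U.toList.getD i (S.assign ⟨0, hn⟩), fun i => ?_, fun x => ?_⟩
  · by_cases hi : i < U.toList.length
    · dsimp only
      rw [List.getD_eq_getElem _ _ hi]
      have : U.toList[i] ∈ U := Finset.mem_toList.1 (List.getElem_mem hi)
      simpa [U] using this
    · dsimp only
      rw [List.getD_eq_default _ _ (by omega)]
      exact ⟨_, rfl⟩
  · have hx : S.assign x ∈ U.toList := by simp [U]
    obtain ⟨i, hi, hix⟩ := List.mem_iff_getElem.1 hx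
    have h₁ : U.toList.length ≤ I.k := by
      rw [Finset.length_toList]
      refine (Finset.card_le_univ U).trans ?_
      simpa using S.numFacilities_le
    have h₂ : U.toList.length ≤ I.space.n := by
      rw [Finset.length_toList]
      exact Finset.card_image_le.trans (by simp)
    refine ⟨⟨i, by omega⟩, by dsimp only; omega, ?_⟩
    dsimp only
    rw [List.getD_eq_getElem _ _ hi, hix]

/-- A capacitated solution gives a fair clustering of the copies. -/
theorem SoftCkMSol.exists_fair {I : SoftCkMInst} (S : SoftCkMSol I) (hn : 0 < I.space.n)
    {W : ℕ × ℕ → ℕ} (hW : IsNatMetric I.space.n W) {B : ℕ} (hB : ∀ p, W p ≤ B)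
    (r : List Bool) (hr : I.space.n ≤ 2 ^ r.length) (ht : 1 ≤ I.u * 2 ^ r.length) :
    ∃ S' : PairwiseFairSol (hW.fairInst (fairPoints r (List.range I.space.n) I.k) mem_fairPoints
        I.k (I.u * 2 ^ r.length) ht),
      (pairwiseFairKMedian 2).cost _ S' ≤
        ((2 ^ r.length * S.natCost W + I.space.n * B : ℕ) : ℚ≥0) := by
  obtain ⟨h, h₁, h₂⟩ := S.exists_enum hn
  set n := I.space.n with hn'
  set M := 2 ^ r.length with hM
  set P := fairPoints r (List.range n) I.k with hP
  -- All copies of a point follow its assignment in `S`; the point of the second group at `x`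
  -- follows the enumeration `h` of the used facilities.
  let φ : ℕ × ℕ → Fin S.numFacilities := fun q =>
    if hq : q.2 = 0 ∧ q.1 < n then S.assign ⟨q.1, hq.2⟩ else h q.1
  have hφ₀ : ∀ x : Fin n, φ (x, 0) = S.assign x := fun x => by simp [φ]
  have hφ₁ : ∀ x : Fin n, φ (x, 1) = h x := fun x => by simp [φ]
  have hcount : ∀ (j : Fin S.numFacilities) (a : Fin 2),
      (Finset.univ.filter fun p : Fin P.length => φ (P.get p) = j ∧
        (⟨(P.get p).2, (mem_fairPoints _ (P.get_mem p)).2⟩ : Fin 2) = a).card =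
      (P.map fun q => if φ q = j ∧ q.2 = a then 1 else 0).sum := by
    intro j a
    rw [Finset.card_filter, ← sum_get]
    refine Finset.sum_congr rfl fun p _ => ?_
    simp only [Fin.ext_iff]
  have hcount₀ : ∀ j : Fin S.numFacilities,
      (P.map fun q => if φ q = j ∧ q.2 = ((0 : Fin 2) : ℕ) then 1 else 0).sum =
      M * (Finset.univ.filter fun x => S.assign x = j).card := by
    intro j
    rw [hP, sum_fairPoints, Finset.card_filter]
    simp only [hφ₀, ← hM]
    simp
    exact .inl rfl
  have hcount₁ : ∀ j : Fin S.numFacilities,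
      (P.map fun q => if φ q = j ∧ q.2 = ((1 : Fin 2) : ℕ) then 1 else 0).sum =
      (Finset.univ.filter fun x : Fin n => (x : ℕ) < I.k ∧ h x = j).card := by
    intro j
    rw [hP, sum_fairPoints, Finset.card_filter]
    simp only [hφ₁]
    simp [ite_and]
  refine ⟨⟨S.numFacilities, S.numFacilities_le, S.facility, fun p => φ (P.get p), ?_⟩, ?_⟩
  · intro j a b
    change (Finset.univ.filter fun p : Fin P.length => φ (P.get p) = j ∧
        (⟨(P.get p).2, (mem_fairPoints _ (P.get_mem p)).2⟩ : Fin 2) = a).card ≤ I.u * M *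
      (Finset.univ.filter fun p : Fin P.length => φ (P.get p) = j ∧
        (⟨(P.get p).2, (mem_fairPoints _ (P.get_mem p)).2⟩ : Fin 2) = b).card
    rw [hcount, hcount]
    have hcap := S.capacity j
    have hcard : (Finset.univ.filter fun x : Fin n => (x : ℕ) < I.k ∧ h x = j).card ≤ n := by
      simpa using Finset.card_le_univ (Finset.univ.filter fun x : Fin n => (x : ℕ) < I.k ∧ h x = j)
    have h₃ : 0 < (Finset.univ.filter fun x => S.assign x = j).card →
        0 < (Finset.univ.filter fun x : Fin n => (x : ℕ) < I.k ∧ h x = j).card := by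
      intro h₃
      obtain ⟨x, hx⟩ := Finset.card_pos.1 h₃
      obtain ⟨i, hi, hix⟩ := h₂ x
      exact Finset.card_pos.2 ⟨i, by simpa [hix, hi] using hx⟩
    have h₄ : 0 < (Finset.univ.filter fun x : Fin n => (x : ℕ) < I.k ∧ h x = j).card →
        0 < (Finset.univ.filter fun x => S.assign x = j).card := by
      intro h₃
      obtain ⟨i, hi⟩ := Finset.card_pos.1 h₃
      obtain ⟨x, hx⟩ := h₁ i
      refine Finset.card_pos.2 ⟨x, ?_⟩
      simp only [Finset.mem_filter, Finset.mem_univ, true_and] at hi ⊢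
      rw [hx, hi.2]
    have h01 : ∀ a : Fin 2, a = 0 ∨ a = 1 := by decide
    rcases h01 a with rfl | rfl <;> rcases h01 b with rfl | rfl
    · exact Nat.le_mul_of_pos_left _ ht
    -- A cluster with clients contains at least one permit and the copies of at most `u` clients.
    · rw [hcount₀, hcount₁]
      generalize (Finset.univ.filter fun x => S.assign x = j).card = p at *
      generalize (Finset.univ.filter fun x : Fin n => (x : ℕ) < I.k ∧ h x = j).card = q at *
      rcases Nat.eq_zero_or_pos p with rfl | hp
      · simp
      · calc M * p ≤ M * I.u := Nat.mul_le_mul_left _ hcap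
          _ = I.u * M * 1 := by ring
          _ ≤ I.u * M * q := Nat.mul_le_mul_left _ (h₃ hp)
    -- Conversely, permits only go to used facilities, and there are at most `n ≤ M` of them.
    · rw [hcount₀, hcount₁]
      generalize (Finset.univ.filter fun x => S.assign x = j).card = p at *
      generalize (Finset.univ.filter fun x : Fin n => (x : ℕ) < I.k ∧ h x = j).card = q at *
      rcases Nat.eq_zero_or_pos q with rfl | hq
      · simp
      · calc q ≤ 1 * (M * 1) := by omega
          _ ≤ I.u * M * (M * p) := Nat.mul_le_mul ht (Nat.mul_le_mul_left _ (h₄ hq))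
    · exact Nat.le_mul_of_pos_left _ ht
  · change ∑ p : Fin P.length, (W ((P.get p).1, S.facility (φ (P.get p))) : ℚ≥0) ≤ _
    rw [← Nat.cast_sum, Nat.cast_le, sum_get P fun q => W (q.1, S.facility (φ q)), hP,
      sum_fairPoints]
    refine Nat.add_le_add ?_ ?_
    · rw [SoftCkMSol.natCost]
      simp only [hφ₀]
      rfl
    · calc _ ≤ ∑ x : Fin n, B := Finset.sum_le_sum fun x _ => by
            split_ifs
            · exact hB _
            · exact Nat.zero_le _
        _ = n * B := by simp

theorem sum_map_filter {α : Type*} (l : List α) (p : α → Bool) (f : α → ℕ) :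
    ((l.filter p).map f).sum = (l.map fun a => if p a = true then f a else 0).sum := by
  induction l with
  | nil => simp
  | cons a l ih => by_cases h : p a = true <;> simp [h, ih]

/-- The encoding of a fair clustering, as lists. -/
def PairwiseFairSol.lists {ℓ : ℕ} {J : PairwiseFairInst ℓ} (S : PairwiseFairSol J) :
    List ℕ × List ℕ :=
  (List.ofFn fun j => (S.center j : ℕ), List.ofFn fun p => (S.assign p : ℕ))

theorem PairwiseFairSol.enc_lists {ℓ : ℕ} {J : PairwiseFairInst ℓ} (S : PairwiseFairSol J) :
    enc S.lists = (pairwiseFairKMedian ℓ).encSol J S := by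
  change Data.node (Data.ofList ((List.ofFn _).map _)) (Data.ofList ((List.ofFn _).map _)) = _
  rw [List.map_ofFn, List.map_ofFn]
  rfl

/-! ### From a fair clustering to a fractional assignment -/

section soundness

variable {n : ℕ} {W : ℕ × ℕ → ℕ} {hW : IsNatMetric n W} {P : List (ℕ × ℕ)}
  {hP : ∀ p ∈ P, p.1 < n ∧ p.2 < 2} {k t : ℕ} {ht : 1 ≤ t}

/-- With `f` an indicator or a distance this yields the degrees, the loads, the range and the cost
of the edges. -/
theorem PairwiseFairSol.sum_fairEdges (S : PairwiseFairSol (hW.fairInst P hP k t ht))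
    (f : ℕ × ℕ → ℕ) :
    ((fairEdges P S.lists).map f).sum = ∑ p : Fin P.length,
      if (P.get p).2 = 0 then f ((P.get p).1, S.center (S.assign p)) else 0 := by
  have hz : P.zipIdx = List.ofFn fun p : Fin P.length => (P.get p, (p : ℕ)) := by
    apply List.ext_getElem
    · simp
    · intro i h₁ h₂
      simp
  rw [fairEdges, List.map_map, sum_map_filter, hz, List.map_ofFn, List.sum_ofFn]
  refine Finset.sum_congr rfl fun p _ => ?_
  have h₁ : S.lists.2.getD p 0 = S.assign p := by
    have hp : (p : ℕ) < S.lists.2.length := by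
      rw [PairwiseFairSol.lists, List.length_ofFn]
      exact p.2
    rw [List.getD_eq_getElem _ _ hp]
    simp only [PairwiseFairSol.lists, List.getElem_ofFn]
    rfl
  have h₂ : S.lists.1.getD (S.assign p) 0 = S.center (S.assign p) := by
    have hp : (S.assign p : ℕ) < S.lists.1.length := by
      rw [PairwiseFairSol.lists, List.length_ofFn]
      exact Fin.is_lt _
    rw [List.getD_eq_getElem _ _ hp]
    simp only [PairwiseFairSol.lists, List.getElem_ofFn]
  simp only [Function.comp_apply, decide_eq_true_eq, h₁, h₂]

theorem PairwiseFairSol.mem_fairEdges (S : PairwiseFairSol (hW.fairInst P hP k t ht)) :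
    ∀ q ∈ fairEdges P S.lists, q.1 < n ∧ q.2 < n := by
  have h := S.sum_fairEdges fun q => if q.1 < n ∧ q.2 < n then 0 else 1
  rw [Finset.sum_eq_zero] at h
  · intro q hq
    have := List.sum_eq_zero_iff.1 h _ (List.mem_map_of_mem hq)
    simpa using this
  · intro p _
    have h₁ : P[(p : ℕ)].1 < n := (hP _ (P.get_mem p)).1
    have h₂ : (S.center (S.assign p) : ℕ) < n := Fin.is_lt _
    simp [h₁, h₂]

theorem PairwiseFairSol.cost_fairEdges_le (S : PairwiseFairSol (hW.fairInst P hP k t ht)) :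
    (((fairEdges P S.lists).map W).sum : ℚ≥0) ≤ (pairwiseFairKMedian 2).cost _ S := by
  rw [S.sum_fairEdges, Nat.cast_sum]
  refine Finset.sum_le_sum fun p _ => ?_
  split_ifs
  · exact le_rfl
  · simp

/-- Here `b c` is the number of points of group `1` in clusters centered at `c`. Several clusters
may share a center, so the fairness inequalities are added over all of them. -/
theorem PairwiseFairSol.countP_snd_fairEdges_le (S : PairwiseFairSol (hW.fairInst P hP k t ht)) :
    ∃ b : ℕ → ℕ, (∀ c < n, ((fairEdges P S.lists).countP fun q => decide (q.2 = c)) ≤ t * b c) ∧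
      ∑ c ∈ Finset.range n, b c = (P.map fun q => if q.2 = 1 then 1 else 0).sum := by
  let num : Fin 2 → Fin S.numClusters → ℕ := fun a j => ∑ p : Fin P.length,
    if S.assign p = j ∧ (hW.fairInst P hP k t ht).group p = a then 1 else 0
  have hnum : ∀ j, num 0 j ≤ t * num 1 j := by
    intro j
    have := S.fair j 0 1
    rw [Finset.card_filter, Finset.card_filter] at this
    exact this
  have hgrp : ∀ (p : Fin P.length) (a : Fin 2), (hW.fairInst P hP k t ht).group p = a ↔
      (P.get p).2 = a := fun p a => Fin.ext_iff
  have hsum : ∀ (a : Fin 2) (c : ℕ), (∑ j, if (S.center j : ℕ) = c then num a j else 0) =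
      ∑ p : Fin P.length, if (P.get p).2 = a ∧ (S.center (S.assign p) : ℕ) = c then 1 else 0 := by
    intro a c
    simp only [num]
    have : ∀ j, (if (S.center j : ℕ) = c then (∑ p : Fin P.length,
        if S.assign p = j ∧ (hW.fairInst P hP k t ht).group p = a then 1 else 0) else 0) =
        ∑ p : Fin P.length, if S.assign p = j then
          (if (P.get p).2 = a ∧ (S.center j : ℕ) = c then 1 else 0) else 0 := by
      intro j
      split_ifs with hj
      · refine Finset.sum_congr rfl fun p _ => ?_
        refine (if_congr (and_congr_right fun _ => hgrp p a) rfl rfl).trans ?_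
        simp [hj, ite_and]
      · simp [hj]
    simp only [this]
    rw [Finset.sum_comm]
    refine Finset.sum_congr rfl fun p _ => ?_
    rw [Finset.sum_ite_eq]
    simp
  refine ⟨fun c => ∑ j, if (S.center j : ℕ) = c then num 1 j else 0, ?_, ?_⟩
  · intro c _
    rw [← List.sum_map_ite_eq_countP, S.sum_fairEdges]
    have h := hsum 0 c
    have h' : ∀ p : Fin P.length, (if (P.get p).2 = ((0 : Fin 2) : ℕ) ∧
        (S.center (S.assign p) : ℕ) = c then 1 else 0) = if (P.get p).2 = 0 then
        (if decide ((S.center (S.assign p) : ℕ) = c) = true then 1 else 0) else 0 := by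
      intro p
      simp [ite_and]
    simp only [h'] at h
    rw [← h, Finset.mul_sum]
    refine Finset.sum_le_sum fun j _ => ?_
    split_ifs
    · exact hnum j
    · simp
  · simp only [hsum]
    rw [Finset.sum_comm, ← sum_get]
    refine Finset.sum_congr rfl fun p _ => ?_
    have h₂ : (S.center (S.assign p) : ℕ) < n := Fin.is_lt _
    simp only [ite_and]
    by_cases h : (P.get p).2 = 1
    · simp only [Fin.val_one, if_pos h]
      rw [Finset.sum_ite_eq]
      simp [h₂]
    · simp only [Fin.val_one, if_neg h]
      simp

end soundness

/-! ### Correctness of the reduction -/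

/-- The solution obtained by packing the assignment `f` into facilities of capacity `u`. -/
theorem SoftCkMSol.exists_of_pack {I : SoftCkMInst} (hu : 1 ≤ I.u) {f : ℕ → ℕ}
    (hf : ∀ x < I.space.n, f x < I.space.n)
    (hk : (pack I.u ((List.range I.space.n).map f)).1.length ≤ I.k) :
    ∃ S : SoftCkMSol I, softCapacitatedKMedian.encSol I S =
        enc ((pack I.u ((List.range I.space.n).map f)).1.map Prod.fst,
          (pack I.u ((List.range I.space.n).map f)).2) ∧
      ∀ x, (S.facility (S.assign x) : ℕ) = f x := by
  set l := (List.range I.space.n).map f with hl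
  have hlen : (pack I.u l).2.length = I.space.n := by
    rw [(length_pack I.u l).1, hl]; simp
  have hget : ∀ x : Fin I.space.n, l.getD x 0 = f x := by
    intro x
    rw [List.getD_eq_getElem _ _ (by simp [hl])]
    simp [hl]
  have hassign : ∀ x : Fin I.space.n, (pack I.u l).2.getD x 0 < (pack I.u l).1.length ∧
      ((pack I.u l).1.getD ((pack I.u l).2.getD x 0) (0, 0)).1 = f x := by
    intro x
    rw [← hget x]
    exact pack_assign I.u l (by simp [hl])
  have hfac : ∀ j : Fin (pack I.u l).1.length, ((pack I.u l).1.get j).1 < I.space.n := by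
    intro j
    obtain ⟨x, hx, hxj⟩ := List.mem_map.1 (mem_pack ((pack I.u l).1.get_mem j)).1
    rw [← hxj]
    exact hf x (List.mem_range.1 hx)
  refine ⟨⟨(pack I.u l).1.length, hk, fun j => ⟨((pack I.u l).1.get j).1, hfac j⟩,
    fun x => ⟨(pack I.u l).2.getD x 0, (hassign x).1⟩, fun j => ?_⟩, ?_, fun x => ?_⟩
  · refine le_trans (le_of_eq ?_) (count_pack_le hu l j)
    have h₁ : (pack I.u l).2 = (List.range I.space.n).map fun x => (pack I.u l).2.getD x 0 := by
      apply List.ext_getElem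
      · simp [hlen]
      · intro i h₁ h₂
        simp [h₁]
    have h₂ := count_map_range I.space.n (fun x => (pack I.u l).2.getD x 0) j
    rw [← h₁] at h₂
    rw [h₂]
    simp only [Fin.ext_iff]
  · change Data.node (Data.ofList (List.ofFn _)) (Data.ofList (List.ofFn _)) =
      Data.node (Data.ofList (List.map _ _)) (Data.ofList (List.map _ _))
    congr 2
    · conv_rhs => rw [← List.ofFn_get (pack I.u l).1]
      rw [List.map_ofFn, List.map_ofFn]
      rfl
    · apply List.ext_getElem
      · simp [hlen]
      · intro i h₁ h₂
        have : i < (pack I.u l).2.length := by simpa using h₂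
        simp [this]
        rfl
  · have h := (hassign x).2
    rw [List.getD_eq_getElem _ _ (hassign x).1] at h
    exact h

/-- `look` selects one edge of `E` for each point. These are distinct, so they form a sub-multiset
of `E`. -/
theorem sum_look_le {E : List (ℕ × ℕ)} {n : ℕ} (hE : ∀ x < n, ∃ p ∈ E, p.1 = x)
    (F : ℕ × ℕ → ℕ) :
    (((List.range n).map fun x => (x, look E x)).map F).sum ≤ (E.map F).sum := by
  have h : List.Subperm ((List.range n).map fun x => (x, look E x)) E := by
    refine List.subperm_of_subset (List.Nodup.map (fun a b h => (Prod.ext_iff.1 h).1)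
      List.nodup_range) ?_
    intro p hp
    obtain ⟨x, hx, rfl⟩ := List.mem_map.1 hp
    exact look_mem (hE x (List.mem_range.1 hx))
  obtain ⟨l, h₁, h₂⟩ := h
  rw [← (h₁.map F).sum_eq]
  exact (h₂.map F).sum_le_sum fun _ _ => Nat.zero_le _

theorem PairwiseFairSol.countP_fst_fairEdges {n : ℕ} {W : ℕ × ℕ → ℕ} {hW : IsNatMetric n W}
    {r : List Bool} {k t : ℕ} {ht : 1 ≤ t}
    (S : PairwiseFairSol (hW.fairInst (fairPoints r (List.range n) k) mem_fairPoints k t ht))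
    {x : ℕ} (hx : x < n) :
    ((fairEdges (fairPoints r (List.range n) k) S.lists).countP fun q => decide (q.1 = x)) =
      2 ^ r.length := by
  rw [← List.sum_map_ite_eq_countP, S.sum_fairEdges]
  rw [sum_get (fairPoints r (List.range n) k) fun q => if q.2 = 0 then
    (if decide (q.1 = x) = true then 1 else 0) else 0, sum_fairPoints]
  obtain ⟨x, rfl⟩ : ∃ x' : Fin n, (x' : ℕ) = x := ⟨⟨x, hx⟩, rfl⟩
  simp [← Fin.ext_iff]

/-- Rounding a fair clustering of the copies to an assignment of the points. -/
theorem PairwiseFairSol.rounded_spec {n : ℕ} {W : ℕ × ℕ → ℕ} {hW : IsNatMetric n W}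
    {r : List Bool} {k u : ℕ} {ht : 1 ≤ u * 2 ^ r.length} (hu : 1 ≤ u)
    (S : PairwiseFairSol (hW.fairInst (fairPoints r (List.range n) k) mem_fairPoints k
      (u * 2 ^ r.length) ht)) :
    ∃ h : ℕ → ℕ, (∀ x, look (halvings (look (table n W)) r
        (fairEdges (fairPoints r (List.range n) k) S.lists)) x = h x) ∧
      (∀ x < n, h x < n) ∧ (pack u ((List.range n).map h)).1.length ≤ k ∧
      ((2 ^ r.length * ∑ x : Fin n, W (x, h x) : ℕ) : ℚ≥0) ≤ (pairwiseFairKMedian 2).cost _ S := by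
  set E₀ := fairEdges (fairPoints r (List.range n) k) S.lists with hE₀
  set E₁ := halvings (look (table n W)) r E₀ with hE₁
  have hmem₀ : ∀ q ∈ E₀, q.1 < n ∧ q.2 < n := S.mem_fairEdges
  have hmem₁ : ∀ q ∈ E₁, q.1 < n ∧ q.2 < n := fun q hq => hmem₀ q (mem_of_mem_halvings _ hq)
  have hex : ∀ x < n, ∃ p ∈ E₁, p.1 = x := by
    intro x hx
    -- The number of halvings is the logarithm of the number of copies, so exactly one edge per
    -- point remains.
    have h₁ : (E₁.countP fun q => decide (q.1 = x)) = 1 := by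
      refine countP_fst_halvings _ r E₀ ?_
      rw [mul_one]
      exact S.countP_fst_fairEdges hx
    obtain ⟨p, hp, hpx⟩ := List.countP_pos_iff.1 (by omega : 0 < E₁.countP fun q => decide (q.1 = x))
    exact ⟨p, hp, by simpa using hpx⟩
  have hlt : ∀ x < n, look E₁ x < n := fun x hx => (hmem₁ _ (look_mem (hex x hx))).2
  refine ⟨look E₁, fun _ => rfl, hlt, ?_, ?_⟩
  · obtain ⟨b, hb, hbs⟩ := S.countP_snd_fairEdges_le
    refine (length_pack_le hu (n := n) (b := b) ?_ ?_).trans ?_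
    · intro c hc
      obtain ⟨x, hx, rfl⟩ := List.mem_map.1 hc
      exact hlt x (List.mem_range.1 hx)
    · intro c hc
      have h₁ := sum_look_le hex fun q => if decide (q.2 = c) = true then 1 else 0
      rw [List.sum_map_ite_eq_countP, List.sum_map_ite_eq_countP, List.countP_map] at h₁
      have h₂ : ((List.range n).map (look E₁)).count c ≤ E₁.countP fun q => decide (q.2 = c) := by
        rw [List.count, List.countP_map]
        refine le_trans (le_of_eq (List.countP_congr fun x _ => ?_)) h₁
        simp
      refine h₂.trans (countP_snd_halvings_le _ r E₀ ((hb c hc).trans (le_of_eq ?_)))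
      ring
    · rw [hbs, sum_fairPoints]
      simp only [if_true, zero_ne_one, if_false,
        Finset.sum_const_zero, mul_zero, zero_add]
      rw [← Finset.card_filter]
      have : (Finset.univ.filter fun x : Fin n => (x : ℕ) < k).card ≤ (Finset.range k).card :=
        Finset.card_le_card_of_injOn (fun x => (x : ℕ)) (fun x hx => by simpa using hx)
          (fun a _ b _ h => Fin.ext h)
      simpa using this
  · refine le_trans ?_ S.cost_fairEdges_le
    rw [Nat.cast_le]
    have h₁ := cost_halvings (look (table n W)) r E₀
    change _ * totalCost (table n W) E₁ ≤ totalCost (table n W) E₀ at h₁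
    rw [totalCost_table W hmem₁, totalCost_table W hmem₀] at h₁
    have h₂ := sum_look_le hex W
    rw [List.map_map] at h₂
    have h₃ := sum_map_range n (W ∘ fun x => (x, look E₁ x))
    rw [h₃] at h₂
    exact (Nat.mul_le_mul_left _ h₂).trans h₁

/-- An instance as lists. -/
def SoftCkMInst.data (I : SoftCkMInst) : SoftData := (I.space.matrix, I.k, I.u)

theorem SoftCkMInst.enc_data (I : SoftCkMInst) : enc I.data = I.encode := by
  change Data.node (enc I.space.matrix) _ = _
  rw [FinMetric.enc_matrix]
  rfl

theorem SoftCkMInst.idx_data (I : SoftCkMInst) : I.data.idx = List.range I.space.n := by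
  rw [SoftData.idx, indices_eq]
  simp [data, FinMetric.matrix]

theorem le_two_pow_logCopies (c n : ℕ) :
    n ^ 3 * 2 ^ c ≤ 2 ^ (logCopies c (List.range n)).length := by
  rw [two_pow_logCopies, List.length_range]
  gcongr
  exact (Nat.lt_size_self n).le

/-- The reduction: the fair instance, and the solution obtained from an approximate solution of
the fair instance. -/
theorem SoftCkMInst.exists_fairInst (I : SoftCkMInst) (hn : 0 < I.space.n)
    (hk : I.space.n ≤ I.k * I.u) {ε : ℝ} {c : ℕ} (hc : 2 ≤ ε * 2 ^ c) :
    ∃ J : PairwiseFairInst 2, J.encode = enc (I.data.fair c) ∧ J.k = I.k ∧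
      Nonempty (PairwiseFairSol J) ∧ ∀ (a : ℝ) (S : PairwiseFairSol J), 0 ≤ a →
        (∀ S' : PairwiseFairSol J, ((pairwiseFairKMedian 2).cost J S : ℝ) ≤ a * (pairwiseFairKMedian 2).cost J S') →
        ∃ R : SoftCkMSol I, softCapacitatedKMedian.encSol I R = enc (I.data.result c S.lists) ∧
          ∀ R' : SoftCkMSol I, (softCapacitatedKMedian.cost I R : ℝ) ≤
            (1 + ε) * a * softCapacitatedKMedian.cost I R' := by
  have hu : 1 ≤ I.u := by
    rcases Nat.eq_zero_or_pos I.u with h | h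
    · rw [h] at hk; omega
    · exact h
  obtain ⟨L, W, hL, hT, hW, hWd⟩ := I.space.exists_natMetric
  obtain ⟨f, hf₁, hf₂, hf₃, hf₄⟩ := fallback_spec hW hn hu hk
  have hT' : I.data.T = table I.space.n W := hT
  have hstart : I.data.start = (List.range I.space.n).map fun x => (x, f x) := by
    rw [← hf₁, SoftData.start, hT', I.idx_data]
    rfl
  have hcost : ∀ g : ℕ → ℕ, (∀ x < I.space.n, g x < I.space.n) → totalCost I.data.T
      ((List.range I.space.n).map fun x => (x, g x)) = ∑ x : Fin I.space.n, W (x, g x) := by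
    intro g hg
    rw [hT', totalCost_table, List.map_map, sum_map_range]
    · rfl
    · intro p hp
      obtain ⟨x, hx, rfl⟩ := List.mem_map.1 hp
      rw [List.mem_range] at hx
      exact ⟨hx, hg x hx⟩
  set F := ∑ x : Fin I.space.n, W (x, f x) with hF
  set r := logCopies c (List.range I.space.n) with hr
  -- The `+ 1` keeps distinct points apart when `F = 0` and makes every truncated distance exceed
  -- `F`.
  have hW' := hW.truncate (B := F + 1) (by omega)
  have hTT : I.data.T' = table I.space.n fun p => min (W p) (F + 1) := by
    rw [SoftData.T', hstart, hcost f hf₂, hT', truncate_table]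
  have hM := le_two_pow_logCopies c I.space.n
  rw [← hr] at hM
  have hnM : I.space.n ≤ 2 ^ r.length := by
    refine le_trans ?_ hM
    calc I.space.n = I.space.n ^ 1 * 1 := by simp
      _ ≤ I.space.n ^ 3 * 2 ^ c :=
        Nat.mul_le_mul (Nat.pow_le_pow_right hn (by omega)) Nat.one_le_two_pow
  have ht : 1 ≤ I.u * 2 ^ r.length := Nat.mul_pos hu (Nat.two_pow_pos _)
  have hfair : I.data.fair c = (tableMatrix (table I.space.n fun p => min (W p) (F + 1))
      (List.range I.space.n), fairPoints r (List.range I.space.n) I.k, I.k, I.u * 2 ^ r.length) := by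
    rw [SoftData.fair, hTT, I.idx_data, ← hr, shift_eq]
    rfl
  have hB : ∀ p, min (W p) (F + 1) ≤ F + 1 := fun p => min_le_right _ _
  obtain ⟨R₀, _, _⟩ := SoftCkMSol.exists_of_pack hu hf₂ hf₃
  refine ⟨hW'.fairInst (fairPoints r (List.range I.space.n) I.k) mem_fairPoints I.k
    (I.u * 2 ^ r.length) ht, ?_, rfl, ?_, ?_⟩
  · rw [hfair, IsNatMetric.encode_fairInst]
  · obtain ⟨S, _⟩ := R₀.exists_fair hn hW' hB r hnM ht
    exact ⟨S⟩
  intro a S ha hS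
  obtain ⟨h, hh₁, hh₂, hh₃, hh₄⟩ := S.rounded_spec hu
  have hround : I.data.rounded c S.lists = (List.range I.space.n).map fun x => (x, h x) := by
    rw [SoftData.rounded, hTT, I.idx_data, ← hr, hfair]
    simp only [hh₁]
  obtain ⟨g, hg₁, hg₂, hg₃, hg₄, hg₅⟩ : ∃ g : ℕ → ℕ, I.data.final c S.lists =
      ((List.range I.space.n).map fun x => (x, g x)) ∧ (∀ x < I.space.n, g x < I.space.n) ∧
      (pack I.u ((List.range I.space.n).map g)).1.length ≤ I.k ∧
      ∑ x : Fin I.space.n, W (x, g x) ≤ ∑ x : Fin I.space.n, W (x, h x) ∧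
      ∑ x : Fin I.space.n, W (x, g x) ≤ F := by
    rw [SoftData.final, hround, hstart, hcost h hh₂, hcost f hf₂]
    split_ifs with hlt
    · exact ⟨h, rfl, hh₂, hh₃, le_rfl, hlt.le⟩
    · exact ⟨f, rfl, hf₂, hf₃, not_lt.1 hlt, le_rfl⟩
  obtain ⟨R, hR₁, hR₂⟩ := SoftCkMSol.exists_of_pack hu hg₂ hg₃
  refine ⟨R, ?_, fun R' => ?_⟩
  · rw [hR₁, SoftData.result, hg₁, List.map_map]
    rfl
  have hnat : ∀ Q : SoftCkMSol I,
      (Q.natCost W : ℝ) = L * (softCapacitatedKMedian.cost I Q : ℝ) := by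
    intro Q
    have : (Q.natCost W : ℚ≥0) = L * softCapacitatedKMedian.cost I Q := by
      rw [SoftCkMSol.natCost, Nat.cast_sum]
      change _ = _ * ∑ x, I.space.dist x (Q.facility (Q.assign x))
      rw [Finset.mul_sum]
      exact Finset.sum_congr rfl fun x _ => hWd _ _
    exact_mod_cast congrArg (fun q : ℚ≥0 => (q : ℝ)) this
  have hLpos : (0 : ℝ) < L := by exact_mod_cast hL
  suffices hmain : (R.natCost W : ℝ) ≤ (1 + ε) * a * R'.natCost W by
    have h₁ := hnat R
    have h₂ := hnat R'
    rw [h₁, h₂] at hmain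
    refine le_of_mul_le_mul_left (hmain.trans (le_of_eq ?_)) hLpos
    ring
  have hRg : R.natCost W = ∑ x : Fin I.space.n, W (x, g x) := by
    simp only [SoftCkMSol.natCost, hR₂]
  have hF' := hf₄ R'
  -- If the optimum vanishes, so does `F`, and the returned solution costs nothing; otherwise the
  -- integral cost is at least 1.
  rcases Nat.eq_zero_or_pos (R'.natCost W) with hzero | hpos
  · rw [hzero, mul_zero] at hF'
    rw [hzero, hRg, Nat.le_zero.1 (hg₅.trans hF')]
    simp
  -- If the truncated cost of the rounded assignment is at most `F`, no distance in it was truncated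
  -- and it has the same true cost. Otherwise the fallback is cheaper than the truncated cost.
  have htrunc : R.natCost W ≤ ∑ x : Fin I.space.n, min (W (x, h x)) (F + 1) := by
    rw [hRg]
    by_cases hle : ∑ x : Fin I.space.n, min (W (x, h x)) (F + 1) ≤ F
    · refine hg₄.trans (Finset.sum_le_sum fun x hx => ?_)
      have := Finset.single_le_sum (f := fun x : Fin I.space.n => min (W (x, h x)) (F + 1))
        (fun _ _ => Nat.zero_le _) hx
      omega
    · omega
  obtain ⟨S', hS'⟩ := R'.exists_fair hn hW' hB r hnM ht
  have h₁ := hS S'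
  set M := 2 ^ r.length with hMdef
  have h₂ : ((M * R.natCost W : ℕ) : ℝ) ≤ (pairwiseFairKMedian 2).cost _ S := by
    have : ((M * R.natCost W : ℕ) : ℚ≥0) ≤ (pairwiseFairKMedian 2).cost _ S :=
      le_trans (by exact_mod_cast Nat.mul_le_mul_left M htrunc) hh₄
    exact_mod_cast this
  have h₃ : ((pairwiseFairKMedian 2).cost _ S' : ℝ) ≤
      ((M * R'.natCost W + 2 * I.space.n ^ 3 * R'.natCost W : ℕ) : ℝ) := by
    have hle : R'.natCost (fun p => min (W p) (F + 1)) ≤ R'.natCost W :=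
      Finset.sum_le_sum fun x _ => min_le_left _ _
    have hle' : I.space.n * (F + 1) ≤ 2 * I.space.n ^ 3 * R'.natCost W := by
      -- As this product is at least 1 and bounds `F`, its double bounds `F + 1`.
      have h₁ : 1 ≤ I.space.n * I.space.n * R'.natCost W := Nat.mul_pos (Nat.mul_pos hn hn) hpos
      calc I.space.n * (F + 1) ≤ I.space.n * (2 * (I.space.n * I.space.n * R'.natCost W)) :=
            Nat.mul_le_mul_left _ (by omega)
        _ = _ := by ring
    have := hS'.trans (Nat.cast_le.2 (Nat.add_le_add (Nat.mul_le_mul_left M hle) hle'))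
    exact_mod_cast this
  have hMpos : (0 : ℝ) < M := by exact_mod_cast Nat.two_pow_pos r.length
  have hεM : 2 * (I.space.n : ℝ) ^ 3 ≤ ε * M := by
    have hM' : (I.space.n : ℝ) ^ 3 * 2 ^ c ≤ M := by exact_mod_cast hM
    have hε : 0 ≤ ε := by
      by_contra hneg
      have : ε * 2 ^ c ≤ 0 := mul_nonpos_of_nonpos_of_nonneg (not_le.1 hneg).le (by positivity)
      linarith
    calc 2 * (I.space.n : ℝ) ^ 3 ≤ (ε * 2 ^ c) * (I.space.n : ℝ) ^ 3 := by gcongr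
      _ = ε * ((I.space.n : ℝ) ^ 3 * 2 ^ c) := by ring
      _ ≤ ε * M := by gcongr
  refine le_of_mul_le_mul_left ?_ hMpos
  have h₄ := h₂.trans (h₁.trans (mul_le_mul_of_nonneg_left h₃ ha))
  push_cast at h₄
  calc (M : ℝ) * R.natCost W
      ≤ a * (M * R'.natCost W + 2 * (I.space.n : ℝ) ^ 3 * R'.natCost W) := h₄
    _ ≤ a * (M * R'.natCost W + ε * M * R'.natCost W) := by gcongr
    _ = _ := by ring

/-! ### The approximation algorithm -/

instance : Enc SoftCkMInst := ⟨SoftCkMInst.encode⟩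

instance {ℓ : ℕ} : Enc (PairwiseFairInst ℓ) := ⟨PairwiseFairInst.encode⟩

/-- The test for feasibility of nonempty instances. -/
def SoftCkMInst.feasible (I : SoftCkMInst) : Bool :=
  decide (0 < I.data.1.length) && decide (I.data.1.length ≤ I.data.2.1 * I.data.2.2)

theorem PolyTime.softData : PolyTime SoftCkMInst.data := .of_enc_eq SoftCkMInst.enc_data

theorem PolyTime.feasible : PolyTime SoftCkMInst.feasible :=
  ((PolyTime.const 0).decide_lt PolyTime.softData.fst.length).and
    (PolyTime.softData.fst.length.decide_le (PolyTime.softData.snd.fst.mul PolyTime.softData.snd.snd))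

theorem SoftCkMInst.feasible_iff (I : SoftCkMInst) :
    I.feasible = true ↔ 0 < I.space.n ∧ I.space.n ≤ I.k * I.u := by
  have : I.data.1.length = I.space.n := by simp [data, FinMetric.matrix]
  rw [feasible, this, Bool.and_eq_true, decide_eq_true_eq, decide_eq_true_eq]
  rfl

theorem SoftCkMSol.card_le {I : SoftCkMInst} (S : SoftCkMSol I) : I.space.n ≤ I.k * I.u := by
  have h : (Finset.univ : Finset (Fin I.space.n)).card ≤
      I.u * (Finset.univ : Finset (Fin S.numFacilities)).card := by
    refine Finset.card_le_mul_card_image_of_maps_to (f := S.assign) (fun _ _ => Finset.mem_univ _) _ ?_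
    exact fun j _ => S.capacity j
  rw [Finset.card_fin, Finset.card_fin, mul_comm] at h
  exact h.trans (Nat.mul_le_mul_right _ S.numFacilities_le)

/-- An approximation algorithm, as a function on the feasible instances. -/
theorem exists_polyTime_of_hasPolyTimeApprox {α : PairwiseFairInst 2 → ℝ}
    (h : (pairwiseFairKMedian 2).HasPolyTimeApprox α) :
    ∃ A : {J : PairwiseFairInst 2 // Nonempty (PairwiseFairSol J)} → List ℕ × List ℕ,
      PolyTime A ∧ ∀ J : {J : PairwiseFairInst 2 // Nonempty (PairwiseFairSol J)},
        ∃ S : PairwiseFairSol J.1, A J = S.lists ∧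
        ∀ S' : PairwiseFairSol J.1, ((pairwiseFairKMedian 2).cost J.1 S : ℝ) ≤
          α J.1 * (pairwiseFairKMedian 2).cost J.1 S' := by
  obtain ⟨c, p, hc⟩ := h
  -- On an infeasible instance the output need not encode any solution, so the algorithm becomes a
  -- function on feasible instances only.
  choose y m hy hm hS using hc
  choose S hS₁ hS₂ using hS
  refine ⟨fun J => PairwiseFairSol.lists (S J.1 J.2), ?_, fun J => ⟨S J.1 J.2, rfl, hS₂ J.1 J.2⟩⟩
  refine ⟨.seq c (.clear c.bound), fun J => p.eval (sz J) + (2 + 2 * c.bound),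
    (PolyBdd.sz.eval p).add (.const _), fun J => ⟨m J.1 + (2 + 2 * c.bound), ?_, ?_⟩⟩
  · exact Nat.add_le_add_right (hm J.1) _
  · have := (hy J.1).exec_init
    have e : enc (PairwiseFairSol.lists (S J.1 J.2)) =
        (pairwiseFairKMedian 2).encSol J.1 (S J.1 J.2) := PairwiseFairSol.enc_lists _
    rw [hS₁ J.1 J.2] at this
    change Exec _ _ (Store.init (enc (PairwiseFairSol.lists (S J.1 J.2)))) _
    rw [e]
    exact this

theorem MinProblem.hasPolyTimeApprox_of_polyTime {F : SoftCkMInst → List ℕ × List ℕ}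
    (hF : PolyTime F) {α : SoftCkMInst → ℝ}
    (h : ∀ I, Nonempty (SoftCkMSol I) → ∃ S : SoftCkMSol I,
      enc (F I) = softCapacitatedKMedian.encSol I S ∧
        ∀ S' : SoftCkMSol I, (softCapacitatedKMedian.cost I S : ℝ) ≤
          α I * softCapacitatedKMedian.cost I S') :
    softCapacitatedKMedian.HasPolyTimeApprox α := by
  obtain ⟨c, t, ⟨p, hp⟩, hc⟩ := hF
  refine ⟨c, p, fun I => ?_⟩
  obtain ⟨m, hm, he⟩ := hc I
  exact ⟨enc (F I), m, ⟨_, he, by simp [Store.init]⟩, hm.trans (hp I), h I⟩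

theorem theorem2 (α : ℕ → ℝ) (hα : ∀ k, 1 ≤ α k)
    (h : (pairwiseFairKMedian 2).HasPolyTimeApprox
      fun I : PairwiseFairInst 2 => α I.k) :
    ∀ ε : ℝ, 0 < ε →
      softCapacitatedKMedian.HasPolyTimeApprox
        fun I : SoftCkMInst => (1 + ε) * α I.k := by
  intro ε hε
  obtain ⟨c, hc⟩ : ∃ c : ℕ, 2 ≤ ε * 2 ^ c := by
    obtain ⟨c, hc⟩ := pow_unbounded_of_one_lt (2 / ε) (one_lt_two : (1 : ℝ) < 2)
    refine ⟨c, ?_⟩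
    rw [div_lt_iff₀ hε] at hc
    linarith
  obtain ⟨A, hA, hAS⟩ := exists_polyTime_of_hasPolyTimeApprox h
  have hex : ∀ I : {I : SoftCkMInst // I.feasible = true}, _ := fun I =>
    I.1.exists_fairInst (I.1.feasible_iff.1 I.2).1 (I.1.feasible_iff.1 I.2).2 hc
  choose J hJ₁ hJ₂ hJ₃ hJ₄ using hex
  -- The instance `J I` was obtained by choice, but its encoding is that of the computable `fair`
  -- data.
  have hJ : PolyTime fun I => (⟨J I, hJ₃ I⟩ : {J // Nonempty (PairwiseFairSol J)}) :=
    (PolyTime.softData_fair c (PolyTime.softData.comp PolyTime.subtype_val)).congr_enc hJ₁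
  have hres := PolyTime.softData_result c (PolyTime.softData.comp
    (PolyTime.subtype_val (P := fun I : SoftCkMInst => I.feasible = true))) (hA.comp hJ)
  refine MinProblem.hasPolyTimeApprox_of_polyTime
    (PolyTime.dite PolyTime.feasible hres (PolyTime.const ([], []))) ?_
  rintro I ⟨S₀⟩
  by_cases hI : I.feasible = true
  · rw [dif_pos hI]
    obtain ⟨S, hS₁, hS₂⟩ := hAS ⟨J ⟨I, hI⟩, hJ₃ ⟨I, hI⟩⟩
    dsimp only at hS₁ hS₂
    -- Since `k` is unchanged, the guarantee for the fair instance is `α I.k`.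
    rw [hJ₂] at hS₂
    obtain ⟨R, hR₁, hR₂⟩ := hJ₄ ⟨I, hI⟩ (α I.k) S (zero_le_one.trans (hα _)) hS₂
    refine ⟨R, ?_, hR₂⟩
    rw [hR₁, hS₁]
  · rw [dif_neg hI]
    -- A solvable instance that fails the test has no points; the empty lists then encode the
    -- solution without facilities, of cost zero.
    have hn : I.space.n = 0 := by
      by_contra hn
      exact hI (I.feasible_iff.2 ⟨Nat.pos_of_ne_zero hn, S₀.card_le⟩)
    have : IsEmpty (Fin I.space.n) := by rw [hn]; infer_instance
    refine ⟨⟨0, Nat.zero_le _, fun j => j.elim0, fun x => isEmptyElim x, fun j => j.elim0⟩, ?_, ?_⟩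
    · change _ = Data.node (Data.ofList (List.ofFn _)) (Data.ofList (List.ofFn _))
      rw [List.ofFn_zero, List.ofFn_eq_map, List.eq_nil_of_length_eq_zero
        (show (List.finRange I.space.n).length = 0 by simp [hn])]
      rfl
    · intro S'
      change ((∑ x : Fin I.space.n, _ : ℚ≥0) : ℝ) ≤ _ * ((∑ x : Fin I.space.n, _ : ℚ≥0) : ℝ)
      simp
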